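/- There is an algorithm that, given a temporal graph $\mathcal G=(G,\lambda)$ with at least one time-edge, an integer $\Delta\ge 1$ and an integer $h\ge 0$, decides in time $$(n\Lambda)^{O(1)}\,(\phi\Delta)^{O(\phi^3)}$$ whether $\mathcal G$ has a $\Delta$-temporal matching of cardinality at least $h$. Here $n$ is the number of vertices, $\Lambda$ the lifetime and $\phi$ the tree-interval-membership (TIM) width of $\mathcal G$, the constants hidden in the $O(\cdot)$ are absolute, and no decomposition of $\mathcal G$ is given to the algorithm. Definitions. A temporal graph $(G,\lambda)$ consists of a finite simple graph $G=(V,E)$ and a map $\lambda$ that assigns to each edge a finite set of positive integers, the times at which it is active. A time-edge is a pair $(e,t)$ with $e\in E$ and $t\in\lambda(e)$; the lifetime $\Lambda$ is the latest time at which an edge is active. A $\Delta$-temporal matching is a set $M$ of time-edges such that any two distinct $(e,t),(e',t')\in M$ satisfy $e\cap e'=\emptyset$ or $|t-t'|\ge\Delta$. A TIM decomposition is a finite directed tree $T$ (an orientation of a tree) with a bag $B(s)\subseteq V$ and a time $\tau(s)\in\{1,\dots,\Lambda\}$ for each node $s$, such that (1) for all $v\in V$ and $t\in\{1,\dots,\Lambda\}$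 there is a unique node $s$ with $\tau(s)=t$ and $v\in B(s)$; (2) for every time-edge $(uv,t)$ there is a unique node $s$ with $\{u,v\}\subseteq B(s)$ and $\tau(s)=t$; (3) the arcs of $T$ are exactly the pairs $(i,j)$ with $B(i)\cap B(j)\neq\emptyset$ and $\tau(j)=\tau(i)+1$. Its width is $\max_s|B(s)|$, and $\phi$ is the least width of a TIM decomposition of $\mathcal G$. Time is the number of steps of a program with unit-cost arithmetic (addition, subtraction) on natural numbers, written in a first-order functional language on natural numbers and pairs in which every construct costs one step; this is, up to a constant factor, an upper bound on the time on a random access machine with the same arithmetic. -/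

import Mathlib

/-!
Temporal graphs, tree-interval-membership width, temporal matchings, and a programming language
with a step count.
-/

/-! ### Temporal graphs -/

/-- A temporal graph on the vertex set `V`: the underlying static graph and, for each of its edges,
the finite set of times at which it is active. Times are positive integers. The temporal assignment
is extended by `∅` to the pairs that are not edges. -/
structure TemporalGraph (V : Type*) where
  /-- the underlying graph -/
  graph : SimpleGraph V
  /-- the temporal assignment -/
  label : Sym2 V → Finset ℕ
  mem_edgeSet_of_mem_label : ∀ e, ∀ t ∈ label e, e ∈ graph.edgeSet
  one_le_of_mem_label : ∀ e, ∀ t ∈ label e, 1 ≤ t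

namespace TemporalGraph

variable {V : Type*}

/-- The time-edges: pairs of an edge and a time at which it is active. -/
def timeEdges (G : TemporalGraph V) : Set (Sym2 V × ℕ) :=
  {p | p.2 ∈ G.label p.1}

/-- The lifetime: the latest time at which an edge is active. -/
def lifetime [Fintype V] [DecidableEq V] (G : TemporalGraph V) : ℕ :=
  (Finset.univ : Finset (Sym2 V)).sup fun e => (G.label e).sup id

/-- A tree-interval-membership decomposition of `G`, with its nodes taken from the type `N`. -/
structure TIMDecomposition [Fintype V] [DecidableEq V] (G : TemporalGraph V) (N : Type) where
  /-- the directed graph on the nodes -/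
  T : Digraph N
  /-- the bag of a node -/
  bag : N → Finset V
  /-- the time of (the bag of) a node -/
  time : N → ℕ
  time_mem : ∀ i, time i ∈ Set.Icc 1 G.lifetime
  existsUnique_vertex : ∀ v : V, ∀ t ∈ Set.Icc 1 G.lifetime, ∃! i, time i = t ∧ v ∈ bag i
  existsUnique_timeEdge : ∀ p ∈ G.timeEdges, ∃! i, (∀ v ∈ p.1, v ∈ bag i) ∧ time i = p.2
  adj_iff : ∀ i j, T.Adj i j ↔ (bag i ∩ bag j).Nonempty ∧ time j = time i + 1
  /-- `T` is a directed tree: forgetting the directions of the arcs leaves a tree -/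
  isTree : (SimpleGraph.fromRel T.Adj).IsTree

/-- The width of a decomposition: the cardinality of a largest bag. -/
def TIMDecomposition.width [Fintype V] [DecidableEq V] {G : TemporalGraph V} {N : Type} [Fintype N]
    (D : G.TIMDecomposition N) : ℕ :=
  (Finset.univ : Finset N).sup fun i => (D.bag i).card

/-- The TIM width: the least width of a (finite) TIM decomposition. -/
noncomputable def timWidth [Fintype V] [DecidableEq V] (G : TemporalGraph V) : ℕ :=
  sInf {w | ∃ (N : Type) (_ : Fintype N) (D : G.TIMDecomposition N), D.width = w}

/-- `M` is a `Δ`-temporal matching of `G`: a set of time-edges of `G`, any two distinct ones of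
which have no common endpoint or are at least `Δ` apart in time. -/
def IsTemporalMatching (G : TemporalGraph V) (Δ : ℕ) (M : Finset (Sym2 V × ℕ)) : Prop :=
  (∀ p ∈ M, p ∈ G.timeEdges) ∧
    ∀ p ∈ M, ∀ q ∈ M, p ≠ q → (∀ v, ¬ (v ∈ p.1 ∧ v ∈ q.1)) ∨ (Δ : ℤ) ≤ |(p.2 : ℤ) - (q.2 : ℤ)|

/-- The question of the decision problem `Δ`-Temporal Matching. -/
def HasTemporalMatching (G : TemporalGraph V) (Δ h : ℕ) : Prop :=
  ∃ M : Finset (Sym2 V × ℕ), G.IsTemporalMatching Δ M ∧ h ≤ M.card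

end TemporalGraph

/-! ### Programs and their running time

Programs are written in a strict first-order functional language with recursion, whose data are
natural numbers and pairs (as in pure Lisp). Each construct costs one step. Pairs are passed by
reference, the arithmetic operations are addition and truncated subtraction, and at any moment the
number of variables in scope is bounded in terms of the program alone; so each step is a bounded
number of operations of a random access machine with unit-cost addition and subtraction, and a time
bound in this language is, up to a constant factor, a time bound on such a machine. -/

namespace FunProg

/-- The data: natural numbers and pairs. -/
inductive Data where
  | num (n : ℕ)
  | pair (a b : Data)

namespace Data

/-- The number held by a datum (`0` for a pair). -/
def val : Data → ℕ
  | num n => n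
  | pair _ _ => 0

/-- The first component of a pair (`0` for a number). -/
def fst : Data → Data
  | num _ => num 0
  | pair a _ => a

/-- The second component of a pair (`0` for a number). -/
def snd : Data → Data
  | num _ => num 0
  | pair _ b => b

/-- The test for pairs: `1` for a pair, `0` for a number. -/
def isPair : Data → Data
  | num _ => num 0
  | pair _ _ => num 1

/-- A finite list as nested pairs `(a₁, (a₂, (…, (aₘ, 0))))`. -/
def ofList : List Data → Data
  | [] => num 0
  | a :: l => pair a (ofList l)

end Data

/-- Terms. Variables are de Bruijn indices; `call f e` applies the `f`-th function of the program to
the value of `e`; `ite e a b` continues with `b` if `e` has the value `0` and with `a` otherwise. -/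
inductive Term where
  | var (i : ℕ)
  | const (n : ℕ)
  | pair (a b : Term)
  | fst (a : Term)
  | snd (a : Term)
  | isPair (a : Term)
  | add (a b : Term)
  | sub (a b : Term)
  | ite (e a b : Term)
  | letIn (a b : Term)
  | call (f : ℕ) (a : Term)

/-- A program: a finite list of function bodies. A body has one free variable, the argument of the
function. The first function is the main one. -/
abbrev Program := List Term

/-- `Eval P ρ e d k`: with the functions of the program `P` and the values `ρ` of the variables, the
evaluation of the term `e` terminates with the value `d` after `k` steps. -/
inductive Eval (P : Program) : List Data → Term → Data → ℕ → Prop where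
  | var {ρ : List Data} {i : ℕ} {d : Data} : ρ[i]? = some d → Eval P ρ (.var i) d 1
  | const {ρ : List Data} {n : ℕ} : Eval P ρ (.const n) (.num n) 1
  | pair {ρ : List Data} {a b : Term} {x y : Data} {k l : ℕ} :
      Eval P ρ a x k → Eval P ρ b y l → Eval P ρ (.pair a b) (.pair x y) (k + l + 1)
  | fst {ρ : List Data} {a : Term} {x : Data} {k : ℕ} :
      Eval P ρ a x k → Eval P ρ (.fst a) x.fst (k + 1)
  | snd {ρ : List Data} {a : Term} {x : Data} {k : ℕ} :
      Eval P ρ a x k → Eval P ρ (.snd a) x.snd (k + 1)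
  | isPair {ρ : List Data} {a : Term} {x : Data} {k : ℕ} :
      Eval P ρ a x k → Eval P ρ (.isPair a) x.isPair (k + 1)
  | add {ρ : List Data} {a b : Term} {x y : Data} {k l : ℕ} :
      Eval P ρ a x k → Eval P ρ b y l → Eval P ρ (.add a b) (.num (x.val + y.val)) (k + l + 1)
  | sub {ρ : List Data} {a b : Term} {x y : Data} {k l : ℕ} :
      Eval P ρ a x k → Eval P ρ b y l → Eval P ρ (.sub a b) (.num (x.val - y.val)) (k + l + 1)
  | iteTrue {ρ : List Data} {e a b : Term} {x y : Data} {k l : ℕ} :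
      Eval P ρ e x k → x ≠ .num 0 → Eval P ρ a y l → Eval P ρ (.ite e a b) y (k + l + 1)
  | iteFalse {ρ : List Data} {e a b : Term} {y : Data} {k l : ℕ} :
      Eval P ρ e (.num 0) k → Eval P ρ b y l → Eval P ρ (.ite e a b) y (k + l + 1)
  | letIn {ρ : List Data} {a b : Term} {x y : Data} {k l : ℕ} :
      Eval P ρ a x k → Eval P (x :: ρ) b y l → Eval P ρ (.letIn a b) y (k + l + 1)
  | call {ρ : List Data} {f : ℕ} {a b : Term} {x y : Data} {k l : ℕ} :
      Eval P ρ a x k → P[f]? = some b → Eval P [x] b y l → Eval P ρ (.call f a) y (k + l + 1)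

/-- Evaluation is deterministic, in its value and in its number of steps. -/
theorem Eval.deterministic {P : Program} {ρ : List Data} {e : Term} {d d' : Data} {k k' : ℕ}
    (h : Eval P ρ e d k) (h' : Eval P ρ e d' k') : d = d' ∧ k = k' := by
  induction h generalizing d' k' with
  | var h => cases h' with | var g => simp_all
  | const => cases h' with | const => simp
  | pair _ _ ih1 ih2 => cases h' with | pair g1 g2 => grind [ih1 g1, ih2 g2]
  | fst _ ih => cases h' with | fst g => grind [ih g]
  | snd _ ih => cases h' with | snd g => grind [ih g]
  | isPair _ ih => cases h' with | isPair g => grind [ih g]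
  | add _ _ ih1 ih2 => cases h' with | add g1 g2 => grind [ih1 g1, ih2 g2]
  | sub _ _ ih1 ih2 => cases h' with | sub g1 g2 => grind [ih1 g1, ih2 g2]
  | iteTrue _ hx _ ih1 ih2 =>
    cases h' with
    | iteTrue g1 _ g2 => grind [ih1 g1, ih2 g2]
    | iteFalse g1 g2 => exact absurd (ih1 g1).1 hx
  | iteFalse _ _ ih1 ih2 =>
    cases h' with
    | iteTrue g1 hx g2 => exact absurd (ih1 g1).1.symm hx
    | iteFalse g1 g2 => grind [ih1 g1, ih2 g2]
  | letIn _ _ ih1 ih2 =>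
    cases h' with
    | letIn g1 g2 =>
      obtain ⟨rfl, rfl⟩ := ih1 g1
      obtain ⟨rfl, rfl⟩ := ih2 g2
      exact ⟨rfl, rfl⟩
  | call _ hf _ ih1 ih2 =>
    cases h' with
    | call g1 gf g2 =>
      obtain ⟨rfl, rfl⟩ := ih1 g1
      obtain rfl := Option.some.inj (hf.symm.trans gf)
      obtain ⟨rfl, rfl⟩ := ih2 g2
      exact ⟨rfl, rfl⟩

/-- On the given input, the program answers the yes-no question `Q` correctly (`1` for yes, `0` for
no) after at most `bound` steps. -/
def Program.DecidesWithin (P : Program) (input : Data) (Q : Prop) (bound : ℕ) : Prop :=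
  ∃ k ≤ bound, (Q → Eval P [input] (.call 0 (.var 0)) (.num 1) k) ∧
    (¬ Q → Eval P [input] (.call 0 (.var 0)) (.num 0) k)

end FunProg

/-! ### Instances as inputs -/

open FunProg in
open scoped Classical in
/-- A temporal graph on the vertices `0, …, n - 1` as an input: the list of all edges of the
underlying graph (the pairs `u < v` in lexicographic order), each as the triple of its endpoints and
the increasing list of the times at which it is active. -/
noncomputable def TemporalGraph.encode {n : ℕ} (G : TemporalGraph (Fin n)) : Data :=
  .ofList <|
    ((List.finRange n ×ˢ List.finRange n).filter fun p => p.1 < p.2 ∧ G.graph.Adj p.1 p.2).map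
      fun p => .pair (.num p.1) <| .pair (.num p.2) <| .ofList <|
        ((List.range (G.lifetime + 1)).filter fun t => t ∈ G.label s(p.1, p.2)).map .num

open FunProg in
/-- An instance `(G, Δ, h)` of `Δ`-Temporal Matching as an input: the tuple of the number of
vertices, `Δ`, `h` and the temporal graph. -/
noncomputable def TemporalGraph.encodeInstance {n : ℕ} (G : TemporalGraph (Fin n)) (Δ h : ℕ) :
    Data :=
  .pair (.num n) <| .pair (.num Δ) <| .pair (.num h) G.encode

/-!
The algorithm works on a network whose nodes are the vertex appearances `(v, t)`. Its wires are the
time-edges, which join two appearances at the same time, and the stays, which join the appearances of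
a vertex at consecutive times. A stay carries the number of time steps for which its vertex is still
blocked, a time-edge carries whether it is matched. Temporal matchings are then the solutions of
constraints that involve only the wires at one node each (`hasTemporalMatching_iff`), and so the
maximum can be found by dynamic programming along any recursive bipartition of the nodes all of whose
parts `U` are left by few wires: there is one table entry for each assignment of values in
`{0, …, Δ}` to the wires that leave `U` (`isTable_leafTable`, `isTable_join`, `decompose_sound`).

Such a recursive bipartition is found without knowledge of a decomposition. In a TIM decomposition of
width `φ`, a time-edge stays inside one bag and a stay runs along an edge of the tree. Removing an
edge of the tree therefore cuts at most `φ` wires, all of them stays (`length_cut_le`). Let `U` be a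
part that at most `6 φ ^ 2` wires leave. If some edge of the tree has at least `φ` of these wires on
both of its sides, then splitting `U` there gives two parts that no more wires leave than `U`, and an
equally good split is found by a minimum cut computation for the right distribution of the wires that
leave `U` (`flowCut_spec`). Otherwise some node of the tree sees fewer than `φ` of the wires in each
direction (`exists_center`), the bag at that node and its at most `2 φ` neighbours account for at
most `3 φ ^ 2` wires in total (`length_delta_le`), and any single node may be split off. Together
this is `splits_ne_nil`. The algorithm tries the guesses `0, 1, 2, …` for `φ` until the recursive
bipartition succeeds; the answer is correct whenever it does, and it does for `φ` at the latest.

All distributions of `6 p ^ 2` wires and all tables are enumerated by lists of length at most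
`(Δ + 1) ^ (6 p ^ 2)`, and everything else is polynomial. Running times are handled by the predicate
`FPT N f`, which says that some program computes `f` in a time polynomial in `N`. It is closed under
composition, folds over lists (`FPT.foldl`) and loops (`FPT.loop`). For functions that are polynomial
in the size of the data, it is established by `fun_prop`. In the end, `N` is
`n * Λ * (φ * Δ) ^ φ ^ 3`.
-/

/-! ### Polynomially bounded functions -/

/-- `g` is bounded by a polynomial in the measure `N`. -/
def PolyBdd {α : Type*} (N g : α → ℕ) : Prop :=
  ∃ a : ℕ, ∀ x, g x ≤ (N x + 2) ^ a

namespace PolyBdd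

variable {α β : Type*} {N g h : α → ℕ}

theorem mono (hg : PolyBdd N g) (hh : ∀ x, h x ≤ g x) : PolyBdd N h := by
  obtain ⟨a, ha⟩ := hg
  exact ⟨a, fun x => (hh x).trans (ha x)⟩

theorem self : PolyBdd N N := ⟨1, fun x => by simp⟩

theorem const (c : ℕ) : PolyBdd N (fun _ => c) :=
  ⟨c, fun x => (Nat.lt_two_pow_self).le.trans (Nat.pow_le_pow_left (by omega) c)⟩

theorem mul (hg : PolyBdd N g) (hh : PolyBdd N h) : PolyBdd N (fun x => g x * h x) := by
  obtain ⟨a, ha⟩ := hg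
  obtain ⟨b, hb⟩ := hh
  exact ⟨a + b, fun x => by rw [pow_add]; exact Nat.mul_le_mul (ha x) (hb x)⟩

theorem add (hg : PolyBdd N g) (hh : PolyBdd N h) : PolyBdd N (fun x => g x + h x) := by
  obtain ⟨a, ha⟩ := hg
  obtain ⟨b, hb⟩ := hh
  refine ⟨max a b + 1, fun x => ?_⟩
  have h1 : (N x + 2) ^ a ≤ (N x + 2) ^ max a b := Nat.pow_le_pow_right (by omega) (le_max_left _ _)
  have h2 : (N x + 2) ^ b ≤ (N x + 2) ^ max a b := Nat.pow_le_pow_right (by omega) (le_max_right _ _)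
  have := ha x
  have := hb x
  rw [pow_succ]
  nlinarith [Nat.zero_le (N x), Nat.zero_le ((N x + 2) ^ max a b)]

theorem pow (hg : PolyBdd N g) (n : ℕ) : PolyBdd N (fun x => g x ^ n) := by
  obtain ⟨a, ha⟩ := hg
  exact ⟨a * n, fun x => by rw [pow_mul]; exact Nat.pow_le_pow_left (ha x) n⟩

/-- A polynomial in a polynomially bounded quantity is polynomially bounded. -/
theorem comp {M k : β → ℕ} (hk : PolyBdd M k) {f : α → β}
    (hM : PolyBdd N (fun x => M (f x))) : PolyBdd N (fun x => k (f x)) := by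
  obtain ⟨a, ha⟩ := hk
  exact ((hM.add (const 2)).pow a).mono fun x => ha (f x)

theorem trans {M : α → ℕ} (hg : PolyBdd M g) (hM : PolyBdd N M) : PolyBdd N g :=
  comp (f := id) hg hM

end PolyBdd

namespace FunProg

/-! ### Linking programs -/

/-- The term with the indices of the called functions shifted by `s`. -/
def Term.shift (s : ℕ) : Term → Term
  | .var i => .var i
  | .const n => .const n
  | .pair a b => .pair (a.shift s) (b.shift s)
  | .fst a => .fst (a.shift s)
  | .snd a => .snd (a.shift s)
  | .isPair a => .isPair (a.shift s)
  | .add a b => .add (a.shift s) (b.shift s)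
  | .sub a b => .sub (a.shift s) (b.shift s)
  | .ite e a b => .ite (e.shift s) (a.shift s) (b.shift s)
  | .letIn a b => .letIn (a.shift s) (b.shift s)
  | .call f a => .call (f + s) (a.shift s)

theorem Eval.shift {P R : Program} {s : ℕ}
    (hR : ∀ i b, P[i]? = some b → R[i + s]? = some (b.shift s))
    {ρ : List Data} {e : Term} {d : Data} {k : ℕ} (h : Eval P ρ e d k) :
    Eval R ρ (e.shift s) d k := by
  induction h with
  | var h => exact .var h
  | const => exact .const
  | pair _ _ ih1 ih2 => exact .pair ih1 ih2
  | fst _ ih => exact .fst ih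
  | snd _ ih => exact .snd ih
  | isPair _ ih => exact .isPair ih
  | add _ _ ih1 ih2 => exact .add ih1 ih2
  | sub _ _ ih1 ih2 => exact .sub ih1 ih2
  | iteTrue _ hx _ ih1 ih2 => exact .iteTrue ih1 hx ih2
  | iteFalse _ _ ih1 ih2 => exact .iteFalse ih1 ih2
  | letIn _ _ ih1 ih2 => exact .letIn ih1 ih2
  | call _ hf _ ih1 ih2 => exact .call ih1 (hR _ _ hf) ih2

/-- Evaluation within a bound on the number of steps. -/
def Ev (P : Program) (ρ : List Data) (e : Term) (d : Data) (K : ℕ) : Prop :=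
  ∃ k ≤ K, Eval P ρ e d k

theorem Ev.mono {P : Program} {ρ : List Data} {e : Term} {d : Data} {K K' : ℕ}
    (h : Ev P ρ e d K) (hK : K ≤ K') : Ev P ρ e d K' := by
  obtain ⟨k, hk, h⟩ := h
  exact ⟨k, hk.trans hK, h⟩

theorem Eval.ev {P : Program} {ρ : List Data} {e : Term} {d : Data} {K : ℕ}
    (h : Eval P ρ e d K) : Ev P ρ e d K :=
  ⟨K, le_rfl, h⟩

section Ev

variable {P : Program} {ρ : List Data} {e a b : Term} {x y : Data} {k l m : ℕ}

theorem Ev.pair (h : Ev P ρ a x k) (h' : Ev P ρ b y l) :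
    Ev P ρ (.pair a b) (.pair x y) (k + l + 1) := by
  obtain ⟨i, hi, h⟩ := h
  obtain ⟨j, hj, h'⟩ := h'
  exact ⟨_, by omega, .pair h h'⟩

theorem Ev.iteTrue (h : Ev P ρ e x k) (hx : x ≠ .num 0) (h' : Ev P ρ a y l) :
    Ev P ρ (.ite e a b) y (k + l + 1) := by
  obtain ⟨i, hi, h⟩ := h
  obtain ⟨j, hj, h'⟩ := h'
  exact ⟨_, by omega, .iteTrue h hx h'⟩

theorem Ev.iteFalse (h : Ev P ρ e (.num 0) k) (h' : Ev P ρ b y l) :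
    Ev P ρ (.ite e a b) y (k + l + 1) := by
  obtain ⟨i, hi, h⟩ := h
  obtain ⟨j, hj, h'⟩ := h'
  exact ⟨_, by omega, .iteFalse h h'⟩

/-- A call whose behaviour on the one-variable environment is known, in an arbitrary environment. -/
theorem Ev.call {f : ℕ} (h : Ev P ρ a x k) (h' : Ev P [x] (.call f (.var 0)) y l) :
    Ev P ρ (.call f a) y (k + l) := by
  obtain ⟨i, hi, h⟩ := h
  obtain ⟨j, hj, h'⟩ := h'
  cases h' with
  | call g1 gf g2 =>
    cases g1 with
    | var g =>
      simp only [List.getElem?_cons_zero, Option.some.injEq] at g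
      subst g
      exact ⟨_, by omega, .call h gf g2⟩

theorem Eval.arg : Eval P [x] (.var 0) x 1 := .var rfl

theorem Ev.callBody {f : ℕ} (hf : P[f]? = some b) (h : Ev P [x] b y l) :
    Ev P [x] (.call f (.var 0)) y (l + 2) := by
  obtain ⟨j, hj, h⟩ := h
  exact ⟨_, by omega, .call (.var rfl) hf h⟩

theorem Ev.link_left {A P Q : Program} (h : Ev P ρ (.call 0 (.var 0)) y k) :
    Ev (A ++ (P.map (Term.shift A.length) ++ Q)) ρ (.call A.length (.var 0)) y k := by
  obtain ⟨j, hj, h⟩ := h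
  have h' := h.shift (R := A ++ (P.map (Term.shift A.length) ++ Q)) (s := A.length) (by
    intro i b hb
    have hi : i < P.length := (List.getElem?_eq_some_iff.1 hb).1
    rw [List.getElem?_append_right (by omega), List.getElem?_append_left (by simpa using hi)]
    simp [hb])
  simp only [Term.shift, Nat.zero_add] at h'
  exact ⟨j, hj, h'⟩

theorem Ev.link_right {A P Q : Program} (h : Ev Q ρ (.call 0 (.var 0)) y k) :
    Ev (A ++ (P ++ Q.map (Term.shift (A.length + P.length)))) ρ
      (.call (A.length + P.length) (.var 0)) y k := by
  have h' := Ev.link_left (A := A ++ P) (Q := []) h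
  simpa using h'

end Ev

/-! ### Functions computed in polynomial time -/

/-- The size of a datum: every number counts as one cell, whatever its value. -/
def Data.size : Data → ℕ
  | .num _ => 1
  | .pair a b => a.size + b.size + 1

/-- Types whose elements are encoded as data. -/
class Enc (α : Type) where
  /-- the encoding -/
  enc : α → Data

open Enc (enc)

/-- The size of the encoding. -/
def sz {α : Type} [Enc α] (x : α) : ℕ := (enc x).size

instance : Enc ℕ := ⟨.num⟩
instance : Enc Bool := ⟨fun b => .num b.toNat⟩
instance {α β : Type} [Enc α] [Enc β] : Enc (α × β) := ⟨fun p => .pair (enc p.1) (enc p.2)⟩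
instance {α : Type} [Enc α] : Enc (List α) := ⟨fun l => .ofList (l.map enc)⟩

section

variable {α β γ δ : Type} [Enc α] [Enc β] [Enc γ] [Enc δ]

@[simp] theorem sz_nat (n : ℕ) : sz n = 1 := rfl
@[simp] theorem sz_bool (n : Bool) : sz n = 1 := rfl
@[simp] theorem sz_prod (p : α × β) : sz p = sz p.1 + sz p.2 + 1 := rfl
@[simp] theorem sz_nil : sz ([] : List α) = 1 := rfl
@[simp] theorem sz_cons (a : α) (l : List α) : sz (a :: l) = sz a + sz l + 1 := rfl

theorem one_le_sz (x : α) : 1 ≤ sz x := by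
  unfold sz
  cases enc x <;> simp [Data.size]

theorem sz_append (l l' : List α) : sz (l ++ l') + 1 = sz l + sz l' := by
  induction l with
  | nil => simp; omega
  | cons a l ih => simp; omega

theorem length_lt_sz (l : List α) : l.length < sz l := by
  induction l with
  | nil => simp
  | cons a l ih => simp; omega

theorem sz_le_of_mem {a : α} {l : List α} (h : a ∈ l) : sz a < sz l := by
  induction l with
  | nil => simp at h
  | cons b l ih =>
    have := one_le_sz l
    have := one_le_sz b
    simp only [List.mem_cons] at h
    rcases h with rfl | h
    · simp
    · have := ih h; simp; omega

theorem sz_le_of_sublist {l l' : List α} (h : l.Sublist l') : sz l ≤ sz l' := by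
  induction h with
  | slnil => exact le_rfl
  | cons a _ ih => simp; omega
  | cons_cons a _ ih => simp; omega

theorem sz_le_of_forall_le {l : List α} {m : ℕ} (h : ∀ a ∈ l, sz a ≤ m) :
    sz l ≤ l.length * (m + 1) + 1 := by
  induction l with
  | nil => simp
  | cons a l ih =>
    have h1 := h a (by simp)
    have h2 := ih fun b hb => h b (by simp [hb])
    simp only [sz_cons, List.length_cons]
    nlinarith

/-- `f` is computed by a program in a time polynomial in the measure `N`, and the size of its value
is polynomial in `N` as well. -/
def FPT (N : α → ℕ) (f : α → β) : Prop :=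
  ∃ (P : Program) (T : α → ℕ), PolyBdd N T ∧ PolyBdd N (fun x => sz (f x)) ∧
    ∀ x, Ev P [enc x] (.call 0 (.var 0)) (enc (f x)) (T x)

/-- `f` is computed by a program in a time polynomial in the size of the argument. -/
@[fun_prop]
def FP (f : α → β) : Prop := FPT sz f

theorem FPT.size {N : α → ℕ} {f : α → β} (h : FPT N f) : PolyBdd N (fun x => sz (f x)) := by
  obtain ⟨P, T, hT, hs, h⟩ := h
  exact hs

theorem FP.size {f : α → β} (h : FP f) : PolyBdd sz (fun x => sz (f x)) := FPT.size h

theorem FPT.mono {N N' : α → ℕ} {f : α → β} (h : FPT N f) (hN : PolyBdd N' N) : FPT N' f := by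
  obtain ⟨P, T, hT, hs, h⟩ := h
  exact ⟨P, T, hT.trans hN, hs.trans hN, h⟩

theorem FP.fpt {N : α → ℕ} {f : α → β} (h : FP f) (hN : PolyBdd N sz) : FPT N f :=
  FPT.mono h hN

theorem FPT.comp {N : α → ℕ} {M : β → ℕ} {g : β → γ} {f : α → β} (hg : FPT M g) (hf : FPT N f)
    (hM : PolyBdd N (fun x => M (f x))) : FPT N (fun x => g (f x)) := by
  obtain ⟨Pf, Tf, hTf, hsf, hf⟩ := hf
  obtain ⟨Pg, Tg, hTg, hsg, hg⟩ := hg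
  refine ⟨[.call (1 + Pf.length) (.call 1 (.var 0))] ++ (Pf.map (Term.shift 1) ++
    Pg.map (Term.shift (1 + Pf.length))), fun x => 1 + Tf x + Tg (f x) + 2,
    (((PolyBdd.const 1).add hTf).add (hTg.comp hM)).add (.const 2), hsg.comp hM, fun x => ?_⟩
  refine Ev.callBody (b := .call (1 + Pf.length) (.call 1 (.var 0))) rfl ?_
  refine Ev.call (Ev.call (Eval.var rfl).ev (Ev.link_left (A := [_]) (hf x))) ?_
  have := Ev.link_right (A := [.call (1 + Pf.length) (.call 1 (.var 0))])
    (P := Pf.map (Term.shift 1)) (hg (f x))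
  simpa using this

theorem FPT.comp_fp {N : α → ℕ} {g : β → γ} {f : α → β} (hg : FP g) (hf : FPT N f) :
    FPT N (fun x => g (f x)) :=
  FPT.comp hg hf hf.size

@[fun_prop]
theorem FP.comp {g : β → γ} {f : α → β} (hg : FP g) (hf : FP f) : FP (fun x => g (f x)) :=
  FPT.comp_fp hg hf

theorem FPT.prodMk {N : α → ℕ} {f : α → β} {g : α → γ} (hf : FPT N f) (hg : FPT N g) :
    FPT N (fun x => (f x, g x)) := by
  obtain ⟨Pf, Tf, hTf, hsf, hf⟩ := hf
  obtain ⟨Pg, Tg, hTg, hsg, hg⟩ := hg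
  refine ⟨[.pair (.call 1 (.var 0)) (.call (1 + Pf.length) (.var 0))] ++ (Pf.map (Term.shift 1) ++
    Pg.map (Term.shift (1 + Pf.length))), fun x => Tf x + Tg x + 1 + 2,
    ((hTf.add hTg).add (.const 1)).add (.const 2),
    ((hsf.add hsg).add (.const 1)), fun x => ?_⟩
  refine Ev.callBody (b := .pair (.call 1 (.var 0)) (.call (1 + Pf.length) (.var 0))) rfl ?_
  refine Ev.pair (Ev.link_left (A := [_]) (hf x)) ?_
  have := Ev.link_right (A := [.pair (.call 1 (.var 0)) (.call (1 + Pf.length) (.var 0))])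
    (P := Pf.map (Term.shift 1)) (hg x)
  simpa using this

@[fun_prop]
theorem FP.prodMk {f : α → β} {g : α → γ} (hf : FP f) (hg : FP g) : FP (fun x => (f x, g x)) :=
  FPT.prodMk hf hg

/-- A term that runs in constant time. -/
theorem FP.of_term {f : α → β} (e : Term) (c : ℕ) (h : ∀ x, Ev [e] [enc x] e (enc (f x)) c)
    (a : ℕ) (hs : ∀ x, sz (f x) ≤ sz x + a) : FP f :=
  ⟨[e], fun _ => c + 2, .const _, (PolyBdd.self.add (.const a)).mono hs,
    fun x => Ev.callBody rfl (h x)⟩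

@[fun_prop]
theorem FP.id' : FP (fun x : α => x) :=
  .of_term (.var 0) 1 (fun _ => (Eval.var rfl).ev) 0 (by simp)

/-- The term that builds a given datum. -/
def Data.toTerm : Data → Term
  | .num n => .const n
  | .pair a b => .pair a.toTerm b.toTerm

theorem Data.ev_toTerm (P : Program) (ρ : List Data) (d : Data) : Ev P ρ d.toTerm d d.size := by
  induction d with
  | num n => exact Eval.const.ev
  | pair a b iha ihb => exact iha.pair ihb

@[fun_prop]
theorem FP.const (c : β) : FP (fun _ : α => c) :=
  .of_term (enc c).toTerm _ (fun _ => Data.ev_toTerm _ _ _) (sz c) (by simp)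

theorem FP.fst₀ : FP (fun p : α × β => p.1) :=
  .of_term (.fst (.var 0)) 2 (fun p => (Eval.fst (.arg (x := enc p))).ev) 0 (by simp; omega)

theorem FP.snd₀ : FP (fun p : α × β => p.2) :=
  .of_term (.snd (.var 0)) 2 (fun p => (Eval.snd (.arg (x := enc p))).ev) 0 (by simp; omega)

@[fun_prop]
theorem FP.fst {f : α → β × γ} (hf : FP f) : FP (fun x => (f x).1) := FP.fst₀.comp hf

@[fun_prop]
theorem FP.snd {f : α → β × γ} (hf : FP f) : FP (fun x => (f x).2) := FP.snd₀.comp hf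

theorem FP.add₀ : FP (fun p : ℕ × ℕ => p.1 + p.2) :=
  .of_term (.add (.fst (.var 0)) (.snd (.var 0))) 5
    (fun p => (Eval.add (.fst (.arg (x := enc p))) (.snd (.arg (x := enc p)))).ev) 0 (by simp)

theorem FP.sub₀ : FP (fun p : ℕ × ℕ => p.1 - p.2) :=
  .of_term (.sub (.fst (.var 0)) (.snd (.var 0))) 5
    (fun p => (Eval.sub (.fst (.arg (x := enc p))) (.snd (.arg (x := enc p)))).ev) 0 (by simp)

@[fun_prop]
theorem FP.add {f g : α → ℕ} (hf : FP f) (hg : FP g) : FP (fun x => f x + g x) :=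
  FP.add₀.comp (hf.prodMk hg)

@[fun_prop]
theorem FP.sub {f g : α → ℕ} (hf : FP f) (hg : FP g) : FP (fun x => f x - g x) :=
  FP.sub₀.comp (hf.prodMk hg)

theorem FP.cond₀ : FP (fun p : Bool × α × α => bif p.1 then p.2.1 else p.2.2) := by
  refine .of_term (.ite (.fst (.var 0)) (.fst (.snd (.var 0))) (.snd (.snd (.var 0)))) 6
    (fun p => ?_) 0 ?_
  · obtain ⟨b, x, y⟩ := p
    cases b
    · exact (Eval.iteFalse (.fst (.arg (x := enc (false, x, y))))
        (.snd (.snd (.arg (x := enc (false, x, y)))))).ev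
    · exact (Eval.iteTrue (.fst (.arg (x := enc (true, x, y)))) (by simp [enc, Data.fst])
        (.fst (.snd (.arg (x := enc (true, x, y)))))).ev
  · rintro ⟨b, x, y⟩
    cases b <;> simp <;> omega

@[fun_prop]
theorem FP.cond {b : α → Bool} {f g : α → β} (hb : FP b) (hf : FP f) (hg : FP g) :
    FP (fun x => bif b x then f x else g x) :=
  FP.cond₀.comp (hb.prodMk (hf.prodMk hg))

theorem FP.decide_eq_zero₀ : FP (fun n : ℕ => decide (n = 0)) := by
  refine .of_term (.ite (.var 0) (.const 0) (.const 1)) 3 (fun n => ?_) 0 (by simp)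
  cases n with
  | zero => exact (Eval.iteFalse (.var rfl) .const).ev
  | succ n => exact (Eval.iteTrue (.var rfl) (by simp [enc]) .const).ev

@[fun_prop]
theorem FP.decide_le {f g : α → ℕ} (hf : FP f) (hg : FP g) :
    FP (fun x => decide (f x ≤ g x)) := by
  have := FP.decide_eq_zero₀.comp (hf.sub hg)
  simpa only [Nat.sub_eq_zero_iff_le] using this

@[fun_prop]
theorem FP.decide_lt {f g : α → ℕ} (hf : FP f) (hg : FP g) :
    FP (fun x => decide (f x < g x)) :=
  FP.decide_le (hf.add (.const 1)) hg

@[fun_prop]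
theorem FP.and {f g : α → Bool} (hf : FP f) (hg : FP g) : FP (fun x => f x && g x) := by
  have := hf.cond hg (.const false)
  refine (funext fun x => ?_ : (fun x => f x && g x) = _) ▸ this
  cases f x <;> rfl

@[fun_prop]
theorem FP.or {f g : α → Bool} (hf : FP f) (hg : FP g) : FP (fun x => f x || g x) := by
  have := hf.cond (.const true) hg
  refine (funext fun x => ?_ : (fun x => f x || g x) = _) ▸ this
  cases f x <;> rfl

@[fun_prop]
theorem FP.not {f : α → Bool} (hf : FP f) : FP (fun x => !f x) := by
  have := hf.cond (.const false) (.const true)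
  refine (funext fun x => ?_ : (fun x => !f x) = _) ▸ this
  cases f x <;> rfl

@[fun_prop]
theorem FP.xor {f g : α → Bool} (hf : FP f) (hg : FP g) : FP (fun x => Bool.xor (f x) (g x)) := by
  have := hf.cond hg.not hg
  refine (funext fun x => ?_ : (fun x => Bool.xor (f x) (g x)) = _) ▸ this
  cases f x <;> simp

/-- Types whose equality test is computed in polynomial time. -/
class FPEq (α : Type) [Enc α] [DecidableEq α] : Prop where
  fp : FP (fun p : α × α => decide (p.1 = p.2))

instance : FPEq ℕ := ⟨by
  have : FP (fun p : ℕ × ℕ => decide (p.1 ≤ p.2) && decide (p.2 ≤ p.1)) := by fun_prop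
  refine (funext fun p => ?_ : (fun p : ℕ × ℕ => decide (p.1 = p.2)) = _) ▸ this
  rw [← Bool.decide_and]
  exact decide_eq_decide.2 le_antisymm_iff⟩

@[fun_prop]
theorem FP.decide_eq [DecidableEq β] [FPEq β] {f g : α → β} {inst : ∀ x, Decidable (f x = g x)}
    (hf : FP f) (hg : FP g) : FP (fun x => @decide (f x = g x) (inst x)) := by
  refine (funext fun x => ?_ : (fun x => @decide (f x = g x) (inst x)) = _) ▸
    FPEq.fp.comp (hf.prodMk hg)
  rw [Bool.eq_iff_iff]
  simp

instance [DecidableEq α] [DecidableEq β] [FPEq α] [FPEq β] : FPEq (α × β) := ⟨by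
  have : FP (fun p : (α × β) × (α × β) =>
    decide (p.1.1 = p.2.1) && decide (p.1.2 = p.2.2)) := by fun_prop
  refine (funext fun p => ?_ : (fun p : (α × β) × (α × β) => decide (p.1 = p.2)) = _) ▸ this
  rw [← Bool.decide_and]
  exact decide_eq_decide.2 Prod.ext_iff⟩

end

end FunProg

namespace FunProg

open Enc (enc)

/-! ### Operations on lists in polynomial time -/

section

variable {α β γ δ : Type} [Enc α] [Enc β] [Enc γ] [Enc δ]

/-- A fold takes polynomial time if its step does and the sizes of all intermediate states are
polynomially bounded. -/
theorem FPT.foldl₀ {f : γ → β → α → β} {N M : γ × β × List α → ℕ}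
    (hf : FP (fun p : γ × β × α => f p.1 p.2.1 p.2.2)) (hN : PolyBdd N sz) (hM : PolyBdd N M)
    (hb : ∀ c b l l', l' <+: l → sz (l'.foldl (f c) b) ≤ M (c, b, l)) :
    FPT N (fun p : γ × β × List α => p.2.2.foldl (f p.1) p.2.1) := by
  obtain ⟨P, T, ⟨d, hT⟩, -, hf⟩ := hf
  set B : Term := .ite (.isPair (.snd (.snd (.var 0))))
    (.call 0 (.pair (.fst (.var 0)) (.pair (.call 1 (.pair (.fst (.var 0))
      (.pair (.fst (.snd (.var 0))) (.fst (.snd (.snd (.var 0)))))))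
      (.snd (.snd (.snd (.var 0)))))))
    (.fst (.snd (.var 0))) with hB
  let S : γ × β × List α → ℕ := fun p => (sz p + M p + 4) ^ d
  have hS : PolyBdd N S := ((hN.add hM).add (.const 4)).pow d
  refine ⟨[B] ++ (P.map (Term.shift 1) ++ []), fun p => (sz p + 1) * (S p + 40),
    (hN.add (.const 1)).mul (hS.add (.const 40)), hM.mono fun p => hb _ _ _ _ List.prefix_rfl, ?_⟩
  set R : Program := [B] ++ (P.map (Term.shift 1) ++ []) with hR
  rintro ⟨c, b, l⟩
  have key : ∀ l₂ l₁ : List α, l₁ ++ l₂ = l →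
      Ev R [enc (c, l₁.foldl (f c) b, l₂)] (.call 0 (.var 0)) (enc (l.foldl (f c) b))
        ((l₂.length + 1) * (S (c, b, l) + 40)) := by
    intro l₂
    induction l₂ with
    | nil =>
      intro l₁ h
      simp only [List.append_nil] at h
      subst h
      set x := enc (c, l₁.foldl (f c) b, ([] : List α)) with hx
      have h0 : Ev R [x] (.isPair (.snd (.snd (.var 0)))) (.num 0) 4 :=
        (Eval.isPair (.snd (.snd (.arg (x := x))))).ev
      have h1 : Ev R [x] (.fst (.snd (.var 0))) (enc (l₁.foldl (f c) b)) 3 :=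
        (Eval.fst (.snd (.arg (x := x)))).ev
      exact (Ev.callBody (b := B) rfl (h0.iteFalse h1)).mono (by simp)
    | cons a l₂ ih =>
      intro l₁ h
      have ih := ih (l₁ ++ [a]) (by simpa using h)
      rw [List.foldl_append] at ih
      set s := l₁.foldl (f c) b with hs
      set x := enc (c, s, a :: l₂) with hx
      have h0 : Ev R [x] (.isPair (.snd (.snd (.var 0)))) (.num 1) 4 :=
        (Eval.isPair (.snd (.snd (.arg (x := x))))).ev
      have h1 : Ev R [x] (.fst (.var 0)) (enc c) 2 := (Eval.fst (.arg (x := x))).ev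
      have h2 : Ev R [x] (.fst (.snd (.var 0))) (enc s) 3 :=
        (Eval.fst (.snd (.arg (x := x)))).ev
      have h3 : Ev R [x] (.fst (.snd (.snd (.var 0)))) (enc a) 4 :=
        (Eval.fst (.snd (.snd (.arg (x := x))))).ev
      have h4 : Ev R [x] (.snd (.snd (.snd (.var 0)))) (enc l₂) 4 :=
        (Eval.snd (.snd (.snd (.arg (x := x))))).ev
      have hstep := Ev.call (h1.pair (h2.pair h3))
        (Ev.link_left (A := [B]) (Q := []) (hf (c, s, a)))
      have hrec := Ev.call (h1.pair (hstep.pair h4)) ih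
      have hTS : T (c, s, a) ≤ S (c, b, l) := by
        refine (hT _).trans (Nat.pow_le_pow_left ?_ d)
        have e1 : sz s ≤ M (c, b, l) := hb _ _ _ _ (by rw [← h]; exact List.prefix_append _ _)
        have e2 : sz a < sz l := sz_le_of_mem (by rw [← h]; simp)
        simp only [sz_prod]
        omega
      refine (Ev.callBody (b := B) rfl (h0.iteTrue (by simp) hrec)).mono ?_
      simp only [List.length_cons]
      ring_nf
      omega
  refine (key l [] rfl).mono (Nat.mul_le_mul_right _ ?_)
  have := length_lt_sz l
  simp only [sz_prod]
  omega

theorem FPT.foldl {N : δ → ℕ} {f : δ → β → α → β} {i : δ → β} {l : δ → List α} {M : δ → ℕ}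
    (hf : FP (fun p : δ × β × α => f p.1 p.2.1 p.2.2)) (hi : FPT N i) (hl : FPT N l)
    (hN : PolyBdd N sz) (hM : PolyBdd N M)
    (hb : ∀ x l', l' <+: l x → sz (l'.foldl (f x) (i x)) ≤ M x) :
    FPT N (fun x => (l x).foldl (f x) (i x)) := by
  obtain ⟨P, T, hT, hs, h⟩ := FPT.foldl₀
    (N := fun p : δ × β × List α => sz p + p.2.2.length.succ *
      (Finset.range (p.2.2.length + 1)).sup fun j => sz ((p.2.2.take j).foldl (f p.1) p.2.1))
    (M := fun p => p.2.2.length.succ *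
      (Finset.range (p.2.2.length + 1)).sup fun j => sz ((p.2.2.take j).foldl (f p.1) p.2.1)) hf
    (PolyBdd.self.mono fun p => by omega) (PolyBdd.self.mono fun p => by omega) (by
      intro c b l l' h
      refine le_trans ?_ (Nat.le_mul_of_pos_left _ (Nat.succ_pos _))
      have h1 : l' = l.take l'.length := List.prefix_iff_eq_take.1 h
      have h2 := h.length_le
      refine le_trans (by rw [← h1]) (Finset.le_sup (f := fun j =>
        sz ((l.take j).foldl (f c) b)) (b := l'.length) (by simp; omega)))
  have hfp : FPT N (fun x => (x, i x, l x)) := (FPT.mono FP.id' hN).prodMk (hi.prodMk hl)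
  refine FPT.comp ⟨P, T, hT, hs, h⟩ hfp ?_
  refine (hfp.size.add (hl.size.mul hM)).mono fun x => ?_
  refine Nat.add_le_add_left (Nat.mul_le_mul (length_lt_sz _) (Finset.sup_le fun j _ => ?_)) _
  exact hb x _ (List.take_prefix _ _)

/-- A fold takes polynomial time if its step does and every step adds to the size of the state an
amount that is polynomial in the context and the list entry. -/
theorem FP.foldl {f : δ → β → α → β} {i : δ → β} {l : δ → List α} {g : δ × α → ℕ}
    (hf : FP (fun p : δ × β × α => f p.1 p.2.1 p.2.2)) (hi : FP i) (hl : FP l)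
    (hg : PolyBdd sz g) (hadd : ∀ x b a, sz (f x b a) ≤ sz b + g (x, a)) :
    FP (fun x => (l x).foldl (f x) (i x)) := by
  obtain ⟨d, hg⟩ := hg
  refine FPT.foldl (M := fun x => sz (i x) + sz (l x) * (sz x + sz (l x) + 4) ^ d) hf hi hl .self
    (hi.size.add (hl.size.mul (((PolyBdd.self.add hl.size).add (.const 4)).pow d))) ?_
  intro x l' hl'
  have key : ∀ l₁ : List α, (∀ a ∈ l₁, a ∈ l x) →
      ∀ b, sz (l₁.foldl (f x) b) ≤ sz b + l₁.length * (sz x + sz (l x) + 4) ^ d := by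
    intro l₁
    induction l₁ with
    | nil => simp
    | cons a l₁ ih =>
      intro h b
      have h1 := ih (fun a' ha' => h a' (by simp [ha'])) (f x b a)
      have h2 := hadd x b a
      have h3 := sz_le_of_mem (h a (by simp))
      have h4 : g (x, a) ≤ (sz x + sz (l x) + 4) ^ d :=
        (hg _).trans (Nat.pow_le_pow_left (by simp only [sz_prod]; omega) d)
      simp only [List.foldl_cons, List.length_cons, add_mul, one_mul]
      omega
  refine (key l' (fun a ha => hl'.subset ha) _).trans (Nat.add_le_add_left
    (Nat.mul_le_mul_right _ ?_) _)
  exact hl'.length_le.trans (length_lt_sz _).le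

theorem FP.cons₀ : FP (fun p : α × List α => p.1 :: p.2) :=
  .of_term (.var 0) 1 (fun p => (Eval.arg (x := enc p)).ev) 0 (by simp)

@[fun_prop]
theorem FP.cons {f : δ → α} {l : δ → List α} (hf : FP f) (hl : FP l) :
    FP (fun x => f x :: l x) :=
  FP.cons₀.comp (hf.prodMk hl)

@[fun_prop]
theorem FP.tail {l : δ → List α} (hl : FP l) : FP (fun x => (l x).tail) := by
  have : FP (fun l : List α => l.tail) := by
    refine .of_term (.snd (.var 0)) 2 (fun l => ?_) 0 fun l => sz_le_of_sublist l.tail_sublist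
    have := (Eval.snd (P := [.snd (.var 0)]) (.arg (x := enc l))).ev
    cases l <;> exact this
  exact this.comp hl

@[fun_prop]
theorem FP.isEmpty {l : δ → List α} (hl : FP l) : FP (fun x => (l x).isEmpty) := by
  have : FP (fun l : List α => l.isEmpty) := by
    refine .of_term (.sub (.const 1) (.isPair (.var 0))) 4 (fun l => ?_) 0 fun l => one_le_sz l
    have := (Eval.sub (P := [.sub (.const 1) (.isPair (.var 0))])
      (.const (n := 1))
      (.isPair (.arg (x := enc l)))).ev
    cases l <;> exact this
  exact this.comp hl

@[fun_prop]
theorem FP.headD {l : δ → List α} {d : δ → α} (hl : FP l) (hd : FP d) :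
    FP (fun x => (l x).headD (d x)) := by
  have : FP (fun p : List α × α => p.1.headD p.2) := by
    set t : Term := .ite (.isPair (.fst (.var 0))) (.fst (.fst (.var 0))) (.snd (.var 0)) with ht
    refine .of_term t 7 (fun p => ?_) 0 ?_
    · obtain ⟨l, d⟩ := p
      cases l with
      | nil =>
        exact (Ev.iteFalse (Eval.isPair (P := [t]) (.fst (.arg (x := enc (([] : List α), d))))).ev
          (Eval.snd (.arg (x := enc (([] : List α), d)))).ev).mono (by omega)
      | cons a l =>
        exact (Ev.iteTrue (Eval.isPair (P := [t]) (.fst (.arg (x := enc (a :: l, d))))).ev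
          (by simp [enc, Data.fst, Data.isPair, Data.ofList])
          (Eval.fst (.fst (.arg (x := enc (a :: l, d))))).ev).mono (by omega)
    · rintro ⟨l, d⟩
      cases l <;> simp <;> omega
  exact this.comp (hl.prodMk hd)

@[fun_prop]
theorem FP.reverse {l : δ → List α} (hl : FP l) : FP (fun x => (l x).reverse) := by
  have := FP.foldl (f := fun (_ : δ) (s : List α) a => a :: s) (i := fun _ => []) (l := l)
    (g := fun p => sz p.2 + 1) (by fun_prop) (by fun_prop) hl
    (PolyBdd.self.mono fun p => by simp only [sz_prod]; omega) (by intros; simp; omega)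
  simpa using this

@[fun_prop]
theorem FP.map {l : δ → List α} {f : δ → α → β} (hl : FP l)
    (hf : FP (fun p : δ × α => f p.1 p.2)) : FP (fun x => (l x).map (f x)) := by
  have h1 : FP (fun p : δ × List β × α => f p.1 p.2.2) :=
    FP.comp (g := fun p : δ × α => f p.1 p.2) (f := fun p : δ × List β × α => (p.1, p.2.2))
      hf (by fun_prop)
  have := FP.foldl (f := fun x (s : List β) a => f x a :: s) (i := fun _ => []) (l := l)
    (g := fun p => sz (f p.1 p.2) + 1) (by fun_prop) (by fun_prop) hl
    (hf.size.add (.const 1)) (by intros; simp; omega)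
  simpa [← List.map_eq_foldr] using this.reverse

@[fun_prop]
theorem FP.filter {l : δ → List α} {f : δ → α → Bool} (hl : FP l)
    (hf : FP (fun p : δ × α => f p.1 p.2)) : FP (fun x => (l x).filter (f x)) := by
  have h1 : FP (fun p : δ × List α × α => f p.1 p.2.2) :=
    FP.comp (g := fun p : δ × α => f p.1 p.2) (f := fun p : δ × List α × α => (p.1, p.2.2))
      hf (by fun_prop)
  have := FP.foldl (f := fun x (s : List α) a => bif f x a then a :: s else s)
    (i := fun _ => []) (l := l)
    (g := fun p => sz p.2 + 1) (by fun_prop) (by fun_prop) hl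
    (PolyBdd.self.mono fun p => by simp only [sz_prod]; omega)
    (by intro x b a; cases f x a <;> simp; omega)
  refine (funext fun x => ?_ : (fun x => (l x).filter (f x)) = _) ▸ this.reverse
  have key : ∀ (l : List α) (s : List α),
      l.foldl (fun s a => bif f x a then a :: s else s) s = (l.filter (f x)).reverse ++ s := by
    intro l
    induction l with
    | nil => simp
    | cons a l ih => intro s; cases h : f x a <;> simp [ih, h]
  simp [key]

@[fun_prop]
theorem FP.append {l l' : δ → List α} (hl : FP l) (hl' : FP l') : FP (fun x => l x ++ l' x) := by
  have := FP.foldl (f := fun (_ : δ) (s : List α) a => a :: s) (i := l')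
    (l := fun x => (l x).reverse)
    (g := fun p => sz p.2 + 1) (by fun_prop) hl' (by fun_prop)
    (PolyBdd.self.mono fun p => by simp only [sz_prod]; omega) (by intros; simp; omega)
  simpa using this

@[fun_prop]
theorem FP.flatten {l : δ → List (List α)} (hl : FP l) : FP (fun x => (l x).flatten) := by
  have := FP.foldl (f := fun (_ : δ) (s : List α) a => s ++ a) (i := fun _ => []) (l := l)
    (g := fun p => sz p.2) (by fun_prop) (by fun_prop) hl
    (PolyBdd.self.mono fun p => by simp only [sz_prod]; omega)
    (by intro x b a; have := sz_append b a; simp only; omega)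
  refine (funext fun x => ?_ : (fun x => (l x).flatten) = _) ▸ this
  have key : ∀ (l : List (List α)) (s : List α),
      l.foldl (fun s a => s ++ a) s = s ++ l.flatten := by
    intro l
    induction l with
    | nil => simp
    | cons a l ih => intro s; simp [ih]
  simp [key]

@[fun_prop]
theorem FP.flatMap {l : δ → List α} {f : δ → α → List β} (hl : FP l)
    (hf : FP (fun p : δ × α => f p.1 p.2)) : FP (fun x => (l x).flatMap (f x)) := by
  simp only [List.flatMap_def]
  fun_prop

@[fun_prop]
theorem FP.any {l : δ → List α} {f : δ → α → Bool} (hl : FP l)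
    (hf : FP (fun p : δ × α => f p.1 p.2)) : FP (fun x => (l x).any (f x)) := by
  have : FP (fun x => !((l x).filter (f x)).isEmpty) := by fun_prop
  refine (funext fun x => ?_ : (fun x => (l x).any (f x)) = _) ▸ this
  rw [Bool.eq_iff_iff]
  simp

@[fun_prop]
theorem FP.all {l : δ → List α} {f : δ → α → Bool} (hl : FP l)
    (hf : FP (fun p : δ × α => f p.1 p.2)) : FP (fun x => (l x).all (f x)) := by
  have : FP (fun x => !(l x).any (fun a => !f x a)) := by fun_prop
  refine (funext fun x => ?_ : (fun x => (l x).all (f x)) = _) ▸ this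
  rw [Bool.eq_iff_iff]
  simp

@[fun_prop]
theorem FP.decide_mem [DecidableEq α] [FPEq α] {f : δ → α} {l : δ → List α}
    {inst : ∀ x, Decidable (f x ∈ l x)} (hf : FP f) (hl : FP l) :
    FP (fun x => @decide (f x ∈ l x) (inst x)) := by
  have : FP (fun x => (l x).any fun a => decide (f x = a)) := by fun_prop
  refine (funext fun x => ?_ : (fun x => @decide (f x ∈ l x) (inst x)) = _) ▸ this
  rw [Bool.eq_iff_iff]
  simp

@[fun_prop]
theorem FP.length {l : δ → List α} (hl : FP l) : FP (fun x => (l x).length) := by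
  have := FP.foldl (f := fun (_ : δ) (s : ℕ) (_ : α) => s + 1) (i := fun _ => 0) (l := l)
    (g := fun _ => 0) (by fun_prop) (by fun_prop) hl (.const 0) (by simp)
  simpa using this

@[fun_prop]
theorem FP.take {n : δ → ℕ} {l : δ → List α} (hn : FP n) (hl : FP l) :
    FP (fun x => (l x).take (n x)) := by
  have := FP.foldl
    (f := fun (x : δ) (s : List α) (a : α) => bif decide (s.length < n x) then a :: s else s)
    (i := fun _ => []) (l := l)
    (g := fun p => sz p.2 + 1) (by fun_prop) (by fun_prop) hl
    (PolyBdd.self.mono fun p => by simp only [sz_prod]; omega)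
    (by intro x b a; cases decide (b.length < n x) <;> simp; omega)
  refine (funext fun x => ?_ : (fun x => (l x).take (n x)) = _) ▸ this.reverse
  have key : ∀ (l : List α) (s : List α),
      l.foldl (fun s a => bif decide (s.length < n x) then a :: s else s) s =
        (l.take (n x - s.length)).reverse ++ s := by
    intro l
    induction l with
    | nil => simp
    | cons a l ih =>
      intro s
      by_cases h : s.length < n x
      · obtain ⟨m, hm⟩ : ∃ m, n x - s.length = m + 1 := ⟨n x - s.length - 1, by omega⟩
        have hm' : n x - (s.length + 1) = m := by omega
        simp [ih, h, hm, hm']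
      · have hm : n x - s.length = 0 := by omega
        simp [ih, h, hm]
  simp [key]

instance [DecidableEq α] [FPEq α] : FPEq (List α) := ⟨by
  have h : FP (fun p : List α × List α => (p.2.foldl (fun (s : Bool × List α) a =>
      (s.1 && !s.2.isEmpty && decide (s.2.headD a = a), s.2.tail)) (true, p.1))) :=
    FP.foldl (f := fun (_ : List α × List α) (s : Bool × List α) (a : α) =>
      (s.1 && !s.2.isEmpty && decide (s.2.headD a = a), s.2.tail)) (g := fun _ => 0)
      (by fun_prop) (by fun_prop) (by fun_prop) (.const 0) (by
        intro x b a
        have := sz_le_of_sublist b.2.tail_sublist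
        simp only [sz_prod, sz_bool]
        omega)
  have h2 := h.fst.and h.snd.isEmpty
  refine (funext fun x => ?_ : (fun p : List α × List α => decide (p.1 = p.2)) = _) ▸ h2
  have key : ∀ (l₂ l₁ : List α) (b : Bool), ((l₂.foldl (fun (s : Bool × List α) a =>
      (s.1 && !s.2.isEmpty && decide (s.2.headD a = a), s.2.tail)) (b, l₁)).1 &&
      (l₂.foldl (fun (s : Bool × List α) a =>
      (s.1 && !s.2.isEmpty && decide (s.2.headD a = a), s.2.tail)) (b, l₁)).2.isEmpty) =
      (b && decide (l₁ = l₂)) := by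
    intro l₂
    induction l₂ with
    | nil => intro l₁ b; cases l₁ <;> simp
    | cons a l₂ ih =>
      intro l₁ b
      rw [List.foldl_cons, ih]
      cases l₁ with
      | nil => simp
      | cons c l₁ => 
        rw [Bool.eq_iff_iff]
        simp only [List.isEmpty_cons, Bool.not_false, Bool.and_true, List.headD_cons,
          List.tail_cons, Bool.and_eq_true, decide_eq_true_eq, List.cons.injEq]
        exact ⟨fun h => ⟨h.1.1, of_decide_eq_true h.1.2, of_decide_eq_true h.2⟩,
          fun h => ⟨⟨h.1, decide_eq_true h.2.1⟩, decide_eq_true h.2.2⟩⟩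
  rw [key]
  simp⟩

end

end FunProg

namespace MatchingAlgorithm

open FunProg

variable {δ : Type} [Enc δ]

/-! ### The algorithm: cuts in the graph of vertex appearances -/

/-- A node `(v, t)` is the appearance of the vertex `v` at the time `t`. -/
abbrev Node := ℕ × ℕ

/-- A wire joins two nodes: the appearances of a vertex at consecutive times, or the appearances of
the ends of a time-edge. Each wire is listed with one of its two orientations. -/
abbrev Wire := Node × Node

/-- Exactly one end of the wire lies in `U`. -/
def crosses (U : List Node) (e : Wire) : Bool :=
  Bool.xor (decide (e.1 ∈ U)) (decide (e.2 ∈ U))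

/-- The wires that leave `U`. -/
def delta (E : List Wire) (U : List Node) : List Wire :=
  E.filter (crosses U)

@[fun_prop]
theorem fp_delta {E : δ → List Wire} {U : δ → List Node} (hE : FP E) (hU : FP U) :
    FP (fun x => delta (E x) (U x)) := by
  unfold delta crosses
  fun_prop

/-- The wires inside `U`, in both orientations. -/
def arcs (E : List Wire) (U : List Node) : List Wire :=
  (E.filter fun e => decide (e.1 ∈ U) && decide (e.2 ∈ U)) ++
    (E.filter fun e => decide (e.1 ∈ U) && decide (e.2 ∈ U)).map fun e => (e.2, e.1)

@[fun_prop]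
theorem fp_arcs {E : δ → List Wire} {U : δ → List Node} (hE : FP E) (hU : FP U) :
    FP (fun x => arcs (E x) (U x)) := by
  unfold arcs
  fun_prop

/-- The residual arcs of the flow `Q` in the network `D`. The flow is the list of the arcs it
uses. -/
def resid (D Q : List Wire) : List Wire :=
  D.filter fun a => !decide (a ∈ Q)

@[fun_prop]
theorem fp_resid {D Q : δ → List Wire} (hD : FP D) (hQ : FP Q) :
    FP (fun x => resid (D x) (Q x)) := by
  unfold resid
  fun_prop

/-- The state of a search from the sources `src` is the list of the arcs along which nodes have been
discovered, the latest first. -/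
def visited (src : List Node) (vis : List Wire) (x : Node) : Bool :=
  decide (x ∈ src) || decide (x ∈ vis.map fun a => a.2)

@[fun_prop]
theorem fp_visited {src : δ → List Node} {vis : δ → List Wire} {x : δ → Node} (h1 : FP src)
    (h2 : FP vis) (h3 : FP x) : FP (fun y => visited (src y) (vis y) (x y)) := by
  unfold visited
  fun_prop

/-- Extend the search by one arc if this discovers a node. -/
def searchStep (src : List Node) (vis : List Wire) (a : Wire) : List Wire :=
  bif visited src vis a.1 && !visited src vis a.2 then a :: vis else vis

/-- One round of the search tries all arcs. -/
def searchRound (src : List Node) (R : List Wire) (vis : List Wire) : List Wire :=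
  R.foldl (searchStep src) vis

/-- The search makes one round more than there are arcs, so that some round discovers nothing. -/
def search (src : List Node) (R : List Wire) : List Wire :=
  (((0, 0), (0, 0)) :: R).foldl (fun vis _ => searchRound src R vis) []

theorem sz_searchRound (src : List Node) (R vis : List Wire) :
    sz (searchRound src R vis) ≤ sz vis + sz R := by
  unfold searchRound
  induction R generalizing vis with
  | nil => simp
  | cons a R ih =>
    have h1 := ih (searchStep src vis a)
    have h2 : sz (searchStep src vis a) ≤ sz vis + sz a + 1 := by
      unfold searchStep
      cases visited src vis a.1 && !visited src vis a.2 <;> simp <;> omega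
    simp only [List.foldl_cons, sz_cons]
    omega

@[fun_prop]
theorem fp_searchRound {src : δ → List Node} {R vis : δ → List Wire} (h1 : FP src) (h2 : FP R)
    (h3 : FP vis) : FP (fun x => searchRound (src x) (R x) (vis x)) := by
  refine FP.foldl (f := fun x s a => searchStep (src x) s a) (g := fun p => sz p.2 + 1)
    (by unfold searchStep; fun_prop) h3 h2
    (PolyBdd.self.mono fun p => by simp only [sz_prod]; omega) ?_
  intro x b a
  unfold searchStep
  cases visited (src x) b a.1 && !visited (src x) b a.2 <;> simp
  omega

theorem sz_search (src : List Node) (R : List Wire) :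
    sz (search src R) ≤ (R.length + 1) * sz R + 1 := by
  have key : ∀ (l vis : List Wire), sz (l.foldl (fun vis _ => searchRound src R vis) vis) ≤
      sz vis + l.length * sz R := by
    intro l
    induction l with
    | nil => simp
    | cons a l ih =>
      intro vis
      have h1 := ih (searchRound src R vis)
      have h2 := sz_searchRound src R vis
      simp only [List.foldl_cons, List.length_cons, add_mul, one_mul]
      omega
  refine (key (((0, 0), (0, 0)) :: R) []).trans ?_
  simp only [sz_nil, List.length_cons]
  omega

@[fun_prop]
theorem fp_search {src : δ → List Node} {R : δ → List Wire} (h1 : FP src) (h2 : FP R) :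
    FP (fun x => search (src x) (R x)) := by
  refine FP.foldl (f := fun x s _ => searchRound (src x) (R x) s) (g := fun p => sz (R p.1))
    (by fun_prop) (by fun_prop) (by fun_prop) ?_ (fun x b a => sz_searchRound _ _ _)
  exact FP.size (f := fun p : δ × Wire => R p.1) (by fun_prop)

/-- Push one unit of flow along the arc `a`, by cancelling the reversed arc if it is in use. -/
def toggle (Q : List Wire) (a : Wire) : List Wire :=
  bif decide ((a.2, a.1) ∈ Q) then Q.filter fun b => !decide (b = (a.2, a.1)) else a :: Q

@[fun_prop]
theorem fp_toggle {Q : δ → List Wire} {a : δ → Wire} (h1 : FP Q) (h2 : FP a) :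
    FP (fun x => toggle (Q x) (a x)) := by
  unfold toggle
  fun_prop

/-- One step of the walk from a discovered node back to a source: if the arc is the one that
discovered the current node, push flow along it and go to its start. -/
def traceStep (s : Node × List Wire) (a : Wire) : Node × List Wire :=
  bif decide (a.2 = s.1) then (a.1, toggle s.2 a) else s

theorem sz_wire (x : Wire) : sz x = 7 := rfl

theorem sz_toggle (Q : List Wire) (a : Wire) : sz (toggle Q a) ≤ sz Q + 8 := by
  unfold toggle
  cases decide ((a.2, a.1) ∈ Q)
  · simp only [cond_false, sz_cons, sz_wire]
    omega
  · exact (sz_le_of_sublist List.filter_sublist).trans (by omega)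

theorem sz_traceStep (s : Node × List Wire) (a : Wire) : sz (traceStep s a) ≤ sz s + 8 := by
  unfold traceStep
  have := sz_toggle s.2 a
  cases decide (a.2 = s.1)
  · simp
  · simp only [cond_true, sz_prod, sz_nat] at this ⊢
    omega

/-- Push one unit of flow along the path by which the search has discovered `t`. -/
def trace (Q vis : List Wire) (t : Node) : Node × List Wire :=
  vis.foldl traceStep (t, Q)

theorem sz_trace (Q vis : List Wire) (t : Node) : sz (trace Q vis t).2 ≤ sz Q + 8 * vis.length := by
  have key : ∀ s : Node × List Wire, sz (vis.foldl traceStep s) ≤ sz s + 8 * vis.length := by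
    induction vis with
    | nil => simp
    | cons a vis ih =>
      intro s
      have h1 := ih (traceStep s a)
      have h2 := sz_traceStep s a
      simp only [List.foldl_cons, List.length_cons]
      omega
  have h1 : sz (trace Q vis t) = 3 + sz (trace Q vis t).2 + 1 := sz_prod _
  have h2 : sz (trace Q vis t) ≤ 3 + sz Q + 1 + 8 * vis.length := key (t, Q)
  omega

@[fun_prop]
theorem fp_trace {Q vis : δ → List Wire} {t : δ → Node} (h1 : FP Q) (h2 : FP vis) (h3 : FP t) :
    FP (fun x => trace (Q x) (vis x) (t x)) :=
  FP.foldl (f := fun _ s a => traceStep s a) (g := fun _ => 8) (by unfold traceStep; fun_prop)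
    (by fun_prop) h2 (.const 8) (fun _ s a => sz_traceStep s a)

/-- Augment the flow by one unit if a sink can be reached from the sources. -/
def augment (src snk : List Node) (D Q : List Wire) : List Wire :=
  bif (snk.filter fun x => visited src (search src (resid D Q)) x).isEmpty then Q
  else (trace Q (search src (resid D Q))
    ((snk.filter fun x => visited src (search src (resid D Q)) x).headD (0, 0))).2

theorem sz_augment (src snk : List Node) (D Q : List Wire) :
    sz (augment src snk D Q) ≤ sz Q + 8 * ((sz D + 1) * sz D + 1) := by
  unfold augment
  cases (snk.filter fun x => visited src (search src (resid D Q)) x).isEmpty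
  · refine (sz_trace _ _ _).trans (Nat.add_le_add_left (Nat.mul_le_mul_left _ ?_) _)
    have h : (resid D Q).Sublist D := List.filter_sublist
    have h1 := sz_le_of_sublist h
    have h2 := length_lt_sz (resid D Q)
    refine (length_lt_sz _).le.trans ((sz_search _ _).trans (Nat.add_le_add_right ?_ 1))
    exact Nat.mul_le_mul (by omega) h1
  · simp

@[fun_prop]
theorem fp_augment {src snk : δ → List Node} {D Q : δ → List Wire} (h1 : FP src) (h2 : FP snk)
    (h3 : FP D) (h4 : FP Q) : FP (fun x => augment (src x) (snk x) (D x) (Q x)) := by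
  unfold augment
  fun_prop

/-- The flow after one attempt to augment for each entry of `iters`. -/
def maxFlow (src snk : List Node) (D : List Wire) (iters : List ℕ) : List Wire :=
  iters.foldl (fun Q _ => augment src snk D Q) []

@[fun_prop]
theorem fp_maxFlow {src snk : δ → List Node} {D : δ → List Wire} {iters : δ → List ℕ}
    (h1 : FP src) (h2 : FP snk) (h3 : FP D) (h4 : FP iters) :
    FP (fun x => maxFlow (src x) (snk x) (D x) (iters x)) := by
  refine FP.foldl (f := fun x Q _ => augment (src x) (snk x) (D x) Q)
    (g := fun p => 8 * ((sz (D p.1) + 1) * sz (D p.1) + 1)) (by fun_prop) (by fun_prop) h4 ?_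
    (fun x b a => sz_augment _ _ _ _)
  have hD : PolyBdd sz fun p : δ × ℕ => sz (D p.1) :=
    FP.size (f := fun p : δ × ℕ => D p.1) (by fun_prop)
  exact (PolyBdd.const 8).mul (((hD.add (.const 1)).mul hD).add (.const 1))

/-- The nodes of `U` at which a wire of `A` is attached. -/
def terminals (U : List Node) (A : List Wire) : List Node :=
  U.filter fun x => A.any fun e => decide (e.1 = x) || decide (e.2 = x)

@[fun_prop]
theorem fp_terminals {U : δ → List Node} {A : δ → List Wire} (h1 : FP U) (h2 : FP A) :
    FP (fun x => terminals (U x) (A x)) := by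
  unfold terminals
  fun_prop

/-- The nodes of `U` that the maximum flow leaves reachable from the sources. -/
def reachableSide (U src snk : List Node) (D : List Wire) (iters : List ℕ) : List Node :=
  U.filter fun x => visited src (search src (resid D (maxFlow src snk D iters))) x

@[fun_prop]
theorem fp_reachableSide {U src snk : δ → List Node} {D : δ → List Wire} {iters : δ → List ℕ}
    (h0 : FP U) (h1 : FP src) (h2 : FP snk) (h3 : FP D) (h4 : FP iters) :
    FP (fun x => reachableSide (U x) (src x) (snk x) (D x) (iters x)) := by
  unfold reachableSide
  fun_prop

/-- One side of a minimum cut of `U` between the wires of `A` and the other wires that leave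
`U`. -/
def flowCut (E : List Wire) (iters : List ℕ) (U : List Node) (A : List Wire) : List Node :=
  reachableSide U (terminals U A) (terminals U ((delta E U).filter fun e => !decide (e ∈ A)))
    (arcs E U) iters

@[fun_prop]
theorem fp_flowCut {E A : δ → List Wire} {iters : δ → List ℕ} {U : δ → List Node}
    (h0 : FP E) (h1 : FP iters) (h2 : FP U) (h3 : FP A) :
    FP (fun x => flowCut (E x) (iters x) (U x) (A x)) := by
  unfold flowCut
  fun_prop

/-! ### The algorithm: decomposition -/

/-- The sublists of `d` (reversed). At most `bud.length` of them are kept at any time, which bounds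
the running time for all arguments; the algorithm provides a budget that is never exceeded. -/
def subsets (bud : List ℕ) (d : List Wire) : List (List Wire) :=
  d.foldl (fun L e => (L ++ L.map fun a => e :: a).take bud.length) [[]]

theorem sz_subsets (bud : List ℕ) (d : List Wire) :
    sz (subsets bud d) ≤ (sz bud + 1) * (sz d + 1) + 1 := by
  have h1 : ∀ a ∈ subsets bud d, sz a ≤ sz d := by
    induction d using List.reverseRecOn with
    | nil => simp [subsets]
    | append_singleton d e ih =>
      intro a ha
      have h0 := sz_append d [e]
      simp only [sz_cons, sz_nil] at h0
      unfold subsets at ha ih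
      rw [List.foldl_append, List.foldl_cons, List.foldl_nil] at ha
      have ha := List.mem_of_mem_take ha
      simp only [List.mem_append, List.mem_map] at ha
      rcases ha with ha | ⟨b, hb, rfl⟩
      · have := ih a ha
        omega
      · have := ih b hb
        rw [sz_cons]
        omega
  have h2 : (subsets bud d).length ≤ sz bud + 1 := by
    induction d using List.reverseRecOn with
    | nil => simp [subsets]
    | append_singleton d e ih =>
      unfold subsets
      rw [List.foldl_append, List.foldl_cons, List.foldl_nil]
      have := length_lt_sz bud
      refine (List.length_take_le _ _).trans (by omega)
  refine (sz_le_of_forall_le h1).trans (Nat.add_le_add_right (Nat.mul_le_mul_right _ h2) 1)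

@[fun_prop]
theorem fp_subsets {bud : δ → List ℕ} {d : δ → List Wire} (h1 : FP bud) (h2 : FP d) :
    FP (fun x => subsets (bud x) (d x)) := by
  refine FPT.foldl (f := fun x (L : List (List Wire)) e =>
      (L ++ L.map fun a => e :: a).take (bud x).length) (i := fun _ => [[]])
    (M := fun x => (sz (bud x) + 1) * (sz (d x) + 1) + 1) (by fun_prop) (FP.const _) h2 .self
    (((h1.size.add (.const 1)).mul (h2.size.add (.const 1))).add (.const 1)) ?_
  intro x l' hl'
  refine (sz_subsets (bud x) l').trans (Nat.add_le_add_right (Nat.mul_le_mul_left _ ?_) 1)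
  exact Nat.add_le_add_right (sz_le_of_sublist hl'.sublist) 1

/-- The ways of splitting `U` that are tried: a single node against the rest, and a minimum cut for
every way of distributing the wires that leave `U` to the two sides. -/
def candidates (E : List Wire) (iters bud : List ℕ) (U : List Node) :
    List (List Node × List Node) :=
  (U.take 1, U.tail) :: (subsets bud (delta E U)).map fun A =>
    (flowCut E iters U A, U.filter fun x => !decide (x ∈ flowCut E iters U A))

@[fun_prop]
theorem fp_candidates {E : δ → List Wire} {iters bud : δ → List ℕ} {U : δ → List Node}
    (h0 : FP E) (h1 : FP iters) (h2 : FP bud) (h3 : FP U) :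
    FP (fun x => candidates (E x) (iters x) (bud x) (U x)) := by
  unfold candidates
  fun_prop

/-- Both parts are nonempty, and at most `K` wires leave each of them. -/
def isGood (E : List Wire) (K : ℕ) (p : List Node × List Node) : Bool :=
  (!p.1.isEmpty && !p.2.isEmpty) &&
    (decide ((delta E p.1).length ≤ K) && decide ((delta E p.2).length ≤ K))

@[fun_prop]
theorem fp_isGood {E : δ → List Wire} {K : δ → ℕ} {p : δ → List Node × List Node}
    (h0 : FP E) (h1 : FP K) (h2 : FP p) : FP (fun x => isGood (E x) (K x) (p x)) := by
  unfold isGood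
  fun_prop

/-- The good ones among the candidates for splitting `U`. -/
def splits (E : List Wire) (iters bud : List ℕ) (K : ℕ) (U : List Node) :
    List (List Node × List Node) :=
  (candidates E iters bud U).filter fun p => isGood E K p

@[fun_prop]
theorem fp_splits {E : δ → List Wire} {iters bud : δ → List ℕ} {K : δ → ℕ} {U : δ → List Node}
    (h0 : FP E) (h1 : FP iters) (h2 : FP bud) (h3 : FP K) (h4 : FP U) :
    FP (fun x => splits (E x) (iters x) (bud x) (K x) (U x)) := by
  unfold splits
  fun_prop

/-- The state of the decomposition: whether all splits have succeeded so far, the stack of the parts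
still to be split, and the record of what has been done, the latest first. An entry of the record is
the empty list for a split and `[x]` for the completion of the part `{x}`. -/
abbrev SplitState := Bool × List (List Node) × List (List Node)

/-- One step of the decomposition takes the part on top of the stack. -/
def splitStep (V : List Node) (E : List Wire) (iters bud : List ℕ) (K : ℕ) (s : SplitState) :
    SplitState :=
  bif s.2.1.isEmpty || !s.1 then s
  else bif (s.2.1.headD []).tail.isEmpty then
    (true, s.2.1.tail, (s.2.1.headD []).take 1 :: s.2.2)
  else bif (splits E iters bud K (s.2.1.headD [])).isEmpty then (false, s.2.1, s.2.2)
  else (true,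
    (V.filter fun x => decide (x ∈
      ((splits E iters bud K (s.2.1.headD [])).headD ([], [])).1)) ::
    (V.filter fun x => decide (x ∈
      ((splits E iters bud K (s.2.1.headD [])).headD ([], [])).2)) :: s.2.1.tail, [] :: s.2.2)

/-- The decomposition: every split and every completion takes one step, and `2 * V.length` steps
suffice. -/
def decompose (V : List Node) (E : List Wire) (iters bud : List ℕ) (K : ℕ) : SplitState :=
  (V ++ V).foldl (fun s _ => splitStep V E iters bud K s) (true, [V], [])

theorem sz_splitStep (V : List Node) (E : List Wire) (iters bud : List ℕ) (K : ℕ)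
    (s : SplitState) : sz (splitStep V E iters bud K s) ≤ sz s + (2 * sz V + 10) := by
  unfold splitStep
  obtain ⟨b, w, r⟩ := s
  cases hw : w.isEmpty || !b
  · cases w with
    | nil => simp at hw
    | cons U w =>
      simp only [List.headD_cons, List.tail_cons]
      cases h2 : U.tail.isEmpty
      · cases h3 : (splits E iters bud K U).isEmpty
        · have h4 : ∀ f : Node → Bool, sz (V.filter f) ≤ sz V := fun f =>
            sz_le_of_sublist List.filter_sublist
          have h5 : ∀ A B : List Node, sz A ≤ sz V → sz B ≤ sz V →
              sz ((true, A :: B :: w, [] :: r) : SplitState) ≤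
                sz ((b, U :: w, r) : SplitState) + (2 * sz V + 10) := by
            intro A B hA hB
            simp only [sz_prod, sz_bool, sz_cons, sz_nil]
            omega
          exact h5 _ _ (h4 _) (h4 _)
        · simp
      · simp only [cond_false, cond_true, sz_prod, sz_bool, sz_cons]
        have : sz (U.take 1) ≤ 5 := by
          cases U <;> simp
        omega
  · simp

@[fun_prop]
theorem fp_decompose {V : δ → List Node} {E : δ → List Wire} {iters bud : δ → List ℕ} {K : δ → ℕ}
    (h : FP V) (h0 : FP E) (h1 : FP iters) (h2 : FP bud) (h3 : FP K) :
    FP (fun x => decompose (V x) (E x) (iters x) (bud x) (K x)) := by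
  refine FP.foldl (f := fun x s _ => splitStep (V x) (E x) (iters x) (bud x) (K x) s)
    (g := fun p => 2 * sz (V p.1) + 10) (by unfold splitStep; fun_prop) (by fun_prop)
    (by fun_prop) ?_ (fun x b a => sz_splitStep _ _ _ _ _ _)
  have hV : PolyBdd sz fun p : δ × Node => sz (V p.1) :=
    FP.size (f := fun p : δ × Node => V p.1) (by fun_prop)
  exact ((PolyBdd.const 2).mul hV).add (.const 10)

/-! ### The algorithm: tables -/

/-- An assignment of values to wires, as an association list. -/
abbrev Assign := List (Wire × ℕ)

/-- A table assigns to (some of) the assignments of values to the wires that leave a part a number of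
matched time-edges inside the part. -/
abbrev Table := List (Assign × ℕ)

/-- The value of the wire `e`. -/
def lookup (e : Wire) (a : Assign) : ℕ :=
  ((a.filter fun q => decide (q.1 = e)).map fun q => q.2).headD 0

@[fun_prop]
theorem fp_lookup {e : δ → Wire} {a : δ → Assign} (h0 : FP e) (h1 : FP a) :
    FP (fun x => lookup (e x) (a x)) := by
  unfold lookup
  fun_prop

/-- The assignments agree on the wires to which both assign a value. -/
def consistent (a b : Assign) : Bool :=
  a.all fun q => b.all fun q' => !decide (q.1 = q'.1) || decide (q.2 = q'.2)

@[fun_prop]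
theorem fp_consistent {a b : δ → Assign} (h0 : FP a) (h1 : FP b) :
    FP (fun x => consistent (a x) (b x)) := by
  unfold consistent
  fun_prop

/-- The common extension of the two assignments, restricted to the wires to which exactly one of
them assigns a value. -/
def glue (E : List Wire) (a b : Assign) : Assign :=
  (E.filter fun e => Bool.xor (decide (e ∈ a.map fun q => q.1))
    (decide (e ∈ b.map fun q => q.1))).map fun e => (e, lookup e (a ++ b))

@[fun_prop]
theorem fp_glue {E : δ → List Wire} {a b : δ → Assign} (h : FP E) (h0 : FP a) (h1 : FP b) :
    FP (fun x => glue (E x) (a x) (b x)) := by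
  unfold glue
  fun_prop

/-- Insert an entry into a table unless it is dominated, and remove the entries it dominates. -/
def keepMax (T : Table) (p : Assign × ℕ) : Table :=
  bif T.any fun q => decide (q.1 = p.1) && decide (p.2 ≤ q.2) then T
  else p :: T.filter fun q => !decide (q.1 = p.1)

/-- For each assignment, the best of its entries. -/
def best (l : Table) : Table :=
  l.foldl keepMax []

@[fun_prop]
theorem fp_best {l : δ → Table} (h : FP l) : FP (fun x => best (l x)) := by
  refine FP.foldl (f := fun _ T p => keepMax T p) (g := fun p => sz p.2 + 1)
    (by unfold keepMax; fun_prop) (by fun_prop) h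
    (PolyBdd.self.mono fun p => by simp only [sz_prod]; omega) ?_
  intro x T p
  unfold keepMax
  cases T.any fun q => decide (q.1 = p.1) && decide (p.2 ≤ q.2)
  · have : sz (T.filter fun q => !decide (q.1 = p.1)) ≤ sz T :=
      sz_le_of_sublist List.filter_sublist
    simp only [cond_false, sz_cons]
    omega
  · simp

/-- The table of the disjoint union of two parts, from the tables of the parts. As in `subsets`, the
budget only bounds the running time. -/
def join (E : List Wire) (bud : List ℕ) (T₁ T₂ : Table) : Table :=
  (best (T₁.flatMap fun p => (T₂.filter fun q => consistent p.1 q.1).map fun q =>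
    (glue E p.1 q.1, p.2 + q.2))).take bud.length

@[fun_prop]
theorem fp_join {E : δ → List Wire} {bud : δ → List ℕ} {T₁ T₂ : δ → Table} (h : FP E)
    (h0 : FP bud) (h1 : FP T₁) (h2 : FP T₂) :
    FP (fun x => join (E x) (bud x) (T₁ x) (T₂ x)) := by
  unfold join
  fun_prop

theorem mem_keepMax {T : Table} {p q : Assign × ℕ} (h : q ∈ keepMax T p) : q = p ∨ q ∈ T := by
  unfold keepMax at h
  cases h2 : T.any fun q => decide (q.1 = p.1) && decide (p.2 ≤ q.2)
  · rw [h2] at h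
    simp only [cond_false, List.mem_cons, List.mem_filter] at h
    exact h.imp_right And.left
  · rw [h2] at h
    exact .inr h

theorem best_concat (l : Table) (p : Assign × ℕ) : best (l ++ [p]) = keepMax (best l) p := by
  simp [best]

theorem best_subset (l : Table) : best l ⊆ l := by
  induction l using List.reverseRecOn with
  | nil => simp [best]
  | append_singleton l p ih =>
    intro q hq
    rw [best_concat] at hq
    rcases mem_keepMax hq with rfl | hq
    · simp
    · simp [ih hq]

theorem sz_join (E : List Wire) (bud : List ℕ) (T₁ T₂ : Table) :
    sz (join E bud T₁ T₂) ≤ sz bud * (sz E * 10 + 4) + 1 := by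
  refine (sz_le_of_forall_le (m := sz E * 10 + 3) ?_).trans (Nat.add_le_add_right
    (Nat.mul_le_mul_right _ ((List.length_take_le _ _).trans (length_lt_sz bud).le)) 1)
  intro r hr
  have hr := best_subset _ (List.mem_of_mem_take hr)
  simp only [List.mem_flatMap, List.mem_map] at hr
  obtain ⟨p, -, q, -, rfl⟩ := hr
  have h1 : sz (glue E p.1 q.1) ≤ (glue E p.1 q.1).length * (9 + 1) + 1 :=
    sz_le_of_forall_le fun q _ => le_rfl
  have h2 : (glue E p.1 q.1).length ≤ E.length := by
    unfold glue
    rw [List.length_map]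
    exact List.length_filter_le _ _
  have h3 := length_lt_sz E
  simp only [sz_prod, sz_nat]
  omega

/-- The time-edges at the node `x`. -/
def edgesAt (E : List Wire) (x : Node) : List Wire :=
  E.filter fun e => !decide (e.1.1 = e.2.1) && (decide (e.1 = x) || decide (e.2 = x))

/-- The values of the wires at the node `x`, if its vertex may not be matched for `r` more steps and
`m` is the list (with at most one entry) of the matched time-edges at `x`. A wire between the
appearances of a vertex carries the number of steps for which the vertex may not be matched, at most
`D = Δ - 1`, and a time-edge carries whether it is matched. -/
def localValue (D : ℕ) (x : Node) (r : ℕ) (m : List Wire) (e : Wire) : ℕ :=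
  bif decide (e.1.1 = e.2.1) then
    bif decide (e.2 = x) then r else bif m.isEmpty then r - 1 else D
  else bif decide (e ∈ m) then 1 else 0

/-- The table of a single node. A matched time-edge is counted at its first end. -/
def leafTable (E : List Wire) (dl : List ℕ) (D : ℕ) (x : Node) : Table :=
  dl.flatMap fun r =>
    (([] :: (edgesAt E x).map fun e => [e]).filter fun m => m.isEmpty || decide (r = 0)).map
      fun m => ((delta E [x]).map fun e => (e, localValue D x r m e),
        bif m.any fun e => decide (e.1 = x) then 1 else 0)

@[fun_prop]
theorem fp_leafTable {E : δ → List Wire} {dl : δ → List ℕ} {D : δ → ℕ} {x : δ → Node} (h : FP E)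
    (h0 : FP dl) (h1 : FP D) (h2 : FP x) :
    FP (fun y => leafTable (E y) (dl y) (D y) (x y)) := by
  unfold leafTable localValue edgesAt
  fun_prop

/-- One step of the evaluation of the record of the decomposition, with a stack of tables. -/
def evalStep (E : List Wire) (dl : List ℕ) (D : ℕ) (bud : List ℕ) (st : List Table)
    (op : List Node) : List Table :=
  bif op.isEmpty then join E bud (st.headD []) (st.tail.headD []) :: st.tail.tail
  else leafTable E dl D (op.headD (0, 0)) :: st

/-- The evaluation of the record of the decomposition. -/
def evaluate (E : List Wire) (dl : List ℕ) (D : ℕ) (bud : List ℕ) (ops : List (List Node)) :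
    List Table → List Table :=
  ops.foldl (evalStep E dl D bud)

@[fun_prop]
theorem fp_evaluate {E : δ → List Wire} {dl : δ → List ℕ} {D : δ → ℕ} {bud : δ → List ℕ}
    {ops : δ → List (List Node)} {st : δ → List Table} (h : FP E) (h0 : FP dl) (h1 : FP D)
    (h2 : FP bud) (h3 : FP ops) (h4 : FP st) :
    FP (fun x => evaluate (E x) (dl x) (D x) (bud x) (ops x) (st x)) := by
  refine FP.foldl (f := fun x s op => evalStep (E x) (dl x) (D x) (bud x) s op)
    (g := fun p => (sz (bud p.1) * (sz (E p.1) * 10 + 4) + 1) +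
      sz (leafTable (E p.1) (dl p.1) (D p.1) (p.2.headD (0, 0))) + 1)
    (by unfold evalStep; fun_prop) h4 h3 ?_ ?_
  · have hE : PolyBdd sz fun p : δ × List Node => sz (E p.1) :=
      FP.size (f := fun p : δ × List Node => E p.1) (by fun_prop)
    have hb : PolyBdd sz fun p : δ × List Node => sz (bud p.1) :=
      FP.size (f := fun p : δ × List Node => bud p.1) (by fun_prop)
    have hl : PolyBdd sz fun p : δ × List Node =>
        sz (leafTable (E p.1) (dl p.1) (D p.1) (p.2.headD (0, 0))) :=
      FP.size (f := fun p : δ × List Node =>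
        leafTable (E p.1) (dl p.1) (D p.1) (p.2.headD (0, 0))) (by fun_prop)
    exact (((hb.mul ((hE.mul (.const 10)).add (.const 4))).add (.const 1)).add hl).add (.const 1)
  · intro x st op
    unfold evalStep
    cases op.isEmpty
    · simp only [cond_false, sz_cons]
      omega
    · have h1 := sz_join (E x) (bud x) (st.headD []) (st.tail.headD [])
      have h2 : sz st.tail.tail ≤ sz st :=
        sz_le_of_sublist (st.tail.tail_sublist.trans st.tail_sublist)
      simp only [cond_true, sz_cons]
      omega

end MatchingAlgorithm

namespace MatchingAlgorithm

open FunProg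

/-! ### Maximum flows and minimum cuts -/

theorem visited_iff {src : List Node} {vis : List Wire} {x : Node} :
    visited src vis x = true ↔ x ∈ src ∨ ∃ a ∈ vis, a.2 = x := by
  simp [visited]

theorem visited_cons {src : List Node} {vis : List Wire} {a : Wire} {x : Node} :
    visited src (a :: vis) x = true ↔ visited src vis x = true ∨ a.2 = x := by
  simp only [visited_iff, List.mem_cons, exists_eq_or_imp]
  rw [or_assoc]
  exact or_congr Iff.rfl or_comm

/-- A possible state of a search in `R`: every arc leads from a node discovered before to a new
node. -/
def IsSearch (src : List Node) (R : List Wire) : List Wire → Prop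
  | [] => True
  | a :: vis => (a ∈ R ∧ visited src vis a.1 = true ∧ ¬ visited src vis a.2 = true) ∧
      IsSearch src R vis

theorem IsSearch.subset {src : List Node} {R vis : List Wire} (h : IsSearch src R vis) :
    vis ⊆ R := by
  induction vis with
  | nil => simp
  | cons a vis ih => exact List.cons_subset.2 ⟨h.1.1, ih h.2⟩

theorem IsSearch.nodup {src : List Node} {R vis : List Wire} (h : IsSearch src R vis) :
    vis.Nodup := by
  induction vis with
  | nil => simp
  | cons a vis ih =>
    exact List.nodup_cons.2 ⟨fun ha => h.1.2.2 (visited_iff.2 (.inr ⟨a, ha, rfl⟩)), ih h.2⟩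

theorem IsSearch.length_le {src : List Node} {R vis : List Wire} (h : IsSearch src R vis) :
    vis.length ≤ R.length :=
  (h.nodup.subperm h.subset).length_le

/-- No arc of `R` leads out of the set of the discovered nodes. -/
def IsClosed (src : List Node) (R vis : List Wire) : Prop :=
  ∀ a ∈ R, visited src vis a.1 = true → visited src vis a.2 = true

theorem IsSearch.step {src : List Node} {R vis : List Wire} {a : Wire} (h : IsSearch src R vis)
    (ha : a ∈ R) : IsSearch src R (searchStep src vis a) := by
  unfold searchStep
  cases h1 : visited src vis a.1 && !visited src vis a.2
  · exact h
  · simp only [Bool.and_eq_true, Bool.not_eq_true'] at h1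
    exact ⟨⟨ha, h1.1, by simp [h1.2]⟩, h⟩

theorem length_searchStep (src : List Node) (vis : List Wire) (a : Wire) :
    vis.length ≤ (searchStep src vis a).length := by
  unfold searchStep
  cases visited src vis a.1 && !visited src vis a.2 <;> simp

theorem length_searchRound (src : List Node) (R vis : List Wire) :
    vis.length ≤ (searchRound src R vis).length := by
  induction R generalizing vis with
  | nil => exact le_rfl
  | cons a R ih => exact (length_searchStep src vis a).trans (ih _)

theorem IsSearch.round {src : List Node} {R vis : List Wire} (h : IsSearch src R vis) :
    IsSearch src R (searchRound src R vis) := by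
  have key : ∀ (l : List Wire) (vis : List Wire), l ⊆ R → IsSearch src R vis →
      IsSearch src R (searchRound src l vis) := by
    intro l
    induction l with
    | nil => exact fun vis _ h => h
    | cons a l ih =>
      exact fun vis hl h => ih (searchStep src vis a) (fun b hb => hl (by simp [hb]))
        (h.step (hl (by simp)))
  exact key R vis (List.Subset.refl R) h

theorem IsClosed.searchRound_eq {src : List Node} {R vis : List Wire} (h : IsClosed src R vis) :
    searchRound src R vis = vis := by
  have key : ∀ l : List Wire, l ⊆ R → searchRound src l vis = vis := by
    intro l
    induction l with
    | nil => exact fun _ => rfl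
    | cons a l ih =>
      intro hl
      have h1 : searchStep src vis a = vis := by
        have := h a (hl (by simp))
        unfold searchStep
        cases h2 : visited src vis a.1 <;> simp_all
      have h2 : searchRound src (a :: l) vis = searchRound src l (searchStep src vis a) := rfl
      rw [h2, h1]
      exact ih fun b hb => hl (by simp [hb])
  exact key R (List.Subset.refl R)

/-- A round that discovers nothing certifies that the search is complete. -/
theorem isClosed_or_length_lt (src : List Node) (R vis : List Wire) :
    IsClosed src R vis ∨ vis.length < (searchRound src R vis).length := by
  have key : ∀ l : List Wire, IsClosed src l vis ∨ vis.length < (searchRound src l vis).length := by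
    intro l
    induction l with
    | nil => exact .inl (by simp [IsClosed])
    | cons a l ih =>
      have h0 : searchRound src (a :: l) vis = searchRound src l (searchStep src vis a) := rfl
      cases h : visited src vis a.1 && !visited src vis a.2
      · have h1 : searchStep src vis a = vis := by simp [searchStep, h]
        rw [h0, h1]
        refine ih.imp_left fun ih b hb => ?_
        rcases List.mem_cons.1 hb with rfl | hb
        · simpa using h
        · exact ih b hb
      · right
        have h1 : searchStep src vis a = a :: vis := by simp [searchStep, h]
        have h2 := length_searchRound src l (a :: vis)
        rw [h0, h1]
        simpa using h2
  exact key R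

theorem search_spec (src : List Node) (R : List Wire) :
    IsSearch src R (search src R) ∧ IsClosed src R (search src R) := by
  have key : ∀ (l vis : List Wire), IsSearch src R vis →
      IsSearch src R (l.foldl (fun vis _ => searchRound src R vis) vis) ∧
      (IsClosed src R (l.foldl (fun vis _ => searchRound src R vis) vis) ∨
        vis.length + l.length ≤ (l.foldl (fun vis _ => searchRound src R vis) vis).length) := by
    intro l
    induction l with
    | nil => exact fun vis h => ⟨h, .inr (by simp)⟩
    | cons a l ih =>
      intro vis h
      obtain ⟨h1, h2⟩ := ih _ h.round
      refine ⟨h1, ?_⟩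
      rcases isClosed_or_length_lt src R vis with h3 | h3
      · left
        have h4 : ∀ l : List Wire, l.foldl (fun vis _ => searchRound src R vis) vis = vis := by
          intro l
          induction l with
          | nil => rfl
          | cons a l ih => rw [List.foldl_cons, h3.searchRound_eq, ih]
        rwa [h4]
      · refine h2.imp id fun h2 => ?_
        simp only [List.length_cons, List.foldl_cons] at h2 ⊢
        omega
  obtain ⟨h1, h2⟩ := key (((0, 0), (0, 0)) :: R) [] trivial
  refine ⟨h1, h2.resolve_right fun h2 => ?_⟩
  have := h1.length_le
  simp only [List.length_cons, List.length_nil] at h2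
  omega

/-- The net amount of flow that leaves the set `X`. -/
def net (X : Node → Bool) (Q : List Wire) : ℤ :=
  (Q.map fun a => ((X a.1).toNat : ℤ) - (X a.2).toNat).sum

/-- `Q` is a set of arcs of `D` that does not contain an arc together with its reversal. -/
structure IsFlow (D Q : List Wire) : Prop where
  nodup : Q.Nodup
  subset : Q ⊆ D
  swap_notMem : ∀ a ∈ Q, (a.2, a.1) ∉ Q

theorem net_filter_ne {X : Node → Bool} {Q : List Wire} (hQ : Q.Nodup) {b : Wire} (hb : b ∈ Q) :
    net X (Q.filter fun c => !decide (c = b)) =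
      net X Q - (((X b.1).toNat : ℤ) - (X b.2).toNat) := by
  induction Q with
  | nil => simp at hb
  | cons c Q ih =>
    obtain ⟨hc, hQ⟩ := List.nodup_cons.1 hQ
    by_cases h : c = b
    · subst h
      have h1 : Q.filter (fun a => !decide (a = c)) = Q := by
        rw [List.filter_eq_self]
        intro a ha
        have : a ≠ c := fun e => hc (e ▸ ha)
        simp [this]
      simp [net, h1]
    · have h2 : b ∈ Q := by
        rcases List.mem_cons.1 hb with h3 | h3
        · exact absurd h3.symm h
        · exact h3
      have h1 := ih hQ h2
      simp only [net] at h1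
      simp [net, h, h1]
      ring

theorem IsFlow.toggle {D Q : List Wire} (h : IsFlow D Q) {a : Wire} (ha : a ∈ D)
    (hne : a.1 ≠ a.2) (haQ : a ∉ Q) :
    IsFlow D (toggle Q a) ∧ (∀ b ∈ toggle Q a, b = a ∨ b ∈ Q) ∧
      ∀ X, net X (MatchingAlgorithm.toggle Q a) =
        net X Q + ((X a.1).toNat - (X a.2).toNat) := by
  unfold MatchingAlgorithm.toggle
  by_cases hs : (a.2, a.1) ∈ Q
  · simp only [hs, decide_true, cond_true]
    refine ⟨⟨h.nodup.filter _, fun b hb => h.subset (List.mem_of_mem_filter hb), fun b hb hb' =>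
      h.swap_notMem b (List.mem_of_mem_filter hb) (List.mem_of_mem_filter hb')⟩,
      fun b hb => .inr (List.mem_of_mem_filter hb), fun X => ?_⟩
    rw [net_filter_ne h.nodup hs]
    ring
  · simp only [hs, decide_false, cond_false]
    refine ⟨⟨List.nodup_cons.2 ⟨haQ, h.nodup⟩, List.cons_subset.2 ⟨ha, h.subset⟩, ?_⟩,
      fun b hb => List.mem_cons.1 hb, fun X => ?_⟩
    · intro b hb hb'
      rcases List.mem_cons.1 hb with rfl | hb
      · rcases List.mem_cons.1 hb' with e | hb'
        · exact hne (congrArg Prod.snd e)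
        · exact hs hb'
      · rcases List.mem_cons.1 hb' with e | hb'
        · exact hs (e ▸ hb)
        · exact h.swap_notMem b hb hb'
    · simp only [net, List.map_cons, List.sum_cons]
      ring

/-- Following the search back from a discovered node and pushing flow on the way amounts to an
additional unit of flow from some source to that node. -/
theorem IsSearch.trace {src : List Node} {R D vis : List Wire} (hD : ∀ a ∈ D, a.1 ≠ a.2)
    (hvis : IsSearch src R vis) {Q : List Wire} (hQ : IsFlow D Q)
    (h : ∀ a ∈ vis, a ∈ D ∧ a ∉ Q) {t : Node} (ht : visited src vis t = true) :
    (trace Q vis t).1 ∈ src ∧ IsFlow D (trace Q vis t).2 ∧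
      ∀ X, net X (MatchingAlgorithm.trace Q vis t).2 =
        net X Q + ((X (MatchingAlgorithm.trace Q vis t).1).toNat - (X t).toNat) := by
  induction vis generalizing Q t with
  | nil =>
    refine ⟨?_, hQ, fun X => ?_⟩
    · simpa [visited_iff, MatchingAlgorithm.trace] using ht
    · simp [MatchingAlgorithm.trace]
  | cons a vis ih =>
    have hrest : ∀ b ∈ vis, b ∈ D ∧ b ∉ Q := fun b hb => h b (by simp [hb])
    by_cases hat : a.2 = t
    · have h0 : MatchingAlgorithm.trace Q (a :: vis) t =
          MatchingAlgorithm.trace (MatchingAlgorithm.toggle Q a) vis a.1 := by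
        simp [MatchingAlgorithm.trace, traceStep, hat]
      obtain ⟨haD, haQ⟩ := h a (by simp)
      obtain ⟨h1, h2, h3⟩ := hQ.toggle haD (hD a haD) haQ
      have h4 : ∀ b ∈ vis, b ∈ D ∧ b ∉ MatchingAlgorithm.toggle Q a := by
        refine fun b hb => ⟨(hrest b hb).1, fun hb' => ?_⟩
        rcases h2 b hb' with rfl | hb'
        · exact hvis.1.2.2 (visited_iff.2 (.inr ⟨b, hb, rfl⟩))
        · exact (hrest b hb).2 hb'
      obtain ⟨h5, h6, h7⟩ := ih hvis.2 h1 h4 hvis.1.2.1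
      rw [h0]
      refine ⟨h5, h6, fun X => ?_⟩
      rw [h7, h3, hat]
      ring
    · have h0 : MatchingAlgorithm.trace Q (a :: vis) t = MatchingAlgorithm.trace Q vis t := by
        simp [MatchingAlgorithm.trace, traceStep, hat]
      rw [h0]
      exact ih hvis.2 hQ hrest ((visited_cons.1 ht).resolve_right hat)

/-- The set `X` contains all sources and no sink. -/
def Separates (src snk : List Node) (X : Node → Bool) : Prop :=
  (∀ x ∈ src, X x = true) ∧ ∀ x ∈ snk, X x = false

/-- No sink can be reached in the residual network. -/
def IsMaximal (src snk : List Node) (D Q : List Wire) : Prop :=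
  ∀ x ∈ snk, visited src (search src (resid D Q)) x = false

theorem augment_spec {src snk : List Node} {D Q : List Wire} (hD : ∀ a ∈ D, a.1 ≠ a.2)
    (hQ : IsFlow D Q) :
    (IsMaximal src snk D Q ∧ augment src snk D Q = Q) ∨
      (IsFlow D (augment src snk D Q) ∧
        ∀ X, Separates src snk X → net X (augment src snk D Q) = net X Q + 1) := by
  cases h : snk.filter fun x => visited src (search src (resid D Q)) x with
  | nil =>
    left
    refine ⟨fun x hx => ?_, by simp [augment, h]⟩
    have := List.filter_eq_nil_iff.1 h x hx
    simpa using this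
  | cons t l =>
    right
    have ht : t ∈ snk.filter fun x => visited src (search src (resid D Q)) x := by rw [h]; simp
    obtain ⟨ht1, ht2⟩ := List.mem_filter.1 ht
    have h0 : augment src snk D Q = (trace Q (search src (resid D Q)) t).2 := by
      simp [augment, h]
    have hs := (search_spec src (resid D Q)).1
    obtain ⟨h1, h2, h3⟩ := hs.trace hD hQ (fun a ha => by
      have := hs.subset ha
      simpa [resid] using this) ht2
    rw [h0]
    refine ⟨h2, fun X hX => ?_⟩
    rw [h3, hX.1 _ h1, hX.2 _ ht1]
    simp

theorem IsFlow.net_le {D Q : List Wire} (hQ : IsFlow D Q) (X : Node → Bool) :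
    net X Q ≤ (D.filter fun a => X a.1 && !X a.2).length := by
  have h1 : net X Q ≤ (Q.filter fun a => X a.1 && !X a.2).length := by
    have key : ∀ Q : List Wire, net X Q ≤ (Q.filter fun a => X a.1 && !X a.2).length := by
      intro Q
      induction Q with
      | nil => simp [net]
      | cons a Q ih =>
        simp only [net, List.map_cons, List.sum_cons] at ih ⊢
        cases h1 : X a.1 <;> cases h2 : X a.2 <;> simp [h1, h2] <;> omega
    exact key Q
  have h2 : (Q.filter fun a => X a.1 && !X a.2).length ≤
      (D.filter fun a => X a.1 && !X a.2).length := by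
    refine ((hQ.nodup.filter _).subperm fun a ha => ?_).length_le
    rw [List.mem_filter] at ha ⊢
    exact ⟨hQ.subset ha.1, ha.2⟩
  omega

theorem maxFlow_spec {src snk : List Node} {D : List Wire} {iters : List ℕ}
    (hD : ∀ a ∈ D, a.1 ≠ a.2) :
    IsFlow D (maxFlow src snk D iters) ∧ ∃ j : ℕ,
      (∀ X, Separates src snk X → net X (maxFlow src snk D iters) = j) ∧
      (IsMaximal src snk D (maxFlow src snk D iters) ∨ j = iters.length) := by
  induction iters using List.reverseRecOn with
  | nil =>
    exact ⟨⟨by simp [maxFlow], by simp [maxFlow], by simp [maxFlow]⟩, 0, by simp [maxFlow, net],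
      .inr rfl⟩
  | append_singleton l i ih =>
    have h0 : maxFlow src snk D (l ++ [i]) = augment src snk D (maxFlow src snk D l) := by
      simp [maxFlow]
    obtain ⟨h1, j, h2, h3⟩ := ih
    rw [h0]
    rcases augment_spec hD h1 with ⟨h4, h5⟩ | ⟨h4, h5⟩
    · rw [h5]
      exact ⟨h1, j, h2, .inl h4⟩
    · rcases h3 with h3 | h3
      · -- a maximal flow is not augmented
        have h6 : augment src snk D (maxFlow src snk D l) = maxFlow src snk D l := by
          have : snk.filter (fun x =>
              visited src (search src (resid D (maxFlow src snk D l))) x) = [] := by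
            rw [List.filter_eq_nil_iff]
            intro x hx
            simp [h3 x hx]
          simp [augment, this]
        rw [h6]
        exact ⟨h1, j, h2, .inl h3⟩
      · refine ⟨h4, j + 1, fun X hX => by rw [h5 X hX, h2 X hX]; push_cast; rfl, .inr ?_⟩
        simp [h3]

/-- If some set separates the sources from the sinks and at most `c` arcs leave it, then more than
`c` attempts to augment lead to a flow for which the set of the reachable nodes has this property as
well. -/
theorem reachable_cut {src snk : List Node} {D : List Wire} {iters : List ℕ} {c : ℕ}
    (hD : ∀ a ∈ D, a.1 ≠ a.2) (hnd : D.Nodup) (hsymm : ∀ a ∈ D, (a.2, a.1) ∈ D)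
    (hc : c < iters.length) {X : Node → Bool} (hX : Separates src snk X)
    (hXc : (D.filter fun a => X a.1 && !X a.2).length ≤ c) {Y : Node → Bool}
    (hY : Y = visited src (search src (resid D (maxFlow src snk D iters)))) :
    Separates src snk Y ∧ (D.filter fun a => Y a.1 && !Y a.2).length ≤ c := by
  obtain ⟨hQ, j, hj, hmax⟩ := maxFlow_spec (iters := iters) (src := src) (snk := snk) hD
  set Q := maxFlow src snk D iters
  have hjc : j ≤ c := by
    have h1 := hQ.net_le X
    rw [hj X hX] at h1
    omega
  have hmax : IsMaximal src snk D Q := hmax.resolve_right (by omega)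
  have hYs : Separates src snk Y := by
    refine ⟨fun x hx => ?_, fun x hx => ?_⟩
    · rw [hY]
      exact visited_iff.2 (.inl hx)
    · rw [hY]
      exact hmax x hx
  refine ⟨hYs, ?_⟩
  -- the arcs that leave `Y` are saturated, and the flow uses no arc into `Y`
  have hout : ∀ a ∈ D, Y a.1 = true → Y a.2 = false → a ∈ Q := by
    intro a ha h1 h2
    by_contra h3
    have h4 := (search_spec src (resid D Q)).2 a (by simp [resid, ha, h3])
    rw [← hY] at h4
    simp [h4 h1] at h2
  have hin : ∀ a ∈ Q, Y a.1 = false → Y a.2 = false := by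
    intro a ha h1
    by_contra h2
    exact hQ.swap_notMem a ha (hout (a.2, a.1) (hsymm a (hQ.subset ha)) (by simpa using h2) h1)
  have hnet : net Y Q = (Q.filter fun a => Y a.1 && !Y a.2).length := by
    have key : ∀ Q : List Wire, (∀ a ∈ Q, Y a.1 = false → Y a.2 = false) →
        net Y Q = (Q.filter fun a => Y a.1 && !Y a.2).length := by
      intro Q
      induction Q with
      | nil => simp [net]
      | cons a Q ih =>
        intro h
        have h0 := ih fun b hb => h b (by simp [hb])
        have h3 := h a (by simp)
        simp only [net, List.map_cons, List.sum_cons] at h0 ⊢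
        cases h1 : Y a.1
        · simp [h3 h1, h1, h0]
        · cases h2 : Y a.2
          · simp [h1, h2, h0]
            ring
          · simp [h1, h2, h0]
    exact key Q hin
  have h1 : (D.filter fun a => Y a.1 && !Y a.2).length ≤
      (Q.filter fun a => Y a.1 && !Y a.2).length := by
    refine ((hnd.filter _).subperm fun a ha => ?_).length_le
    rw [List.mem_filter] at ha ⊢
    simp only [Bool.and_eq_true, Bool.not_eq_true'] at ha
    exact ⟨hout a ha.1 ha.2.1 ha.2.2, by simp [ha.2.1, ha.2.2]⟩
  rw [hj Y hYs] at hnet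
  omega

/-- The requirements on a list of wires: there are no loops, and no wire is listed twice, not even
with different orientations. -/
structure IsWiring (E : List Wire) : Prop where
  nodup : E.Nodup
  ne : ∀ e ∈ E, e.1 ≠ e.2
  swap_notMem : ∀ e ∈ E, (e.2, e.1) ∉ E

theorem length_filter_arcs (E : List Wire) (U : List Node) (X : Node → Bool) :
    ((arcs E U).filter fun a => X a.1 && !X a.2).length =
      (E.filter fun e => (decide (e.1 ∈ U) && decide (e.2 ∈ U)) &&
        Bool.xor (X e.1) (X e.2)).length := by
  induction E with
  | nil => simp [arcs]
  | cons e E ih =>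
    simp only [arcs, List.filter_append, List.length_append] at ih ⊢
    cases h : decide (e.1 ∈ U) && decide (e.2 ∈ U)
    · simp only [List.filter_cons, h]
      simpa using ih
    · simp only [List.filter_cons, h, if_true, List.map_cons, Bool.true_and]
      cases h1 : X e.1 <;> cases h2 : X e.2 <;> simp <;> simp at ih <;> omega

/-- The cut computed from the flow is at least as good as any given cut. -/
theorem flowCut_spec {E : List Wire} (hE : IsWiring E) {iters : List ℕ} {U : List Node}
    {A : List Wire} {c : ℕ} (hc : c < iters.length) {X : Node → Bool}
    (hX : Separates (terminals U A)
      (terminals U ((delta E U).filter fun e => !decide (e ∈ A))) X)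
    (hXc : (E.filter fun e => (decide (e.1 ∈ U) && decide (e.2 ∈ U)) &&
        Bool.xor (X e.1) (X e.2)).length ≤ c) :
    (∀ x ∈ terminals U A, x ∈ flowCut E iters U A) ∧
    (∀ x ∈ terminals U ((delta E U).filter fun e => !decide (e ∈ A)),
      x ∉ flowCut E iters U A) ∧
    (E.filter fun e => (decide (e.1 ∈ U) && decide (e.2 ∈ U)) &&
        Bool.xor (decide (e.1 ∈ flowCut E iters U A))
          (decide (e.2 ∈ flowCut E iters U A))).length ≤ c := by
  set src := terminals U A with hsrc
  set snk := terminals U ((delta E U).filter fun e => !decide (e ∈ A)) with hsnk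
  set Y := visited src (search src (resid (arcs E U) (maxFlow src snk (arcs E U) iters))) with hY
  have hmem : ∀ x, x ∈ flowCut E iters U A ↔ x ∈ U ∧ Y x = true := by
    intro x
    simp [flowCut, reachableSide, ← hsrc, ← hsnk, ← hY]
  have hU : ∀ x B, x ∈ terminals U B → x ∈ U := fun x B h => List.mem_of_mem_filter h
  have hnd : (arcs E U).Nodup := by
    refine List.Nodup.append (hE.nodup.filter _) ((hE.nodup.filter _).map ?_) ?_
    · intro a b hab
      simp only [Prod.mk.injEq] at hab
      exact Prod.ext hab.2 hab.1
    · intro a ha ha'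
      obtain ⟨b, hb, rfl⟩ := List.mem_map.1 ha'
      exact hE.swap_notMem b (List.mem_of_mem_filter hb) (List.mem_of_mem_filter ha)
  obtain ⟨h1, h2⟩ := reachable_cut (D := arcs E U) (by
      intro a ha
      rcases List.mem_append.1 ha with ha | ha
      · exact hE.ne a (List.mem_of_mem_filter ha)
      · obtain ⟨b, hb, rfl⟩ := List.mem_map.1 ha
        exact (hE.ne b (List.mem_of_mem_filter hb)).symm) hnd (by
      intro a ha
      rcases List.mem_append.1 ha with ha | ha
      · exact List.mem_append.2 (.inr (List.mem_map.2 ⟨a, ha, rfl⟩))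
      · obtain ⟨b, hb, rfl⟩ := List.mem_map.1 ha
        exact List.mem_append.2 (.inl hb)) hc hX (by rwa [length_filter_arcs]) hY
  refine ⟨fun x hx => (hmem x).2 ⟨hU x _ hx, h1.1 x hx⟩, fun x hx hx' => ?_, ?_⟩
  · have := ((hmem x).1 hx').2
    rw [h1.2 x hx] at this
    exact Bool.false_ne_true this
  · rw [length_filter_arcs] at h2
    refine le_trans (le_of_eq (congrArg List.length (List.filter_congr fun e _ => ?_))) h2
    simp only [hmem]
    by_cases h3 : e.1 ∈ U <;> by_cases h4 : e.2 ∈ U <;> simp [h3, h4]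

end MatchingAlgorithm

namespace MatchingAlgorithm

open FunProg

/-! ### Tables of partial solutions -/

theorem mem_delta {E : List Wire} {U : List Node} {e : Wire} :
    e ∈ delta E U ↔ e ∈ E ∧ crosses U e = true := List.mem_filter

theorem delta_congr {E : List Wire} {U U' : List Node} (h : ∀ x, x ∈ U ↔ x ∈ U') :
    delta E U = delta E U' := by
  refine List.filter_congr fun e _ => ?_
  simp [crosses, h]

/-- The assignment of the values of `f` to the wires that leave `U`. -/
def restrict (E : List Wire) (U : List Node) (f : Wire → ℕ) : Assign :=
  (delta E U).map fun e => (e, f e)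

/-- A system of local constraints: `loc x f w` means that the values of `f` are admissible at the
node `x` and contribute `w` to the objective. It depends on the wires at `x` only. -/
def IsLocal (E : List Wire) (loc : Node → (Wire → ℕ) → ℕ → Prop) : Prop :=
  ∀ x f g w, (∀ e ∈ delta E [x], f e = g e) → loc x f w → loc x g w

/-- The values of `f` are admissible at all nodes of `U` and contribute `w` in total. -/
def Sat (loc : Node → (Wire → ℕ) → ℕ → Prop) (U : Finset Node) (f : Wire → ℕ) (w : ℕ) : Prop :=
  ∃ wt : Node → ℕ, (∀ x ∈ U, loc x f (wt x)) ∧ w = ∑ x ∈ U, wt x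

/-- `T` lists, for the assignments to the wires that leave `U`, the maximum contribution of the nodes
of `U`. All values that occur are less than `b`. -/
structure IsTable (E : List Wire) (loc : Node → (Wire → ℕ) → ℕ → Prop) (b : ℕ) (U : List Node)
    (T : Table) : Prop where
  sound : ∀ p ∈ T, ∃ f : Wire → ℕ, (∀ e, f e < b) ∧ p.1 = restrict E U f ∧ Sat loc U.toFinset f p.2
  complete : ∀ f w, Sat loc U.toFinset f w → ∃ w', w ≤ w' ∧ (restrict E U f, w') ∈ T

theorem IsTable.congr {E : List Wire} {loc : Node → (Wire → ℕ) → ℕ → Prop} {b : ℕ}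
    {U U' : List Node} {T : Table} (h : IsTable E loc b U T) (hU : ∀ x, x ∈ U ↔ x ∈ U') :
    IsTable E loc b U' T := by
  have h1 : U.toFinset = U'.toFinset := by ext x; simp [hU]
  have h2 : ∀ f, restrict E U f = restrict E U' f := fun f => by
    rw [restrict, restrict, delta_congr hU]
  exact ⟨fun p hp => by simpa only [h1, h2] using h.sound p hp,
    fun f w hf => by simpa only [h2] using h.complete f w (by rwa [h1])⟩

theorem keys_nodup_keepMax {T : Table} (h : (T.map fun q => q.1).Nodup) (p : Assign × ℕ) :
    ((keepMax T p).map fun q => q.1).Nodup := by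
  unfold keepMax
  cases T.any fun q => decide (q.1 = p.1) && decide (p.2 ≤ q.2)
  · simp only [cond_false, List.map_cons]
    refine List.nodup_cons.2 ⟨fun hp => ?_, h.sublist (List.filter_sublist.map _)⟩
    obtain ⟨q, hq, hqp⟩ := List.mem_map.1 hp
    simpa [hqp] using (List.mem_filter.1 hq).2
  · exact h

theorem keys_nodup_best (l : Table) : ((best l).map fun q => q.1).Nodup := by
  induction l using List.reverseRecOn with
  | nil => simp [best]
  | append_singleton l p ih => rw [best_concat]; exact keys_nodup_keepMax ih p

theorem exists_keepMax {T : Table} {p r : Assign × ℕ}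
    (h : r = p ∨ ∃ w, r.2 ≤ w ∧ (r.1, w) ∈ T) : ∃ w, r.2 ≤ w ∧ (r.1, w) ∈ keepMax T p := by
  unfold keepMax
  cases hT : T.any fun q => decide (q.1 = p.1) && decide (p.2 ≤ q.2)
  · simp only [cond_false]
    by_cases hr : r.1 = p.1
    · refine ⟨p.2, ?_, by simp [hr]⟩
      rcases h with rfl | ⟨w, hw, hwT⟩
      · exact le_rfl
      · rw [List.any_eq_false] at hT
        have := hT _ hwT
        simp only [hr, decide_true, Bool.true_and, decide_eq_true_eq] at this
        omega
    · rcases h with rfl | ⟨w, hw, hwT⟩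
      · exact absurd rfl hr
      · exact ⟨w, hw, List.mem_cons_of_mem _ (List.mem_filter.2 ⟨hwT, by simp [hr]⟩)⟩
  · rcases h with rfl | h
    · obtain ⟨q, hq, h2⟩ := List.any_eq_true.1 hT
      simp only [Bool.and_eq_true, decide_eq_true_eq] at h2
      exact ⟨q.2, h2.2, by rw [← h2.1]; exact hq⟩
    · exact h

theorem exists_best {l : Table} {r : Assign × ℕ} (h : r ∈ l) :
    ∃ w, r.2 ≤ w ∧ (r.1, w) ∈ best l := by
  induction l using List.reverseRecOn with
  | nil => simp at h
  | append_singleton l p ih =>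
    rw [best_concat]
    refine exists_keepMax ?_
    rcases List.mem_append.1 h with h | h
    · exact .inr (ih h)
    · exact .inl (List.mem_singleton.1 h)

theorem lookup_map_append {l l' : List Wire} {f g : Wire → ℕ} (e : Wire) :
    lookup e ((l.map fun e => (e, f e)) ++ l'.map fun e => (e, g e)) =
      if e ∈ l then f e else if e ∈ l' then g e else 0 := by
  have h1 : ∀ (l : List Wire) (f : Wire → ℕ) (t : List ℕ),
      ((((l.map fun e => (e, f e)).filter fun q => decide (q.1 = e)).map fun q => q.2) ++ t).headD 0
        = if e ∈ l then f e else t.headD 0 := by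
    intro l f t
    induction l with
    | nil => simp
    | cons a l ih =>
      by_cases h : a = e
      · subst h; simp
      · have h' : ¬ e = a := fun h2 => h h2.symm
        simpa [h, h'] using ih
  unfold lookup
  rw [List.filter_append, List.map_append, h1]
  have := h1 l' g []
  simp only [List.append_nil] at this
  rw [this]
  simp

theorem restrict_keys (E : List Wire) (U : List Node) (f : Wire → ℕ) :
    ((restrict E U f).map fun q => q.1) = delta E U := by
  simp [restrict, Function.comp_def]

/-- A table with distinct keys, all of which assign values below `b` to the wires of `l`, is small. -/
theorem length_le_of_keys {T : Table} {l : List Wire} {b : ℕ} (hT : (T.map fun q => q.1).Nodup)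
    (h : ∀ p ∈ T, ∃ f : Wire → ℕ, (∀ e, f e < b) ∧ p.1 = l.map fun e => (e, f e)) :
    T.length ≤ b ^ l.length := by
  classical
  let S : Finset Assign := Finset.univ.image fun g : Fin l.length → Fin b =>
    List.ofFn fun i => (l.get i, (g i : ℕ))
  have hsub : (T.map fun q => q.1).toFinset ⊆ S := by
    intro a ha
    obtain ⟨p, hp, rfl⟩ := List.mem_map.1 (List.mem_toFinset.1 ha)
    obtain ⟨f, hf, hp1⟩ := h p hp
    refine Finset.mem_image.2 ⟨fun i => ⟨f (l.get i), hf _⟩, Finset.mem_univ _, ?_⟩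
    dsimp only
    rw [hp1]
    conv_rhs => rw [← List.ofFn_get l, List.map_ofFn]
    rfl
  calc T.length = (T.map fun q => q.1).toFinset.card := by
        rw [List.toFinset_card_of_nodup hT, List.length_map]
    _ ≤ S.card := Finset.card_le_card hsub
    _ ≤ _ := Finset.card_image_le
    _ = b ^ l.length := by simp

section Join

variable {E : List Wire} {U U₁ U₂ : List Node}

theorem crosses_union (hU : ∀ x, x ∈ U ↔ x ∈ U₁ ∨ x ∈ U₂) (hd : ∀ x ∈ U₁, x ∉ U₂) (e : Wire) :
    crosses U e = Bool.xor (crosses U₁ e) (crosses U₂ e) := by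
  have key : ∀ x, decide (x ∈ U) = Bool.xor (decide (x ∈ U₁)) (decide (x ∈ U₂)) := by
    intro x
    have h := hd x
    by_cases h1 : x ∈ U₁
    · simp [hU, h1, h h1]
    · simp [hU, h1]
  simp only [crosses, key]
  cases decide (e.1 ∈ U₁) <;> cases decide (e.1 ∈ U₂) <;> cases decide (e.2 ∈ U₁) <;>
    cases decide (e.2 ∈ U₂) <;> rfl

/-- The values of `f₁` on the wires that touch `U₁`, and those of `f₂` on the others. -/
def mergeValues (U₁ : List Node) (f₁ f₂ : Wire → ℕ) (e : Wire) : ℕ :=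
  if e.1 ∈ U₁ ∨ e.2 ∈ U₁ then f₁ e else f₂ e

/-- A wire between `U₁` and `U₂` leaves both of them, but not their union. -/
theorem glue_restrict (hU : ∀ x, x ∈ U ↔ x ∈ U₁ ∨ x ∈ U₂) (hd : ∀ x ∈ U₁, x ∉ U₂)
    (f₁ f₂ : Wire → ℕ) : glue E (restrict E U₁ f₁) (restrict E U₂ f₂) =
      restrict E U (mergeValues U₁ f₁ f₂) := by
  unfold glue
  rw [restrict_keys, restrict_keys]
  have h1 : (E.filter fun e => Bool.xor (decide (e ∈ delta E U₁)) (decide (e ∈ delta E U₂))) =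
      delta E U := by
    refine List.filter_congr fun e he => ?_
    rw [crosses_union hU hd]
    simp [mem_delta, he]
  rw [h1]
  refine List.map_congr_left fun e he => ?_
  rw [Prod.mk.injEq]
  refine ⟨rfl, ?_⟩
  rw [restrict, restrict, lookup_map_append]
  obtain ⟨heE, hc⟩ := mem_delta.1 he
  rw [crosses_union hU hd] at hc
  have hd1 := hd e.1
  have hd2 := hd e.2
  simp only [mem_delta, heE, true_and, mergeValues]
  unfold crosses at hc ⊢
  by_cases h1 : e.1 ∈ U₁ <;> by_cases h2 : e.2 ∈ U₁ <;> by_cases h3 : e.1 ∈ U₂ <;>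
    by_cases h4 : e.2 ∈ U₂ <;> simp_all

theorem consistent_restrict {f₁ f₂ : Wire → ℕ} :
    consistent (restrict E U₁ f₁) (restrict E U₂ f₂) = true ↔
      ∀ e ∈ delta E U₁, e ∈ delta E U₂ → f₁ e = f₂ e := by
  simp only [consistent, restrict, List.all_map, List.all_eq_true, Function.comp_apply,
    Bool.or_eq_true, Bool.not_eq_true', decide_eq_false_iff_not, decide_eq_true_eq]
  constructor
  · intro h e h1 h2
    simpa using h e h1 e h2
  · intro h e h1 e' h2
    by_cases he : e = e'
    · subst he
      exact .inr (h e h1 h2)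
    · exact .inl he

theorem touches_of_mem_delta_singleton {x : Node} {e : Wire} (h : e ∈ delta E [x]) :
    e.1 = x ∨ e.2 = x := by
  have := (mem_delta.1 h).2
  by_contra hne
  rw [not_or] at hne
  simp [crosses, hne.1, hne.2] at this

/-- Since the constraints are local, solutions on two disjoint parts that agree on the wires between
them combine to a solution on the union. -/
theorem Sat.merge {loc : Node → (Wire → ℕ) → ℕ → Prop} (hloc : IsLocal E loc)
    (hU : ∀ x, x ∈ U ↔ x ∈ U₁ ∨ x ∈ U₂) (hd : ∀ x ∈ U₁, x ∉ U₂) {f₁ f₂ : Wire → ℕ} {w₁ w₂ : ℕ}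
    (h₁ : Sat loc U₁.toFinset f₁ w₁) (h₂ : Sat loc U₂.toFinset f₂ w₂)
    (hf : ∀ e ∈ delta E U₁, e ∈ delta E U₂ → f₁ e = f₂ e) :
    Sat loc U.toFinset (mergeValues U₁ f₁ f₂) (w₁ + w₂) := by
  obtain ⟨wt₁, h₁, rfl⟩ := h₁
  obtain ⟨wt₂, h₂, rfl⟩ := h₂
  have hUU : U.toFinset = U₁.toFinset ∪ U₂.toFinset := by ext x; simp [hU]
  have hdis : Disjoint U₁.toFinset U₂.toFinset := by
    rw [Finset.disjoint_left]
    intro x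
    simpa using hd x
  refine ⟨fun x => if x ∈ U₁ then wt₁ x else wt₂ x, fun x hx => ?_, ?_⟩
  · by_cases hx1 : x ∈ U₁
    · simp only [hx1, if_true]
      refine hloc x f₁ _ _ (fun e he => ?_) (h₁ x (by simpa using hx1))
      have : e.1 ∈ U₁ ∨ e.2 ∈ U₁ := by
        rcases touches_of_mem_delta_singleton he with h | h <;> simp [h, hx1]
      simp [mergeValues, this]
    · have hx2 : x ∈ U₂ := by
        have := (hU x).1 (by simpa using hx)
        tauto
      simp only [hx1, if_false]
      refine hloc x f₂ _ _ (fun e he => ?_) (h₂ x (by simpa using hx2))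
      unfold mergeValues
      split_ifs with h
      · -- a wire at `x` that touches `U₁` leaves both parts
        have hE := (mem_delta.1 he).1
        symm
        refine hf e (mem_delta.2 ⟨hE, ?_⟩) (mem_delta.2 ⟨hE, ?_⟩)
        all_goals
          have hd1 := hd e.1
          have hd2 := hd e.2
          unfold crosses
          rcases touches_of_mem_delta_singleton he with h3 | h3 <;> subst h3 <;> simp_all
      · rfl
  · rw [hUU, Finset.sum_union hdis]
    refine congrArg₂ _ (Finset.sum_congr rfl fun x hx => ?_) (Finset.sum_congr rfl fun x hx => ?_)
    · simp [List.mem_toFinset.1 hx]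
    · have : x ∉ U₁ := fun h => hd x h (List.mem_toFinset.1 hx)
      simp [this]

theorem Sat.split {loc : Node → (Wire → ℕ) → ℕ → Prop}
    (hU : ∀ x, x ∈ U ↔ x ∈ U₁ ∨ x ∈ U₂) (hd : ∀ x ∈ U₁, x ∉ U₂) {f : Wire → ℕ} {w : ℕ}
    (h : Sat loc U.toFinset f w) : ∃ w₁ w₂, w = w₁ + w₂ ∧ Sat loc U₁.toFinset f w₁ ∧
      Sat loc U₂.toFinset f w₂ := by
  obtain ⟨wt, h, rfl⟩ := h
  have hUU : U.toFinset = U₁.toFinset ∪ U₂.toFinset := by ext x; simp [hU]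
  have hdis : Disjoint U₁.toFinset U₂.toFinset := by
    rw [Finset.disjoint_left]
    intro x
    simpa using hd x
  rw [hUU] at h
  refine ⟨_, _, by rw [hUU, Finset.sum_union hdis], ⟨wt, fun x hx => h x ?_, rfl⟩,
    ⟨wt, fun x hx => h x ?_, rfl⟩⟩
  · exact Finset.mem_union_left _ hx
  · exact Finset.mem_union_right _ hx

/-- The step of the dynamic program. The budget exceeds the number of assignments to the wires that
leave `U`, so that the table is not truncated. -/
theorem isTable_join {loc : Node → (Wire → ℕ) → ℕ → Prop} (hloc : IsLocal E loc)
    (hU : ∀ x, x ∈ U ↔ x ∈ U₁ ∨ x ∈ U₂) (hd : ∀ x ∈ U₁, x ∉ U₂) {b K : ℕ} (hb : 0 < b)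
    {bud : List ℕ} (hbud : b ^ K ≤ bud.length) (hK : (delta E U).length ≤ K) {T₁ T₂ : Table}
    (h₁ : IsTable E loc b U₁ T₁) (h₂ : IsTable E loc b U₂ T₂) :
    IsTable E loc b U (join E bud T₁ T₂) := by
  set L : Table := T₁.flatMap fun p => (T₂.filter fun q => consistent p.1 q.1).map fun q =>
    (glue E p.1 q.1, p.2 + q.2) with hL
  have hsound : ∀ p ∈ L, ∃ f : Wire → ℕ, (∀ e, f e < b) ∧ p.1 = restrict E U f ∧
      Sat loc U.toFinset f p.2 := by
    intro r hr
    simp only [hL, List.mem_flatMap, List.mem_map, List.mem_filter] at hr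
    obtain ⟨p, hp, q, ⟨hq, hpq⟩, rfl⟩ := hr
    obtain ⟨f₁, hf₁, hp1, hs₁⟩ := h₁.sound p hp
    obtain ⟨f₂, hf₂, hq1, hs₂⟩ := h₂.sound q hq
    rw [hp1, hq1] at hpq
    refine ⟨mergeValues U₁ f₁ f₂, fun e => ?_, ?_,
      hs₁.merge hloc hU hd hs₂ (consistent_restrict.1 hpq)⟩
    · unfold mergeValues
      split_ifs
      exacts [hf₁ e, hf₂ e]
    · simp only [hp1, hq1, glue_restrict hU hd]
  have hjoin : join E bud T₁ T₂ = best L := by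
    refine List.take_of_length_le (le_trans (length_le_of_keys (l := delta E U) (b := b)
      (keys_nodup_best L) fun p hp => ?_) ((Nat.pow_le_pow_right hb hK).trans hbud))
    obtain ⟨f, hf, hp, -⟩ := hsound p (best_subset L hp)
    exact ⟨f, hf, hp⟩
  rw [hjoin]
  refine ⟨fun p hp => hsound p (best_subset L hp), fun f w hf => ?_⟩
  obtain ⟨w₁, w₂, rfl, hs₁, hs₂⟩ := hf.split hU hd
  obtain ⟨v₁, hv₁, hm₁⟩ := h₁.complete f w₁ hs₁
  obtain ⟨v₂, hv₂, hm₂⟩ := h₂.complete f w₂ hs₂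
  have hr : (restrict E U f, v₁ + v₂) ∈ L := by
    simp only [hL, List.mem_flatMap, List.mem_map, List.mem_filter]
    refine ⟨_, hm₁, _, ⟨hm₂, consistent_restrict.2 fun _ _ _ => rfl⟩, ?_⟩
    dsimp only
    rw [glue_restrict hU hd]
    congr 2
    funext e
    simp [mergeValues]
  obtain ⟨w', hw', hm⟩ := exists_best hr
  exact ⟨w', by dsimp only at hw'; omega, hm⟩

end Join

/-- The local constraint of the matching problem. -/
def matchLoc (E : List Wire) (dl : List ℕ) (D : ℕ) (x : Node) (f : Wire → ℕ) (w : ℕ) : Prop :=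
  ∃ r ∈ dl, ∃ m ∈ [] :: (edgesAt E x).map fun e => [e], (m = [] ∨ r = 0) ∧
    (∀ e ∈ delta E [x], f e = localValue D x r m e) ∧
    w = bif m.any fun e => decide (e.1 = x) then 1 else 0

theorem isLocal_matchLoc (E : List Wire) (dl : List ℕ) (D : ℕ) : IsLocal E (matchLoc E dl D) := by
  rintro x f g w hfg ⟨r, hr, m, hm, h1, h2, h3⟩
  exact ⟨r, hr, m, hm, h1, fun e he => by rw [← hfg e he, h2 e he], h3⟩

theorem isTable_leafTable (E : List Wire) {dl : List ℕ} {D b : ℕ} (hdl : ∀ r ∈ dl, r < b)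
    (hD : D < b) (hb : 1 < b) (x : Node) :
    IsTable E (matchLoc E dl D) b [x] (leafTable E dl D x) := by
  constructor
  · intro p hp
    simp only [leafTable, List.mem_flatMap, List.mem_map, List.mem_filter] at hp
    obtain ⟨r, hr, m, ⟨hm, hmr⟩, rfl⟩ := hp
    refine ⟨localValue D x r m, fun e => ?_, rfl, ?_⟩
    · have := hdl r hr
      unfold localValue
      cases decide (e.1.1 = e.2.1)
      · cases decide (e ∈ m) <;> simp <;> omega
      · cases decide (e.2 = x)
        · cases m.isEmpty <;> simp <;> omega
        · simpa
    · refine ⟨fun _ => _, fun y hy => ?_, by simp; rfl⟩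
      obtain rfl : y = x := by simpa using hy
      exact ⟨r, hr, m, hm, by simpa using hmr, fun _ _ => rfl, rfl⟩
  · rintro f w ⟨wt, hwt, rfl⟩
    obtain ⟨r, hr, m, hm, h1, h2, h3⟩ := hwt x (by simp)
    refine ⟨wt x, by simp, ?_⟩
    simp only [leafTable, List.mem_flatMap, List.mem_map, List.mem_filter]
    refine ⟨r, hr, m, ⟨hm, by simpa using h1⟩, ?_⟩
    rw [Prod.mk.injEq]
    refine ⟨List.map_congr_left fun e he => ?_, h3.symm⟩
    rw [h2 e he]

end MatchingAlgorithm

namespace MatchingAlgorithm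

open FunProg

/-! ### Correctness of the decomposition -/

/-- `p` splits `U` into two nonempty parts, each of which at most `K` wires leave. -/
structure IsSplit (E : List Wire) (K : ℕ) (U : List Node) (p : List Node × List Node) : Prop where
  mem_iff : ∀ x, x ∈ U ↔ x ∈ p.1 ∨ x ∈ p.2
  disjoint : ∀ x ∈ p.1, x ∉ p.2
  fst_ne_nil : p.1 ≠ []
  snd_ne_nil : p.2 ≠ []
  fst_le : (delta E p.1).length ≤ K
  snd_le : (delta E p.2).length ≤ K

theorem isSplit_of_mem_splits {E : List Wire} {iters bud : List ℕ} {K : ℕ} {U : List Node}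
    (hU : U.Nodup) {p : List Node × List Node} (hp : p ∈ splits E iters bud K U) :
    IsSplit E K U p := by
  obtain ⟨hp, hg⟩ := List.mem_filter.1 hp
  simp only [isGood, Bool.and_eq_true, Bool.not_eq_true', List.isEmpty_eq_false_iff,
    decide_eq_true_eq] at hg
  refine ⟨?_, ?_, hg.1.1, hg.1.2, hg.2.1, hg.2.2⟩
  all_goals
    rcases List.mem_cons.1 hp with rfl | hp
    · cases U with
      | nil => simp
      | cons a U =>
        have := (List.nodup_cons.1 hU).1
        simp [this]
    · obtain ⟨A, -, rfl⟩ := List.mem_map.1 hp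
      intro x
      have : x ∈ flowCut E iters U A → x ∈ U := fun h => List.mem_of_mem_filter h
      by_cases h : x ∈ flowCut E iters U A <;> simp_all

/-- The invariant of the decomposition: the stack consists of parts of `V` that at most `K` wires
leave, and from tables of the parts on the stack the record computes a table of `V`. -/
structure SplitInv (V : List Node) (E : List Wire) (dl : List ℕ) (D : ℕ) (bud : List ℕ) (K b : ℕ)
    (s : SplitState) : Prop where
  parts : ∀ U ∈ s.2.1, U ≠ [] ∧ U.Nodup ∧ U ⊆ V ∧ (delta E U).length ≤ K
  eval : ∀ st, List.Forall₂ (IsTable E (matchLoc E dl D) b) s.2.1 st →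
    ∃ T, evaluate E dl D bud s.2.2 st = [T] ∧ IsTable E (matchLoc E dl D) b V T

section Step

variable {V : List Node} {E : List Wire} {iters dl bud : List ℕ} {D K b : ℕ}

theorem splitStep_nil (s : List (List Node)) (c : Bool) :
    splitStep V E iters bud K (c, [], s) = (c, [], s) := by
  simp [splitStep]

theorem splitStep_singleton (x : Node) (w s : List (List Node)) :
    splitStep V E iters bud K (true, [x] :: w, s) = (true, w, [x] :: s) := by
  simp [splitStep]

theorem splitStep_false (w s : List (List Node)) :
    splitStep V E iters bud K (false, w, s) = (false, w, s) := by
  simp [splitStep]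

theorem splitStep_fail {U : List Node} (hU : 2 ≤ U.length) (w s : List (List Node))
    (h : splits E iters bud K U = []) :
    splitStep V E iters bud K (true, U :: w, s) = (false, U :: w, s) := by
  match U, hU with
  | a :: a' :: U, _ => simp [splitStep, h]

theorem splitStep_split {U : List Node} (hU : 2 ≤ U.length) (w s : List (List Node))
    (h : splits E iters bud K U ≠ []) : ∃ p ∈ splits E iters bud K U,
    splitStep V E iters bud K (true, U :: w, s) = (true,
      (V.filter fun x => decide (x ∈ p.1)) :: (V.filter fun x => decide (x ∈ p.2)) :: w,
      [] :: s) := by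
  match U, hU with
  | a :: a' :: U, _ =>
    cases h2 : splits E iters bud K (a :: a' :: U) with
    | nil => exact absurd h2 h
    | cons p l => exact ⟨p, by simp, by simp [splitStep, h2]⟩

theorem mem_filter_mem {p : List Node} (hp : p ⊆ V) (x : Node) :
    x ∈ V.filter (fun x => decide (x ∈ p)) ↔ x ∈ p := by
  simpa using fun h => hp h

theorem SplitInv.step (hV : V.Nodup) (hdl : ∀ r ∈ dl, r < b) (hD : D < b) (hb : 1 < b)
    (hbud : b ^ K ≤ bud.length) {w s : List (List Node)}
    (h : SplitInv V E dl D bud K b (true, w, s)) :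
    (splitStep V E iters bud K (true, w, s)).1 = true →
      SplitInv V E dl D bud K b (splitStep V E iters bud K (true, w, s)) := by
  cases w with
  | nil => rw [splitStep_nil]; exact fun _ => h
  | cons U w =>
    obtain ⟨hne, hnd, hUV, hUK⟩ := h.parts U (by simp)
    have hw : ∀ U ∈ w, U ≠ [] ∧ U.Nodup ∧ U ⊆ V ∧ (delta E U).length ≤ K :=
      fun U' hU' => h.parts U' (by simp [hU'])
    by_cases h2 : 2 ≤ U.length
    · by_cases h3 : splits E iters bud K U = []
      · rw [splitStep_fail h2 _ _ h3]
        simp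
      · obtain ⟨p, hp, hstep⟩ := splitStep_split (V := V) h2 w s h3
        rw [hstep]
        intro _
        have hp := isSplit_of_mem_splits hnd hp
        have h1V : p.1 ⊆ V := fun x hx => hUV ((hp.mem_iff x).2 (.inl hx))
        have h2V : p.2 ⊆ V := fun x hx => hUV ((hp.mem_iff x).2 (.inr hx))
        have hpart : ∀ q : List Node, q ⊆ V → q ≠ [] → (delta E q).length ≤ K →
            V.filter (fun x => decide (x ∈ q)) ≠ [] ∧
            (V.filter fun x => decide (x ∈ q)).Nodup ∧ V.filter (fun x => decide (x ∈ q)) ⊆ V ∧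
            (delta E (V.filter fun x => decide (x ∈ q))).length ≤ K := by
          intro q hq hne hK
          refine ⟨fun h0 => ?_, hV.filter _, List.filter_subset_self _, ?_⟩
          · obtain ⟨x, hx⟩ := List.exists_mem_of_ne_nil q hne
            have := (mem_filter_mem hq x).2 hx
            simp [h0] at this
          · rwa [delta_congr (mem_filter_mem hq)]
        constructor
        · intro U' hU'
          simp only [List.mem_cons] at hU'
          rcases hU' with rfl | rfl | hU'
          · exact hpart _ h1V hp.fst_ne_nil hp.fst_le
          · exact hpart _ h2V hp.snd_ne_nil hp.snd_le
          · exact hw U' hU'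
        · intro st hst
          dsimp only at hst
          obtain ⟨T₁, st₁, hT₁, hst₁, rfl⟩ := List.forall₂_cons_left_iff.1 hst
          obtain ⟨T₂, st₂, hT₂, hst₂, rfl⟩ := List.forall₂_cons_left_iff.1 hst₁
          have hT : IsTable E (matchLoc E dl D) b U (join E bud T₁ T₂) :=
            isTable_join (isLocal_matchLoc E dl D) hp.mem_iff hp.disjoint (by omega) hbud hUK
              (hT₁.congr (mem_filter_mem h1V)) (hT₂.congr (mem_filter_mem h2V))
          obtain ⟨T, hT1, hT2⟩ := h.eval (join E bud T₁ T₂ :: st₂) (.cons hT hst₂)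
          exact ⟨T, by rw [← hT1]; rfl, hT2⟩
    · obtain ⟨x, rfl⟩ : ∃ x, U = [x] := by
        rw [← List.length_eq_one_iff]
        have := List.length_pos_iff.2 hne
        omega
      rw [splitStep_singleton]
      refine fun _ => ⟨hw, fun st hst => ?_⟩
      obtain ⟨T, hT1, hT2⟩ := h.eval (leafTable E dl D x :: st)
        (.cons (isTable_leafTable E hdl hD hb x) hst)
      exact ⟨T, by rw [← hT1]; rfl, hT2⟩

/-- The number of steps that the decomposition still needs for the parts on the stack. -/
def remaining (w : List (List Node)) : ℕ :=
  (w.map fun U => 2 * U.length - 1).sum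

theorem length_filter_add (hV : V.Nodup) {U : List Node} (hnd : U.Nodup) (hUV : U ⊆ V)
    {p : List Node × List Node} (hp : IsSplit E K U p) :
    (V.filter fun x => decide (x ∈ p.1)).length + (V.filter fun x => decide (x ∈ p.2)).length =
      U.length := by
  rw [← List.toFinset_card_of_nodup (hV.filter _), ← List.toFinset_card_of_nodup (hV.filter _),
    ← List.toFinset_card_of_nodup hnd, ← Finset.card_union_of_disjoint]
  · congr 1
    ext x
    have := @hUV x
    simp only [Finset.mem_union, List.mem_toFinset, List.mem_filter, decide_eq_true_eq,
      hp.mem_iff x] at this ⊢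
    tauto
  · rw [Finset.disjoint_left]
    intro x
    have := hp.disjoint x
    simp only [List.mem_toFinset, List.mem_filter, decide_eq_true_eq]
    tauto

/-- A part with `k` nodes gives rise to `k - 1` splits and `k` completions. -/
theorem SplitInv.progress (hV : V.Nodup)
    (hsplit : ∀ U, U.Nodup → U ⊆ V → 2 ≤ U.length → (delta E U).length ≤ K →
      splits E iters bud K U ≠ []) {w s : List (List Node)}
    (h : SplitInv V E dl D bud K b (true, w, s)) :
    (splitStep V E iters bud K (true, w, s)).1 = true ∧
      remaining (splitStep V E iters bud K (true, w, s)).2.1 ≤ remaining w - 1 := by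
  cases w with
  | nil => simp [splitStep_nil, remaining]
  | cons U w =>
    obtain ⟨hne, hnd, hUV, hUK⟩ := h.parts U (by simp)
    by_cases h2 : 2 ≤ U.length
    · obtain ⟨p, hp, hstep⟩ := splitStep_split (V := V) h2 w s (hsplit U hnd hUV h2 hUK)
      rw [hstep]
      have hp := isSplit_of_mem_splits hnd hp
      have h3 := length_filter_add hV hnd hUV hp
      have hpos : ∀ q : List Node, q ⊆ U → q ≠ [] →
          0 < (V.filter fun x => decide (x ∈ q)).length := by
        intro q hq hne
        obtain ⟨x, hx⟩ := List.exists_mem_of_ne_nil q hne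
        exact List.length_pos_of_mem
          ((mem_filter_mem (fun y hy => hUV (hq hy)) x).2 hx)
      have h4 := hpos p.1 (fun x hx => (hp.mem_iff x).2 (.inl hx)) hp.fst_ne_nil
      have h5 := hpos p.2 (fun x hx => (hp.mem_iff x).2 (.inr hx)) hp.snd_ne_nil
      refine ⟨rfl, ?_⟩
      simp only [remaining, List.map_cons, List.sum_cons]
      omega
    · obtain ⟨x, rfl⟩ : ∃ x, U = [x] := by
        rw [← List.length_eq_one_iff]
        have := List.length_pos_iff.2 hne
        omega
      rw [splitStep_singleton]
      refine ⟨rfl, ?_⟩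
      simp only [remaining, List.map_cons, List.sum_cons, List.length_cons, List.length_nil]
      omega

theorem SplitInv.init (hV : V.Nodup) (hne : V ≠ []) (hK : (delta E V).length ≤ K) :
    SplitInv V E dl D bud K b (true, [V], []) := by
  constructor
  · intro U hU
    obtain rfl : U = V := by simpa using hU
    exact ⟨hne, hV, List.Subset.refl _, hK⟩
  · intro st hst
    obtain ⟨T, st', hT, hst', rfl⟩ := List.forall₂_cons_left_iff.1 hst
    obtain rfl := List.forall₂_nil_left_iff.1 hst'
    exact ⟨T, rfl, hT⟩

/-- If the decomposition succeeds, then its record computes the table of all nodes. -/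
theorem decompose_sound (hV : V.Nodup) (hne : V ≠ []) (hK : (delta E V).length ≤ K)
    (hdl : ∀ r ∈ dl, r < b) (hD : D < b) (hb : 1 < b) (hbud : b ^ K ≤ bud.length)
    (h : (decompose V E iters bud K).1 = true) (h' : (decompose V E iters bud K).2.1 = []) :
    ∃ T, evaluate E dl D bud (decompose V E iters bud K).2.2 [] = [T] ∧
      IsTable E (matchLoc E dl D) b V T := by
  have key : ∀ (l : List Node) (s : SplitState),
      (s.1 = true → SplitInv V E dl D bud K b s) →
      (l.foldl (fun s _ => splitStep V E iters bud K s) s).1 = true →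
      SplitInv V E dl D bud K b (l.foldl (fun s _ => splitStep V E iters bud K s) s) := by
    intro l
    induction l with
    | nil => exact fun s hs h => hs h
    | cons a l ih =>
      rintro ⟨c, w, s⟩ hs h
      refine ih _ ?_ h
      cases c with
      | false => simp [splitStep_false]
      | true => exact (hs rfl).step hV hdl hD hb hbud
  have hinv := key (V ++ V) _ (fun _ => SplitInv.init hV hne hK) h
  refine hinv.eval [] ?_
  unfold decompose at h'
  rw [h']
  exact .nil

/-- If every part with at least two nodes that at most `K` wires leave can be split, then the
decomposition succeeds. -/
theorem decompose_complete (hV : V.Nodup) (hne : V ≠ []) (hK : (delta E V).length ≤ K)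
    (hb : 1 < b) (hbud : b ^ K ≤ bud.length)
    (hsplit : ∀ U, U.Nodup → U ⊆ V → 2 ≤ U.length → (delta E U).length ≤ K →
      splits E iters bud K U ≠ []) :
    (decompose V E iters bud K).1 = true ∧ (decompose V E iters bud K).2.1 = [] := by
  have key : ∀ (l : List Node) (w s : List (List Node)),
      SplitInv V E [] 0 bud K b (true, w, s) →
      (l.foldl (fun s _ => splitStep V E iters bud K s) (true, w, s)).1 = true ∧
      SplitInv V E [] 0 bud K b (l.foldl (fun s _ => splitStep V E iters bud K s) (true, w, s)) ∧
      remaining (l.foldl (fun s _ => splitStep V E iters bud K s) (true, w, s)).2.1 ≤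
        remaining w - l.length := by
    intro l
    induction l with
    | nil => exact fun w s h => ⟨rfl, h, by simp⟩
    | cons a l ih =>
      intro w s h
      obtain ⟨h1, h2⟩ := h.progress hV hsplit
      have h3 := h.step (iters := iters) hV (by simp) (by omega) hb hbud h1
      obtain ⟨c, w', s', hs⟩ : ∃ c w' s', splitStep V E iters bud K (true, w, s) = (c, w', s') :=
        ⟨_, _, _, rfl⟩
      rw [List.foldl_cons]
      rw [hs] at h1 h2 h3 ⊢
      obtain rfl : c = true := h1
      obtain ⟨h4, h5, h6⟩ := ih w' s' h3
      refine ⟨h4, h5, h6.trans ?_⟩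
      simp only [List.length_cons] at h2 ⊢
      omega
  obtain ⟨h1, h2, h3⟩ := key (V ++ V) [V] [] (SplitInv.init hV hne hK)
  refine ⟨h1, ?_⟩
  have h4 : remaining (decompose V E iters bud K).2.1 = 0 := by
    refine Nat.eq_zero_of_le_zero (h3.trans ?_)
    simp [remaining]
    omega
  by_contra h5
  obtain ⟨U, hU⟩ := List.exists_mem_of_ne_nil _ h5
  have h6 := List.length_pos_iff.2 (h2.parts U hU).1
  have h7 : 2 * U.length - 1 ≤ remaining (decompose V E iters bud K).2.1 :=
    List.le_sum_of_mem (List.mem_map.2 ⟨U, hU, rfl⟩)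
  omega

end Step

end MatchingAlgorithm

namespace MatchingAlgorithm

open FunProg

/-! ### The network of a temporal graph -/

/-- The nodes: the appearances of the vertices `vs` at the times `ts`. -/
def nodeList (vs ts : List ℕ) : List Node :=
  vs.flatMap fun v => ts.map fun t => (v, t)

/-- The wires between consecutive appearances of the vertices `vs`, for consecutive times `ts`. -/
def stayWires (vs ts : List ℕ) : List Wire :=
  vs.flatMap fun v => ts.tail.map fun t => ((v, t - 1), (v, t))

/-- The wires of the time-edges. -/
def edgeWires (L : List (ℕ × ℕ × List ℕ)) : List Wire :=
  L.flatMap fun q => q.2.2.map fun t => ((q.1, t), (q.2.1, t))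

/-- The greatest time that occurs in the input; `m + (t - m)` is the maximum of `m` and `t`. -/
def maxTime (L : List (ℕ × ℕ × List ℕ)) : ℕ :=
  (L.flatMap fun q => q.2.2).foldl (fun m t => m + (t - m)) 0

variable {n : ℕ}

open scoped Classical in
/-- The list of the edges of the temporal graph, with the times at which they are active. -/
noncomputable def inputList (G : TemporalGraph (Fin n)) : List (ℕ × ℕ × List ℕ) :=
  ((List.finRange n ×ˢ List.finRange n).filter fun p => p.1 < p.2 ∧ G.graph.Adj p.1 p.2).map
    fun p => (p.1, p.2, (List.range (G.lifetime + 1)).filter fun t => t ∈ G.label s(p.1, p.2))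

theorem enc_inputList (G : TemporalGraph (Fin n)) : Enc.enc (inputList G) = G.encode := by
  unfold inputList TemporalGraph.encode
  simp only [Enc.enc, List.map_map]
  rfl

variable (G : TemporalGraph (Fin n))

theorem le_lifetime {e : Sym2 (Fin n)} {t : ℕ} (h : t ∈ G.label e) : t ≤ G.lifetime :=
  (Finset.le_sup (f := id) h).trans
    (Finset.le_sup (f := fun e => (G.label e).sup id) (Finset.mem_univ e))

theorem exists_of_lt_lifetime {m : ℕ} (h : m < G.lifetime) : ∃ e, ∃ t ∈ G.label e, m < t := by
  unfold TemporalGraph.lifetime at h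
  rw [Finset.lt_sup_iff] at h
  obtain ⟨e, -, he⟩ := h
  rw [Finset.lt_sup_iff] at he
  obtain ⟨t, ht, h⟩ := he
  exact ⟨e, t, ht, h⟩

/-- Every time-edge has a representation with ordered ends. -/
theorem exists_ordered {e : Sym2 (Fin n)} {t : ℕ} (h : t ∈ G.label e) :
    ∃ u v : Fin n, u < v ∧ e = s(u, v) := by
  have hE := G.mem_edgeSet_of_mem_label e t h
  induction e with
  | h a b =>
    have hne : a ≠ b := G.graph.ne_of_adj hE
    rcases lt_or_gt_of_ne hne with h1 | h1
    · exact ⟨a, b, h1, rfl⟩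
    · exact ⟨b, a, h1, Sym2.eq_swap⟩

theorem mem_edgeWires {e : Wire} : e ∈ edgeWires (inputList G) ↔
    ∃ u v : Fin n, u < v ∧ ∃ t ∈ G.label s(u, v), e = (((u : ℕ), t), ((v : ℕ), t)) := by
  simp only [edgeWires, inputList, List.mem_flatMap, List.mem_map, List.mem_filter,
    decide_eq_true_eq, Prod.exists]
  constructor
  · rintro ⟨a, b, l, ⟨u, v, ⟨-, huv, -⟩, he⟩, t, ht, rfl⟩
    simp only [Prod.mk.injEq] at he
    obtain ⟨rfl, rfl, rfl⟩ := he
    simp only [List.mem_filter, decide_eq_true_eq] at ht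
    exact ⟨u, v, huv, t, ht.2, rfl⟩
  · rintro ⟨u, v, huv, t, ht, rfl⟩
    refine ⟨u, v, _, ⟨u, v, ⟨?_, huv, G.mem_edgeSet_of_mem_label _ t ht⟩, rfl⟩, t, ?_, rfl⟩
    · exact List.mem_product.2 ⟨List.mem_finRange u, List.mem_finRange v⟩
    · simp only [List.mem_filter, List.mem_range, decide_eq_true_eq]
      exact ⟨Nat.lt_succ_of_le (le_lifetime G ht), ht⟩

theorem nodup_edgeWires : (edgeWires (inputList G)).Nodup := by
  unfold edgeWires inputList
  rw [List.flatMap_map, List.nodup_flatMap]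
  constructor
  · intro p _
    refine List.Nodup.map (fun a b h => ?_) (List.nodup_range.filter _)
    simpa using h
  · refine List.Pairwise.imp ?_
      (((List.nodup_finRange n).product (List.nodup_finRange n)).filter _)
    intro p q hpq e he he'
    obtain ⟨t, -, rfl⟩ := List.mem_map.1 he
    obtain ⟨t', -, h⟩ := List.mem_map.1 he'
    simp only [Prod.mk.injEq] at h
    exact hpq (Prod.ext (Fin.ext h.1.1.symm) (Fin.ext h.2.1.symm))

theorem maxTime_inputList : maxTime (inputList G) = G.lifetime := by
  have key : ∀ (l : List ℕ) (m : ℕ), m ≤ l.foldl (fun m t => m + (t - m)) m ∧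
      (∀ t ∈ l, t ≤ l.foldl (fun m t => m + (t - m)) m) ∧
      (l.foldl (fun m t => m + (t - m)) m = m ∨ l.foldl (fun m t => m + (t - m)) m ∈ l) := by
    intro l
    induction l with
    | nil => simp
    | cons a l ih =>
      intro m
      obtain ⟨h1, h2, h3⟩ := ih (m + (a - m))
      simp only [List.foldl_cons, List.mem_cons, forall_eq_or_imp]
      refine ⟨by omega, ⟨by omega, h2⟩, ?_⟩
      rcases h3 with h3 | h3
      · rw [h3]
        omega
      · exact .inr (.inr h3)
  have hmem : ∀ t, t ∈ (inputList G).flatMap (fun q => q.2.2) ↔ ∃ e, t ∈ G.label e := by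
    intro t
    simp only [inputList, List.mem_flatMap, List.mem_map, List.mem_filter]
    constructor
    · rintro ⟨q, ⟨p, -, rfl⟩, ht⟩
      simp only [List.mem_filter, decide_eq_true_eq] at ht
      exact ⟨_, ht.2⟩
    · rintro ⟨e, ht⟩
      obtain ⟨u, v, huv, rfl⟩ := exists_ordered G ht
      refine ⟨_, ⟨(u, v), ⟨List.mem_product.2 ⟨List.mem_finRange u, List.mem_finRange v⟩, ?_⟩,
        rfl⟩, ?_⟩
      · simpa using ⟨huv, G.mem_edgeSet_of_mem_label _ t ht⟩
      · simp only [List.mem_filter, List.mem_range, decide_eq_true_eq]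
        exact ⟨Nat.lt_succ_of_le (le_lifetime G ht), ht⟩
  obtain ⟨-, h2, h3⟩ := key ((inputList G).flatMap fun q => q.2.2) 0
  refine le_antisymm ?_ ?_
  · rcases h3 with h3 | h3
    · unfold maxTime
      rw [h3]
      exact Nat.zero_le _
    · obtain ⟨e, he⟩ := (hmem _).1 h3
      exact le_lifetime G he
  · by_contra h
    obtain ⟨e, t, ht, hlt⟩ := exists_of_lt_lifetime G (not_le.1 h)
    have := h2 t ((hmem t).2 ⟨e, ht⟩)
    unfold maxTime at hlt
    omega

/-- The nodes of the network of `G`. -/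
def nodes : List Node :=
  nodeList (List.range n) (List.range' 1 G.lifetime)

/-- The wires of the network of `G`. -/
noncomputable def wires : List Wire :=
  stayWires (List.range n) (List.range' 1 G.lifetime) ++ edgeWires (inputList G)

theorem mem_nodes {x : Node} : x ∈ nodes G ↔ x.1 < n ∧ 1 ≤ x.2 ∧ x.2 ≤ G.lifetime := by
  obtain ⟨v, t⟩ := x
  simp only [nodes, nodeList, List.mem_flatMap, List.mem_range, List.mem_map, List.mem_range'_1,
    Prod.mk.injEq]
  constructor
  · rintro ⟨a, ha, b, hb, rfl, rfl⟩
    omega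
  · rintro ⟨h1, h2, h3⟩
    exact ⟨v, h1, t, by omega, rfl, rfl⟩

theorem nodup_nodes : (nodes G).Nodup := by
  unfold nodes nodeList
  rw [List.nodup_flatMap]
  constructor
  · intro v _
    exact List.Nodup.map (fun a b h => by simpa using h) List.nodup_range'
  · refine List.nodup_range.imp fun {a b} hab x hx hx' => ?_
    obtain ⟨t, -, rfl⟩ := List.mem_map.1 hx
    obtain ⟨t', -, h⟩ := List.mem_map.1 hx'
    simp only [Prod.mk.injEq] at h
    exact hab h.1.symm

theorem mem_stayWires {m : ℕ} {e : Wire} : e ∈ stayWires (List.range n) (List.range' 1 m) ↔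
    ∃ v t, v < n ∧ 1 ≤ t ∧ t + 1 ≤ m ∧ e = ((v, t), (v, t + 1)) := by
  simp only [stayWires, List.tail_range', List.mem_flatMap, List.mem_range, List.mem_map,
    List.mem_range'_1]
  constructor
  · rintro ⟨v, hv, t, ht, rfl⟩
    exact ⟨v, t - 1, hv, by omega, by omega, by rw [Nat.sub_add_cancel (by omega)]⟩
  · rintro ⟨v, t, hv, h1, h2, rfl⟩
    exact ⟨v, hv, t + 1, by omega, rfl⟩

theorem mem_wires {e : Wire} : e ∈ wires G ↔
    (∃ v t, v < n ∧ 1 ≤ t ∧ t + 1 ≤ G.lifetime ∧ e = ((v, t), (v, t + 1))) ∨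
    ∃ u v : Fin n, u < v ∧ ∃ t ∈ G.label s(u, v), e = (((u : ℕ), t), ((v : ℕ), t)) := by
  rw [wires, List.mem_append, mem_stayWires, mem_edgeWires]

theorem mem_nodes_of_mem_wires {e : Wire} (h : e ∈ wires G) : e.1 ∈ nodes G ∧ e.2 ∈ nodes G := by
  rw [mem_nodes, mem_nodes]
  rcases (mem_wires G).1 h with ⟨v, t, hv, h1, h2, rfl⟩ | ⟨u, v, -, t, ht, rfl⟩
  · dsimp only
    omega
  · have h1 := le_lifetime G ht
    have h2 := G.one_le_of_mem_label _ t ht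
    exact ⟨⟨u.2, h2, h1⟩, v.2, h2, h1⟩

theorem delta_nodes : delta (wires G) (nodes G) = [] := by
  refine List.filter_eq_nil_iff.2 fun e he => ?_
  have := mem_nodes_of_mem_wires G he
  simp [crosses, this.1, this.2]

theorem isWiring_wires : IsWiring (wires G) := by
  constructor
  · refine List.Nodup.append ?_ (nodup_edgeWires G) ?_
    · unfold stayWires
      rw [List.nodup_flatMap]
      constructor
      · intro v _
        refine List.Nodup.map (fun a b h => ?_)
          (List.Nodup.sublist (List.tail_sublist _) List.nodup_range')
        simp only [Prod.mk.injEq] at h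
        exact h.2.2
      · refine List.nodup_range.imp fun {a b} hab x hx hx' => ?_
        obtain ⟨t, -, rfl⟩ := List.mem_map.1 hx
        obtain ⟨t', -, h⟩ := List.mem_map.1 hx'
        simp only [Prod.mk.injEq] at h
        exact hab h.1.1.symm
    · intro e he he'
      obtain ⟨v, t, -, -, -, rfl⟩ := mem_stayWires.1 he
      obtain ⟨u, w, -, s, -, h⟩ := (mem_edgeWires G).1 he'
      simp only [Prod.mk.injEq] at h
      omega
  · intro e he
    rcases (mem_wires G).1 he with ⟨v, t, -, -, -, rfl⟩ | ⟨u, v, huv, t, -, rfl⟩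
    · simp
    · simp only [ne_eq, Prod.mk.injEq, and_true]
      exact fun h => huv.ne (Fin.ext h)
  · intro e he he'
    rcases (mem_wires G).1 he with ⟨v, t, -, -, -, rfl⟩ | ⟨u, v, huv, t, -, rfl⟩ <;>
      rcases (mem_wires G).1 he' with ⟨v', t', -, -, -, h⟩ | ⟨u', v', huv', t', -, h⟩ <;>
      simp only [Prod.mk.injEq] at h <;> try rw [Fin.lt_def] at huv
    all_goals try rw [Fin.lt_def] at huv'
    all_goals omega

end MatchingAlgorithm

namespace MatchingAlgorithm

open FunProg

/-! ### Matchings as solutions of local constraints -/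

variable {n : ℕ} (G : TemporalGraph (Fin n))

/-- The time-edges, with ordered ends. -/
def slots : Finset (Fin n × Fin n × ℕ) :=
  (Finset.univ ×ˢ Finset.univ ×ˢ Finset.range (G.lifetime + 1)).filter fun p =>
    p.1 < p.2.1 ∧ p.2.2 ∈ G.label s(p.1, p.2.1)

theorem mem_slots {p : Fin n × Fin n × ℕ} :
    p ∈ slots G ↔ p.1 < p.2.1 ∧ p.2.2 ∈ G.label s(p.1, p.2.1) := by
  simp only [slots, Finset.mem_filter, Finset.mem_product, Finset.mem_univ, true_and,
    Finset.mem_range, and_iff_right_iff_imp, and_imp]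
  exact fun _ h => Nat.lt_succ_of_le (le_lifetime G h)

/-- The wire of a time-edge. -/
def wireOf (p : Fin n × Fin n × ℕ) : Wire :=
  ((p.1, p.2.2), (p.2.1, p.2.2))

/-- The time-edge as an unordered pair of vertices and a time. -/
def edgeOf (p : Fin n × Fin n × ℕ) : Sym2 (Fin n) × ℕ :=
  (s(p.1, p.2.1), p.2.2)

theorem wireOf_injective : Function.Injective (wireOf (n := n)) := by
  intro p q h
  simp only [wireOf, Prod.mk.injEq] at h
  exact Prod.ext (Fin.ext h.1.1) (Prod.ext (Fin.ext h.2.1) h.1.2)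

variable {G}

theorem wireOf_mem {p : Fin n × Fin n × ℕ} (h : p ∈ slots G) : wireOf p ∈ wires G :=
  (mem_wires G).2 (.inr ⟨p.1, p.2.1, ((mem_slots G).1 h).1, p.2.2, ((mem_slots G).1 h).2, rfl⟩)

theorem wireOf_ne {p : Fin n × Fin n × ℕ} (h : p ∈ slots G) :
    (wireOf p).1.1 ≠ (wireOf p).2.1 :=
  fun e => ((mem_slots G).1 h).1.ne (Fin.ext e)

theorem edgeOf_injOn : Set.InjOn (edgeOf (n := n)) (slots G) := by
  intro p hp q hq h
  have h1 := ((mem_slots G).1 hp).1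
  have h2 := ((mem_slots G).1 hq).1
  simp only [edgeOf, Prod.mk.injEq, Sym2.eq_iff] at h
  rcases h with ⟨⟨h3, h4⟩ | ⟨h3, h4⟩, h5⟩
  · exact Prod.ext h3 (Prod.ext h4 h5)
  · rw [h3, h4] at h1
    exact absurd h1 h2.le.not_gt

theorem exists_slot {q : Sym2 (Fin n) × ℕ} (h : q ∈ G.timeEdges) : ∃ p ∈ slots G, edgeOf p = q := by
  obtain ⟨e, t⟩ := q
  obtain ⟨u, v, huv, rfl⟩ := exists_ordered G h
  exact ⟨(u, v, t), (mem_slots G).2 ⟨huv, h⟩, rfl⟩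

theorem edgeOf_mem {p : Fin n × Fin n × ℕ} (h : p ∈ slots G) : edgeOf p ∈ G.timeEdges :=
  ((mem_slots G).1 h).2

/-- The wire of `p` is attached at `x`. -/
def IsAt (x : Node) (p : Fin n × Fin n × ℕ) : Prop :=
  (wireOf p).1 = x ∨ (wireOf p).2 = x

theorem isAt_iff {v : Fin n} {t : ℕ} {p : Fin n × Fin n × ℕ} :
    IsAt ((v : ℕ), t) p ↔ v ∈ (edgeOf p).1 ∧ (edgeOf p).2 = t := by
  simp only [IsAt, wireOf, edgeOf, Prod.mk.injEq, Sym2.mem_iff, Fin.ext_iff]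
  constructor
  · rintro (⟨h1, h2⟩ | ⟨h1, h2⟩)
    · exact ⟨.inl h1.symm, h2⟩
    · exact ⟨.inr h1.symm, h2⟩
  · rintro ⟨h1 | h1, h2⟩
    · exact .inl ⟨h1.symm, h2⟩
    · exact .inr ⟨h1.symm, h2⟩

theorem exists_of_mem_edgesAt {x : Node} {e : Wire} (h : e ∈ edgesAt (wires G) x) :
    ∃ p ∈ slots G, IsAt x p ∧ e = wireOf p := by
  simp only [edgesAt, List.mem_filter, Bool.and_eq_true, Bool.not_eq_true', decide_eq_false_iff_not,
    Bool.or_eq_true, decide_eq_true_eq] at h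
  obtain ⟨he, hne, hx⟩ := h
  rcases (mem_wires G).1 he with ⟨v, t, -, -, -, rfl⟩ | ⟨u, v, huv, t, ht, rfl⟩
  · exact absurd rfl hne
  · exact ⟨(u, v, t), (mem_slots G).2 ⟨huv, ht⟩, hx, rfl⟩

theorem wireOf_mem_edgesAt {x : Node} {p : Fin n × Fin n × ℕ} (hp : p ∈ slots G) (hx : IsAt x p) :
    wireOf p ∈ edgesAt (wires G) x := by
  simp only [edgesAt, List.mem_filter, Bool.and_eq_true, Bool.not_eq_true', decide_eq_false_iff_not,
    Bool.or_eq_true, decide_eq_true_eq]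
  exact ⟨wireOf_mem hp, wireOf_ne hp, hx⟩

theorem mem_delta_singleton {x : Node} {e : Wire} : e ∈ delta (wires G) [x] ↔
    e ∈ wires G ∧ (e.1 = x ∨ e.2 = x) := by
  rw [mem_delta]
  refine and_congr_right fun he => ?_
  have hne := (isWiring_wires G).ne e he
  by_cases h1 : e.1 = x <;> by_cases h2 : e.2 = x
  · exact absurd (h1.trans h2.symm) hne
  all_goals simp [crosses, h1, h2]

theorem localValue_wireOf {D r : ℕ} {x : Node} {m : List Wire} {p : Fin n × Fin n × ℕ}
    (hp : p ∈ slots G) : localValue D x r m (wireOf p) = if wireOf p ∈ m then 1 else 0 := by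
  unfold localValue
  by_cases h : wireOf p ∈ m <;> simp [wireOf_ne hp, h]

theorem localValue_in {D r v t : ℕ} {m : List Wire} :
    localValue D (v, t + 1) r m ((v, t), (v, t + 1)) = r := by
  simp [localValue]

theorem localValue_out {D r v t : ℕ} {m : List Wire} :
    localValue D (v, t) r m ((v, t), (v, t + 1)) = if m = [] then r - 1 else D := by
  unfold localValue
  cases m <;> simp

/-- The matched time-edges at a node. -/
theorem choice_cases {x : Node} {m : List Wire}
    (hm : m ∈ [] :: (edgesAt (wires G) x).map fun e => [e]) :
    m = [] ∨ ∃ p ∈ slots G, IsAt x p ∧ m = [wireOf p] := by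
  rcases List.mem_cons.1 hm with h | h
  · exact .inl h
  · obtain ⟨e, he, rfl⟩ := List.mem_map.1 h
    obtain ⟨p, hp, hx, rfl⟩ := exists_of_mem_edgesAt he
    exact .inr ⟨p, hp, hx, rfl⟩

variable (G) in
/-- The total contribution of a solution is the number of the matched time-edges. -/
theorem Sat.eq_card {dl : List ℕ} {D w : ℕ} {f : Wire → ℕ}
    (h : Sat (matchLoc (wires G) dl D) (nodes G).toFinset f w) :
    w = ((slots G).filter fun p => f (wireOf p) = 1).card := by
  classical
  obtain ⟨wt, h, rfl⟩ := h
  rw [Finset.card_eq_sum_card_fiberwise (f := fun p => (wireOf p).1) (t := (nodes G).toFinset)]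
  · refine Finset.sum_congr rfl fun x hx => ?_
    obtain ⟨r, -, m, hm, -, hf, hw⟩ := h x hx
    have hf' : ∀ p ∈ slots G, IsAt x p → (f (wireOf p) = 1 ↔ wireOf p ∈ m) := by
      intro p hp hxp
      rw [hf _ (mem_delta_singleton.2 ⟨wireOf_mem hp, hxp⟩), localValue_wireOf hp]
      simp
    rw [hw, Finset.filter_filter]
    have h1 : (slots G).filter (fun p => f (wireOf p) = 1 ∧ (wireOf p).1 = x) =
        (slots G).filter fun p => wireOf p ∈ m ∧ (wireOf p).1 = x := by
      refine Finset.filter_congr fun p hp => and_congr_left fun hxp => hf' p hp (.inl hxp)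
    rw [h1]
    rcases choice_cases hm with rfl | ⟨q, hq, -, rfl⟩
    · simp
    · have h2 : (slots G).filter (fun p => wireOf p ∈ [wireOf q] ∧ (wireOf p).1 = x) =
          if (wireOf q).1 = x then {q} else ∅ := by
        ext p
        simp only [Finset.mem_filter, List.mem_singleton, wireOf_injective.eq_iff]
        split_ifs with h3
        · rw [Finset.mem_singleton]
          exact ⟨fun h => h.2.1, by rintro rfl; exact ⟨hq, rfl, h3⟩⟩
        · constructor
          · rintro ⟨-, rfl, h4⟩
            exact absurd h4 h3
          · simp
      rw [h2]
      by_cases h3 : (wireOf q).1 = x <;> simp [h3]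
  · intro p hp
    have := mem_nodes_of_mem_wires G (wireOf_mem (Finset.mem_filter.1 hp).1)
    simpa using this.1

/-- After a time-edge at `v` has been matched at the time `t`, the vertex is blocked for `D` steps. -/
theorem blocked_after {D : ℕ} {r : Node → ℕ} {m : Node → List Wire} {v t : ℕ}
    (hstay : ∀ s, 1 ≤ s → s + 1 ≤ G.lifetime → r (v, s + 1) =
      if m (v, s) = [] then r (v, s) - 1 else D)
    (ht : 1 ≤ t) (hm : m (v, t) ≠ []) (j : ℕ)
    (hj : t + 1 + j ≤ G.lifetime) : D ≤ r (v, t + 1 + j) + j := by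
  induction j with
  | zero => rw [Nat.add_zero, hstay t ht (by omega), if_neg hm]
  | succ j ih =>
    have h1 := ih (by omega)
    have h2 := hstay (t + 1 + j) (by omega) (by omega)
    rw [show t + 1 + (j + 1) = t + 1 + j + 1 from rfl, h2]
    split_ifs with h4 <;> omega

/-- A solution of the local constraints yields a temporal matching. -/
theorem exists_matching_of_sat {Δ w : ℕ} (hΔ : 1 ≤ Δ) {f : Wire → ℕ}
    (h : Sat (matchLoc (wires G) (List.range Δ) (Δ - 1)) (nodes G).toFinset f w) :
    ∃ M : Finset (Sym2 (Fin n) × ℕ), G.IsTemporalMatching Δ M ∧ M.card = w := by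
  classical
  refine ⟨((slots G).filter fun p => f (wireOf p) = 1).image edgeOf, ⟨?_, ?_⟩, ?_⟩
  · intro q hq
    obtain ⟨p, hp, rfl⟩ := Finset.mem_image.1 hq
    exact edgeOf_mem (Finset.mem_filter.1 hp).1
  · obtain ⟨wt, h, -⟩ := h
    have h' : ∀ x : Node, ∃ r m, x ∈ nodes G → (m = [] ∨ r = 0) ∧
        (m = [] ∨ ∃ p ∈ slots G, IsAt x p ∧ m = [wireOf p]) ∧
        ∀ e ∈ delta (wires G) [x], f e = localValue (Δ - 1) x r m e := by
      intro x
      by_cases hx : x ∈ nodes G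
      · obtain ⟨r, -, m, hm, h1, h2, -⟩ := h x (by simpa using hx)
        exact ⟨r, m, fun _ => ⟨h1, choice_cases hm, h2⟩⟩
      · exact ⟨0, [], fun h => absurd h hx⟩
    choose r m hrm using h'
    -- a matched time-edge is the chosen one at both of its ends
    have hmem : ∀ p ∈ slots G, f (wireOf p) = 1 → ∀ x, IsAt x p → x ∈ nodes G ∧ m x = [wireOf p] := by
      intro p hp hf x hx
      have hxn : x ∈ nodes G := by
        have := mem_nodes_of_mem_wires G (wireOf_mem hp)
        rcases hx with rfl | rfl
        exacts [this.1, this.2]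
      refine ⟨hxn, ?_⟩
      obtain ⟨-, h2, h3⟩ := hrm x hxn
      rw [h3 _ (mem_delta_singleton.2 ⟨wireOf_mem hp, hx⟩), localValue_wireOf hp] at hf
      have h4 : wireOf p ∈ m x := by
        by_contra h5
        simp [h5] at hf
      rcases h2 with h2 | ⟨q, -, -, h2⟩
      · simp [h2] at h4
      · rw [h2, List.mem_singleton] at h4
        rw [h2, h4]
    have key : ∀ p ∈ slots G, ∀ q ∈ slots G, f (wireOf p) = 1 → f (wireOf q) = 1 → p ≠ q →
        p.2.2 ≤ q.2.2 → ∀ v : Fin n, v ∈ (edgeOf p).1 → v ∈ (edgeOf q).1 → p.2.2 + Δ ≤ q.2.2 := by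
      intro p hp q hq hfp hfq hpq hle v hvp hvq
      obtain ⟨hpn, hmp⟩ := hmem p hp hfp (v, p.2.2) (isAt_iff.2 ⟨hvp, rfl⟩)
      obtain ⟨hqn, hmq⟩ := hmem q hq hfq (v, q.2.2) (isAt_iff.2 ⟨hvq, rfl⟩)
      have hlt : p.2.2 < q.2.2 := by
        refine lt_of_le_of_ne hle fun heq => hpq (wireOf_injective ?_)
        rw [heq, hmq] at hmp
        simpa using hmp.symm
      obtain ⟨j, hj⟩ := Nat.exists_eq_add_of_le (Nat.succ_le_of_lt hlt)
      rw [mem_nodes] at hpn hqn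
      have hnode : ∀ s, 1 ≤ s → s ≤ G.lifetime → ((v : ℕ), s) ∈ nodes G := fun s h1 h2 =>
        (mem_nodes G).2 ⟨v.2, h1, h2⟩
      have hj' : q.2.2 = p.2.2 + 1 + j := by omega
      have h1 := blocked_after (G := G) (D := Δ - 1) (r := r) (m := m) (v := v) (t := p.2.2) (by
          intro s hs1 hs2
          have hw : (((v : ℕ), s), ((v : ℕ), s + 1)) ∈ wires G :=
            (mem_wires G).2 (.inl ⟨v, s, v.2, hs1, hs2, rfl⟩)
          have h3 := (hrm _ (hnode s hs1 (by omega))).2.2 _ (mem_delta_singleton.2 ⟨hw, .inl rfl⟩)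
          have h4 := (hrm _ (hnode (s + 1) (by omega) hs2)).2.2 _
            (mem_delta_singleton.2 ⟨hw, .inr rfl⟩)
          rw [localValue_out] at h3
          rw [localValue_in] at h4
          rw [← h4, h3]) hpn.2.1 (by simp [hmp]) j
        (by have := hqn.2.2; dsimp only at this; omega)
      have h2 : r (v, p.2.2 + 1 + j) = 0 := by
        rw [← hj']
        exact (hrm _ (hnode q.2.2 hqn.2.1 hqn.2.2)).1.resolve_left (by simp [hmq])
      omega
    intro P hP Q hQ hne
    obtain ⟨p, hp, rfl⟩ := Finset.mem_image.1 hP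
    obtain ⟨q, hq, rfl⟩ := Finset.mem_image.1 hQ
    rw [Finset.mem_filter] at hp hq
    by_cases hv : ∃ v, v ∈ (edgeOf p).1 ∧ v ∈ (edgeOf q).1
    · right
      obtain ⟨v, hvp, hvq⟩ := hv
      have hpq : p ≠ q := fun h => hne (by rw [h])
      simp only [edgeOf]
      rcases le_total p.2.2 q.2.2 with hle | hle
      · have := key p hp.1 q hq.1 hp.2 hq.2 hpq hle v hvp hvq
        rw [abs_of_nonpos (by omega)]
        omega
      · have := key q hq.1 p hp.1 hq.2 hp.2 hpq.symm hle v hvq hvp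
        rw [abs_of_nonneg (by omega)]
        omega
    · exact .inl fun v hv' => hv ⟨v, hv'⟩
  · rw [h.eq_card, Finset.card_image_of_injOn]
    exact edgeOf_injOn.mono fun p hp => (Finset.mem_filter.1 hp).1

/-- The number of steps, from the time `t` on, for which the vertex may not be matched. -/
def blockedTime (D : ℕ) (P : ℕ → Prop) [DecidablePred P] : ℕ → ℕ
  | 0 => 0
  | t + 1 => if P t then D else blockedTime D P t - 1

theorem exists_of_blockedTime_pos {D : ℕ} {P : ℕ → Prop} [DecidablePred P] {t : ℕ}
    (h : 0 < blockedTime D P t) : ∃ s < t, P s ∧ blockedTime D P t + (t - s) ≤ D + 1 := by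
  induction t with
  | zero => simp [blockedTime] at h
  | succ t ih =>
    rw [blockedTime] at h ⊢
    split_ifs at h ⊢ with hP
    · exact ⟨t, by omega, hP, by omega⟩
    · obtain ⟨s, hs, hPs, h2⟩ := ih (by omega)
      exact ⟨s, by omega, hPs, by omega⟩

theorem blockedTime_le (D : ℕ) (P : ℕ → Prop) [DecidablePred P] (t : ℕ) :
    blockedTime D P t ≤ D := by
  induction t with
  | zero => simp [blockedTime]
  | succ t ih => rw [blockedTime]; split_ifs <;> omega

/-- A temporal matching yields a solution of the local constraints. -/
theorem exists_sat_of_matching {Δ : ℕ} (hΔ : 1 ≤ Δ) {M : Finset (Sym2 (Fin n) × ℕ)}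
    (hM : G.IsTemporalMatching Δ M) : ∃ f : Wire → ℕ,
      Sat (matchLoc (wires G) (List.range Δ) (Δ - 1)) (nodes G).toFinset f M.card := by
  classical
  let matched : ℕ → ℕ → Prop := fun v t => ∃ p ∈ slots G, edgeOf p ∈ M ∧ IsAt (v, t) p
  let f : Wire → ℕ := fun e =>
    if e.1.1 = e.2.1 then blockedTime (Δ - 1) (matched e.2.1) e.2.2
    else if ∃ p ∈ slots G, edgeOf p ∈ M ∧ wireOf p = e then 1 else 0
  have hf1 : ∀ p ∈ slots G, f (wireOf p) = if edgeOf p ∈ M then 1 else 0 := by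
    intro p hp
    have h1 : (∃ q ∈ slots G, edgeOf q ∈ M ∧ wireOf q = wireOf p) ↔ edgeOf p ∈ M := by
      constructor
      · rintro ⟨q, -, hq, h⟩
        rwa [← wireOf_injective h]
      · exact fun h => ⟨p, hp, h, rfl⟩
    simp only [f, wireOf_ne hp, if_false, h1]
  have huniq : ∀ (v : Fin n) (t : ℕ), ∀ p ∈ slots G, ∀ q ∈ slots G, edgeOf p ∈ M → edgeOf q ∈ M →
      IsAt ((v : ℕ), t) p → IsAt ((v : ℕ), t) q → p = q := by
    intro v t p hp q hq hpM hqM hvp hvq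
    by_contra hne
    rw [isAt_iff] at hvp hvq
    rcases hM.2 _ hpM _ hqM (fun h => hne (edgeOf_injOn hp hq h)) with h | h
    · exact h v ⟨hvp.1, hvq.1⟩
    · rw [hvp.2, hvq.2, sub_self, abs_zero] at h
      omega
  have hzero : ∀ (v : Fin n) (t : ℕ), matched v t →
      blockedTime (Δ - 1) (matched v) t = 0 := by
    rintro v t ⟨p, hp, hpM, hvp⟩
    by_contra hpos
    obtain ⟨s, hst, ⟨q, hq, hqM, hvq⟩, hs⟩ := exists_of_blockedTime_pos (Nat.pos_of_ne_zero hpos)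
    rw [isAt_iff] at hvp hvq
    have hne : edgeOf p ≠ edgeOf q := by
      intro h
      rw [h] at hvp
      omega
    rcases hM.2 _ hpM _ hqM hne with h | h
    · exact h v ⟨hvp.1, hvq.1⟩
    · rw [hvp.2, hvq.2, abs_of_nonneg (by omega)] at h
      omega
  have hloc : ∀ x ∈ nodes G, ∃ w, matchLoc (wires G) (List.range Δ) (Δ - 1) x f w := by
    rintro ⟨v, t⟩ hx
    obtain ⟨hv, ht1, ht2⟩ := (mem_nodes G).1 hx
    dsimp only at hv ht1 ht2
    obtain ⟨m, hm, hm0, hmM⟩ : ∃ m ∈ [] :: (edgesAt (wires G) (v, t)).map (fun e => [e]),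
        (m = [] ↔ ¬ matched v t) ∧ ∀ p ∈ slots G, IsAt (v, t) p → (wireOf p ∈ m ↔ edgeOf p ∈ M) := by
      by_cases h : matched v t
      · obtain ⟨q, hq, hqM, hvq⟩ := h
        refine ⟨[wireOf q], ?_, ?_, fun p hp hvp => ?_⟩
        · exact List.mem_cons_of_mem _ (List.mem_map.2 ⟨_, wireOf_mem_edgesAt hq hvq, rfl⟩)
        · simp only [List.cons_ne_nil, false_iff, not_not]
          exact ⟨q, hq, hqM, hvq⟩
        · rw [List.mem_singleton, wireOf_injective.eq_iff]
          refine ⟨fun h => h ▸ hqM, fun h => huniq ⟨v, hv⟩ t p hp q hq h hqM hvp hvq⟩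
      · refine ⟨[], by simp, by simp [h], fun p hp hvp => ?_⟩
        simp only [List.not_mem_nil, false_iff]
        exact fun hpM => h ⟨p, hp, hpM, hvp⟩
    refine ⟨_, blockedTime (Δ - 1) (matched v) t, ?_, m, hm, ?_, ?_, rfl⟩
    · have := blockedTime_le (Δ - 1) (matched v) t
      rw [List.mem_range]
      omega
    · rw [hm0]
      by_cases h : matched v t
      · exact .inr (hzero ⟨v, hv⟩ t h)
      · exact .inl h
    · intro e he
      obtain ⟨heE, hex⟩ := mem_delta_singleton.1 he
      rcases (mem_wires G).1 heE with ⟨a, s, -, -, -, rfl⟩ | ⟨a, b, hab, s, hs, rfl⟩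
      · simp only [Prod.mk.injEq] at hex
        rcases hex with ⟨rfl, rfl⟩ | ⟨rfl, rfl⟩
        · rw [localValue_out]
          simp only [f, if_true, blockedTime, hm0]
          split_ifs <;> tauto
        · rw [localValue_in]
          simp [f]
      · have hp : (a, b, s) ∈ slots G := (mem_slots G).2 ⟨hab, hs⟩
        have h1 := hf1 _ hp
        have h2 := localValue_wireOf (D := Δ - 1) (r := blockedTime (Δ - 1) (matched v) t)
          (x := (v, t)) (m := m) hp
        have h3 := hmM _ hp hex
        simp only [h3] at h2
        exact h1.trans h2.symm
  choose! wt hwt using hloc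
  have hsat : Sat (matchLoc (wires G) (List.range Δ) (Δ - 1)) (nodes G).toFinset f
      (∑ x ∈ (nodes G).toFinset, wt x) :=
    ⟨wt, fun x hx => hwt x (List.mem_toFinset.1 hx), rfl⟩
  refine ⟨f, ?_⟩
  convert hsat using 1
  rw [hsat.eq_card]
  have h1 : M = ((slots G).filter fun p => f (wireOf p) = 1).image edgeOf := by
    ext q
    simp only [Finset.mem_image, Finset.mem_filter]
    constructor
    · intro hq
      obtain ⟨p, hp, rfl⟩ := exists_slot (hM.1 q hq)
      exact ⟨p, ⟨hp, by rw [hf1 p hp, if_pos hq]⟩, rfl⟩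
    · rintro ⟨p, ⟨hp, h⟩, rfl⟩
      by_contra hq
      rw [hf1 p hp, if_neg hq] at h
      exact absurd h (by decide)
  conv_lhs => rw [h1]
  exact Finset.card_image_of_injOn (edgeOf_injOn.mono fun p hp => (Finset.mem_filter.1 hp).1)

theorem hasTemporalMatching_iff {Δ h b : ℕ} (hΔ : 1 ≤ Δ) {T : Table}
    (hT : IsTable (wires G) (matchLoc (wires G) (List.range Δ) (Δ - 1)) b (nodes G) T) :
    G.HasTemporalMatching Δ h ↔ ∃ p ∈ T, h ≤ p.2 := by
  constructor
  · rintro ⟨M, hM, hh⟩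
    obtain ⟨f, hf⟩ := exists_sat_of_matching hΔ hM
    obtain ⟨w, hw, hmem⟩ := hT.complete f _ hf
    exact ⟨_, hmem, hh.trans hw⟩
  · rintro ⟨p, hp, hh⟩
    obtain ⟨f, -, -, hf⟩ := hT.sound p hp
    obtain ⟨M, hM, hc⟩ := exists_matching_of_sat hΔ hf
    exact ⟨M, hM, by omega⟩

end MatchingAlgorithm

namespace MatchingAlgorithm

/-! ### Separating a tree at an edge -/

section Tree

variable {N α : Type} {T : SimpleGraph N}

/-- The nodes that lie on the side of `j` once the edge `ij` is removed. -/
def side (T : SimpleGraph N) (i j : N) : Set N :=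
  {x | (T.deleteEdges {s(i, j)}).Reachable j x}

theorem mem_side_of_adj {i j x y : N} (hx : x ∈ side T i j) (h : T.Adj x y)
    (hne : s(x, y) ≠ s(i, j)) : y ∈ side T i j := by
  refine SimpleGraph.Reachable.trans hx (SimpleGraph.Adj.reachable ?_)
  rw [SimpleGraph.deleteEdges_adj]
  exact ⟨h, hne⟩

theorem notMem_side (hT : T.IsAcyclic) {i j : N} (h : T.Adj i j) : i ∉ side T i j := by
  intro hi
  exact (SimpleGraph.isAcyclic_iff_forall_adj_isBridge.1 hT h) (SimpleGraph.Reachable.symm hi)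

theorem disjoint_side (hT : T.IsAcyclic) {i j x : N} (h : T.Adj i j) (hx : x ∈ side T i j) :
    x ∉ side T j i := by
  intro hx'
  refine notMem_side hT h (SimpleGraph.Reachable.trans hx ?_)
  have h2 : (T.deleteEdges {s(j, i)}).Reachable i x := hx'
  rw [Sym2.eq_swap] at h2
  exact h2.symm

theorem exists_mem_side (hT : T.Connected) {s x : N} (hx : x ≠ s) :
    ∃ j, T.Adj s j ∧ x ∈ side T s j := by
  obtain ⟨p, hp⟩ := (hT.preconnected s x).exists_isPath
  cases p with
  | nil => exact absurd rfl hx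
  | @cons _ j _ h q =>
    rw [SimpleGraph.Walk.cons_isPath_iff] at hp
    refine ⟨j, h, ⟨q.toDeleteEdge s(s, j) fun he => hp.2 ?_⟩⟩
    exact q.fst_mem_support_of_mem_edges he

theorem side_ssubset (hT : T.IsAcyclic) {i j k : N} (hij : T.Adj i j) (hjk : T.Adj j k)
    (hki : k ≠ i) : side T j k ⊂ side T i j := by
  have hj : j ∈ side T i j := SimpleGraph.Reachable.refl _
  refine ⟨fun x hx => ?_, fun h => notMem_side hT hjk (h hj)⟩
  have hx := (SimpleGraph.reachable_iff_reflTransGen _ _).1 hx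
  have key : x ∈ side T j k ∧ x ∈ side T i j := by
    induction hx with
    | refl =>
      refine ⟨SimpleGraph.Reachable.refl _, mem_side_of_adj hj hjk fun h => hki ?_⟩
      have := Sym2.eq_iff.1 h
      have := hij.ne
      grind
    | @tail y z hy hyz ih =>
      obtain ⟨h1, h2⟩ := ih ((SimpleGraph.reachable_iff_reflTransGen _ _).2 hy)
      rw [SimpleGraph.deleteEdges_adj] at hyz
      refine ⟨mem_side_of_adj h1 hyz.1 hyz.2, mem_side_of_adj h2 hyz.1 fun h => ?_⟩
      rcases Sym2.eq_iff.1 h with ⟨rfl, rfl⟩ | ⟨rfl, rfl⟩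
      · exact notMem_side hT hij h2
      · exact notMem_side hT hjk h1
  exact key.2

open scoped Classical in
/-- Some node of a tree sees few of the points of `A` (mapped into the tree by `g`) in each
direction, unless some edge of the tree has many points on both sides. -/
theorem exists_center [Finite N] (hT : T.IsTree) (A : Finset α) (g : α → N) (c : ℕ)
    (h : ∀ i j, T.Adj i j → c ≤ (A.filter fun a => g a ∈ side T i j).card →
      (A.filter fun a => g a ∉ side T i j).card < c) :
    ∃ s, ∀ j, T.Adj s j → (A.filter fun a => g a ∈ side T s j).card < c := by
  by_contra! hno
  obtain ⟨s⟩ := hT.connected.nonempty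
  obtain ⟨j, hj⟩ := hno s
  -- a heavy arc with the least side
  obtain ⟨⟨i, j⟩, ⟨hij, hc⟩, hmin⟩ := (Set.toFinite {p : N × N | T.Adj p.1 p.2 ∧
    c ≤ (A.filter fun a => g a ∈ side T p.1 p.2).card}).exists_minimalFor
      (fun p => side T p.1 p.2) _ ⟨(s, j), hj⟩
  obtain ⟨k, hjk, hk⟩ := hno j
  have hlt := h i j hij hc
  by_cases hki : k = i
  · subst hki
    refine absurd (hk.trans (Finset.card_le_card ?_)) hlt.not_ge
    intro a
    simp only [Finset.mem_filter]
    exact fun ⟨h1, h2⟩ => ⟨h1, disjoint_side hT.isAcyclic hjk h2⟩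
  · have hs := side_ssubset hT.isAcyclic hij hjk hki
    exact hs.2 (hmin (j := (j, k)) ⟨hjk, hk⟩ hs.1)

open scoped Classical in
/-- If no edge of the tree has `c` points on both sides, there are few points altogether. -/
theorem card_le_of_no_balanced_edge [Finite N] (hT : T.IsTree) (A : Finset α) (g : α → N)
    (c d m : ℕ)
    (h : ∀ i j, T.Adj i j → c ≤ (A.filter fun a => g a ∈ side T i j).card →
      (A.filter fun a => g a ∉ side T i j).card < c)
    (hd : ∀ s, ∃ F : Finset N, F.card ≤ d ∧ ∀ j, T.Adj s j → j ∈ F)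
    (hm : ∀ s, (A.filter fun a => g a = s).card ≤ m) : A.card ≤ m + d * (c - 1) := by
  obtain ⟨s, hs⟩ := exists_center hT A g c h
  obtain ⟨F, hF, hadj⟩ := hd s
  have h1 : A ⊆ (A.filter fun a => g a = s) ∪
      (F.filter fun j => T.Adj s j).biUnion fun j => A.filter fun a => g a ∈ side T s j := by
    intro a ha
    by_cases hg : g a = s
    · simp [ha, hg]
    · obtain ⟨j, hj, hgj⟩ := exists_mem_side hT.connected hg
      refine Finset.mem_union_right _ (Finset.mem_biUnion.2 ⟨j, ?_⟩)
      simp [ha, hgj, hj, hadj j hj]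
  refine (Finset.card_le_card h1).trans ((Finset.card_union_le _ _).trans
    (Nat.add_le_add (hm s) ?_))
  refine (Finset.card_biUnion_le_card_mul _ _ (c - 1) fun j hj => ?_).trans
    (Nat.mul_le_mul_right _ ((Finset.card_filter_le _ _).trans hF))
  have := hs j (Finset.mem_filter.1 hj).2
  omega

end Tree

end MatchingAlgorithm

namespace MatchingAlgorithm

open FunProg

/-! ### Splitting a part along a tree-interval-membership decomposition -/

section Width

variable {n : ℕ} {G : TemporalGraph (Fin n)} {N : Type} (D : G.TIMDecomposition N)

/-- The undirected tree of the decomposition. -/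
abbrev tree : SimpleGraph N := SimpleGraph.fromRel D.T.Adj

/-- The bag of a node, as a set of numbers. -/
def numBag (i : N) : Finset ℕ := (D.bag i).image Fin.val

open scoped Classical in
/-- The node of the tree whose bag holds the appearance `x`. -/
noncomputable def home (x : Node) : N :=
  if h : ∃ i, D.time i = x.2 ∧ x.1 ∈ numBag D i then h.choose
  else D.isTree.connected.nonempty.some

theorem home_spec {x : Node} (hx : x ∈ nodes G) :
    D.time (home D x) = x.2 ∧ x.1 ∈ numBag D (home D x) := by
  rw [mem_nodes] at hx
  obtain ⟨i, ⟨h1, h2⟩, -⟩ := D.existsUnique_vertex ⟨x.1, hx.1⟩ x.2 hx.2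
  have h : ∃ i, D.time i = x.2 ∧ x.1 ∈ numBag D i :=
    ⟨i, h1, Finset.mem_image.2 ⟨_, h2, rfl⟩⟩
  rw [home, dif_pos h]
  exact h.choose_spec

theorem mem_nodes_of_mem_numBag {i : N} {v : ℕ} (hv : v ∈ numBag D i) :
    (v, D.time i) ∈ nodes G := by
  obtain ⟨w, -, rfl⟩ := Finset.mem_image.1 hv
  exact (mem_nodes G).2 ⟨w.2, D.time_mem i⟩

theorem eq_home {i : N} {v : ℕ} (hv : v ∈ numBag D i) : home D (v, D.time i) = i := by
  obtain ⟨h1, h2⟩ := home_spec D (mem_nodes_of_mem_numBag D hv)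
  obtain ⟨w, hw, rfl⟩ := Finset.mem_image.1 hv
  obtain ⟨w', hw', h3⟩ := Finset.mem_image.1 h2
  obtain rfl : w' = w := Fin.ext h3
  exact (D.existsUnique_vertex w' (D.time i) (D.time_mem i)).unique ⟨h1, hw'⟩ ⟨rfl, hw⟩

theorem card_numBag_le [Fintype N] (i : N) : (numBag D i).card ≤ D.width :=
  Finset.card_image_le.trans (Finset.le_sup (f := fun i => (D.bag i).card) (Finset.mem_univ i))

theorem tree_adj_iff {i j : N} : (tree D).Adj i j ↔ (∃ v ∈ numBag D i, v ∈ numBag D j) ∧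
    (D.time j = D.time i + 1 ∨ D.time i = D.time j + 1) := by
  have h : (∃ v ∈ numBag D i, v ∈ numBag D j) ↔ (D.bag i ∩ D.bag j).Nonempty := by
    constructor
    · rintro ⟨v, h1, h2⟩
      obtain ⟨w, hw, rfl⟩ := Finset.mem_image.1 h1
      obtain ⟨w', hw', h3⟩ := Finset.mem_image.1 h2
      obtain rfl : w' = w := Fin.ext h3
      exact ⟨w', Finset.mem_inter.2 ⟨hw, hw'⟩⟩
    · rintro ⟨w, hw⟩
      rw [Finset.mem_inter] at hw
      exact ⟨w, Finset.mem_image.2 ⟨w, hw.1, rfl⟩, Finset.mem_image.2 ⟨w, hw.2, rfl⟩⟩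
  rw [SimpleGraph.fromRel_adj, D.adj_iff, D.adj_iff, h, Finset.inter_comm (D.bag j)]
  constructor
  · rintro ⟨-, ⟨h1, h2⟩ | ⟨h1, h2⟩⟩
    · exact ⟨h1, .inl h2⟩
    · exact ⟨h1, .inr h2⟩
  · rintro ⟨h1, h2⟩
    refine ⟨?_, h2.imp (⟨h1, ·⟩) (⟨h1, ·⟩)⟩
    rintro rfl
    omega

/-- A time-edge lies in one bag, and the other wires run along the edges of the tree. -/
theorem home_wire {e : Wire} (he : e ∈ wires G) :
    (home D e.1 = home D e.2 ∧ e.1.2 = e.2.2) ∨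
      ((tree D).Adj (home D e.1) (home D e.2) ∧ e.2 = (e.1.1, e.1.2 + 1)) := by
  obtain ⟨h1, h2⟩ := mem_nodes_of_mem_wires G he
  obtain ⟨h3, h4⟩ := home_spec D h1
  obtain ⟨h5, h6⟩ := home_spec D h2
  rcases (mem_wires G).1 he with ⟨v, t, hv, ht, htl, rfl⟩ | ⟨u, v, -, t, ht, rfl⟩
  · refine .inr ⟨(tree_adj_iff D).2 ⟨⟨v, h4, h6⟩, .inl ?_⟩, rfl⟩
    rw [h3, h5]
  · obtain ⟨i, ⟨h7, h8⟩, -⟩ := D.existsUnique_timeEdge (s(u, v), t) ht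
    have hu : (u : ℕ) ∈ numBag D i := Finset.mem_image.2 ⟨u, h7 u (by simp), rfl⟩
    have hv : (v : ℕ) ∈ numBag D i := Finset.mem_image.2 ⟨v, h7 v (by simp), rfl⟩
    have e1 := eq_home D hu
    have e2 := eq_home D hv
    simp only at h8
    rw [h8] at e1 e2
    exact .inl ⟨e1.trans e2.symm, rfl⟩

variable [Fintype N]

/-- Few wires are attached to a node. -/
theorem length_delta_singleton_le {x : Node} (hx : x ∈ nodes G) :
    (delta (wires G) [x]).length ≤ D.width + 2 := by
  classical
  have hE := isWiring_wires G
  have hnd : (delta (wires G) [x]).Nodup := hE.nodup.filter _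
  rw [← List.toFinset_card_of_nodup hnd]
  obtain ⟨hx1, hx2⟩ := home_spec D hx
  -- a wire is determined by its other end, which is in the same bag or an adjacent appearance
  let F : Finset Node := (numBag D (home D x)).image (fun v => (v, x.2)) ∪
    {(x.1, x.2 - 1), (x.1, x.2 + 1)}
  have hF : F.card ≤ D.width + 2 := (Finset.card_union_le _ _).trans
    (Nat.add_le_add (Finset.card_image_le.trans (card_numBag_le D _)) Finset.card_le_two)
  refine le_trans (Finset.card_le_card_of_injOn (fun e => if e.1 = x then e.2 else e.1) ?_ ?_) hF
  · intro e he
    rw [Finset.mem_coe, List.mem_toFinset, mem_delta_singleton] at he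
    obtain ⟨he, hx'⟩ := he
    obtain ⟨h1, h2⟩ := mem_nodes_of_mem_wires G he
    obtain ⟨h3, h4⟩ := home_spec D h1
    obtain ⟨h5, h6⟩ := home_spec D h2
    dsimp only
    rcases home_wire D he with ⟨h7, h8⟩ | ⟨-, h7⟩
    · refine Finset.mem_union_left _ (Finset.mem_image.2 ?_)
      split
      · next h => exact ⟨e.2.1, by rwa [← h, h7], by rw [← h, h8]⟩
      · next h =>
        obtain rfl := hx'.resolve_left h
        exact ⟨e.1.1, by rwa [← h7], by rw [← h8]⟩
    · refine Finset.mem_union_right _ ?_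
      split
      · next h => simp [h7, ← h]
      · next h =>
        obtain rfl := hx'.resolve_left h
        simp [h7]
  · intro e he e' he' h
    rw [Finset.mem_coe, List.mem_toFinset, mem_delta_singleton] at he he'
    have s1 := hE.swap_notMem e he.1
    have n1 := hE.ne e he.1
    have n2 := hE.ne e' he'.1
    obtain ⟨a, b⟩ := e
    obtain ⟨a', b'⟩ := e'
    dsimp only at *
    by_cases h1 : a = x <;> by_cases h2 : a' = x
    · simp_all
    · simp only [h1, h2, if_true, if_false] at h he'
      grind
    · simp only [h1, h2, if_true, if_false] at h he'
      grind
    · grind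

/-- A node of the tree has few neighbours. -/
theorem exists_neighbors (s : N) :
    ∃ F : Finset N, F.card ≤ 2 * D.width ∧ ∀ j, (tree D).Adj s j → j ∈ F := by
  classical
  refine ⟨(numBag D s).image (fun v => home D (v, D.time s + 1)) ∪
    (numBag D s).image (fun v => home D (v, D.time s - 1)), ?_, fun j hj => ?_⟩
  · refine (Finset.card_union_le _ _).trans ?_
    rw [two_mul]
    exact Nat.add_le_add (Finset.card_image_le.trans (card_numBag_le D _))
      (Finset.card_image_le.trans (card_numBag_le D _))
  · obtain ⟨⟨v, h1, h2⟩, h3⟩ := (tree_adj_iff D).1 hj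
    have h4 := eq_home D h2
    rcases h3 with h3 | h3
    · refine Finset.mem_union_left _ (Finset.mem_image.2 ⟨v, h1, ?_⟩)
      rw [← h3, h4]
    · refine Finset.mem_union_right _ (Finset.mem_image.2 ⟨v, h1, ?_⟩)
      rw [h3, Nat.add_sub_cancel, h4]

open scoped Classical in
/-- Few wires run from one side of an edge of the tree to the other. -/
theorem length_cut_le {i j : N} (p : Wire → Bool)
    (hp : ∀ e, p e = true → ¬(home D e.1 ∈ side (tree D) i j ↔ home D e.2 ∈ side (tree D) i j)) :
    ((wires G).filter p).length ≤ D.width := by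
  have hnd : ((wires G).filter p).Nodup := (isWiring_wires G).nodup.filter _
  rw [← List.toFinset_card_of_nodup hnd]
  have key : ∀ e ∈ (wires G).filter p, e.1.1 ∈ numBag D i ∧ e.2 = (e.1.1, e.1.2 + 1) ∧
      ((e.1.2 = D.time i ∧ e.2.2 = D.time j) ∨ (e.1.2 = D.time j ∧ e.2.2 = D.time i)) := by
    intro e he
    obtain ⟨he, hpe⟩ := List.mem_filter.1 he
    obtain ⟨h1, h2⟩ := mem_nodes_of_mem_wires G he
    obtain ⟨h3, h4⟩ := home_spec D h1
    obtain ⟨h5, h6⟩ := home_spec D h2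
    have hne := hp e hpe
    rcases home_wire D he with ⟨h7, -⟩ | ⟨h7, h8⟩
    · rw [h7] at hne
      exact absurd Iff.rfl hne
    · by_cases hs : s(home D e.1, home D e.2) = s(i, j)
      · rcases Sym2.eq_iff.1 hs with ⟨h9, h10⟩ | ⟨h9, h10⟩
        · rw [h9] at h3 h4
          rw [h10] at h5
          exact ⟨h4, h8, .inl ⟨h3.symm, h5.symm⟩⟩
        · rw [h9] at h3
          rw [h10] at h5 h6
          rw [h8] at h6
          exact ⟨h6, h8, .inr ⟨h3.symm, h5.symm⟩⟩
      · refine absurd ⟨fun h => mem_side_of_adj h h7 hs, fun h => mem_side_of_adj h h7.symm ?_⟩ hne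
        rwa [Sym2.eq_swap]
  refine le_trans (Finset.card_le_card_of_injOn (fun e => e.1.1) ?_ ?_) (card_numBag_le D i)
  · intro e he
    exact (key e (List.mem_toFinset.1 he)).1
  · intro e he e' he' h
    obtain ⟨-, h1, h2⟩ := key e (List.mem_toFinset.1 he)
    obtain ⟨-, h3, h4⟩ := key e' (List.mem_toFinset.1 he')
    obtain ⟨⟨a, b⟩, c⟩ := e
    obtain ⟨⟨a', b'⟩, c'⟩ := e'
    dsimp only at *
    subst h1 h3 h
    simp only [Prod.mk.injEq, true_and] at *
    omega

/-- The end in `U` of a wire that leaves `U`. -/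
def innerEnd (U : List Node) (e : Wire) : Node := if e.1 ∈ U then e.1 else e.2

theorem innerEnd_spec {U : List Node} {e : Wire} (he : crosses U e = true) :
    innerEnd U e ∈ U ∧ (e.1 = innerEnd U e ∨ e.2 = innerEnd U e) ∧
      ∀ x ∈ U, (e.1 = x ∨ e.2 = x) → x = innerEnd U e := by
  unfold crosses at he
  unfold innerEnd
  by_cases h1 : e.1 ∈ U <;> by_cases h2 : e.2 ∈ U <;> simp_all <;> grind

open scoped Classical in
/-- If the wires that leave `U` are not distributed evenly to the two sides of some edge of the
tree, there are few of them. -/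
theorem length_delta_le {U : List Node} (hU : U ⊆ nodes G)
    (h : ∀ i j, (tree D).Adj i j →
      D.width ≤ ((delta (wires G) U).filter fun e =>
        decide (home D (innerEnd U e) ∈ side (tree D) i j)).length →
      ((delta (wires G) U).filter fun e =>
        !decide (home D (innerEnd U e) ∈ side (tree D) i j)).length < D.width) :
    (delta (wires G) U).length ≤ 3 * D.width ^ 2 := by
  have hnd : (delta (wires G) U).Nodup := (isWiring_wires G).nodup.filter _
  have key : ∀ p : Wire → Bool, ((delta (wires G) U).filter p).length =
      ((delta (wires G) U).toFinset.filter fun e => p e = true).card := by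
    intro p
    rw [← List.toFinset_card_of_nodup (hnd.filter _), List.toFinset_filter]
  have h1 := card_le_of_no_balanced_edge (T := tree D) D.isTree (delta (wires G) U).toFinset
    (fun e => home D (innerEnd U e)) D.width (2 * D.width) (D.width * (D.width + 2)) ?_
    (exists_neighbors D) ?_
  · rw [List.toFinset_card_of_nodup hnd] at h1
    rcases Nat.eq_zero_or_pos D.width with h0 | h0
    · simp_all
    · obtain ⟨w, hw⟩ : ∃ w, D.width = w + 1 := ⟨D.width - 1, by omega⟩
      rw [hw] at h1 ⊢
      refine h1.trans (le_of_eq ?_)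
      rw [Nat.add_sub_cancel]
      ring
  · intro i j hij hc
    have := h i j hij
    rw [key, key] at this
    simp only [decide_eq_true_eq, Bool.not_eq_true', decide_eq_false_iff_not] at this
    exact this hc
  · intro s
    have h2 : ((delta (wires G) U).toFinset.filter fun e => home D (innerEnd U e) = s) ⊆
        (numBag D s).biUnion fun v => (delta (wires G) [(v, D.time s)]).toFinset := by
      intro e he
      simp only [Finset.mem_filter, List.mem_toFinset, mem_delta] at he
      obtain ⟨⟨he, hc⟩, hs⟩ := he
      obtain ⟨h3, h4, -⟩ := innerEnd_spec hc
      obtain ⟨h5, h6⟩ := home_spec D (hU h3)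
      rw [hs] at h5 h6
      refine Finset.mem_biUnion.2 ⟨_, h6, ?_⟩
      rw [List.mem_toFinset, mem_delta_singleton, h5]
      exact ⟨he, h4⟩
    refine (Finset.card_le_card h2).trans ((Finset.card_biUnion_le_card_mul _ _ (D.width + 2)
      fun v hv => ?_).trans (Nat.mul_le_mul_right _ (card_numBag_le D s)))
    exact (List.toFinset_card_le _).trans
      (length_delta_singleton_le D (mem_nodes_of_mem_numBag D hv))

end Width

theorem length_filter_le_add {l : List Wire} {p q r : Wire → Bool}
    (h : ∀ e ∈ l, p e = true → q e = true ∨ r e = true) :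
    (l.filter p).length ≤ (l.filter q).length + (l.filter r).length := by
  induction l with
  | nil => simp
  | cons a l ih =>
    have h1 := ih fun e he => h e (List.mem_cons_of_mem _ he)
    have h2 := h a List.mem_cons_self
    cases hp : p a <;> cases hq : q a <;> cases hr : r a <;> simp_all <;> omega

/-- If the budget suffices, all sublists are listed (reversed). -/
theorem reverse_filter_mem_subsets {bud : List ℕ} {d : List Wire} (p : Wire → Bool)
    (h : 2 ^ d.length ≤ bud.length) : (d.filter p).reverse ∈ subsets bud d := by
  have key : (subsets bud d).length = 2 ^ d.length ∧ (d.filter p).reverse ∈ subsets bud d := by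
    induction d using List.reverseRecOn with
    | nil => simp [subsets]
    | append_singleton d e ih =>
      rw [List.length_append, List.length_singleton, pow_succ] at h
      obtain ⟨h1, h2⟩ := ih (by omega)
      have h3 : subsets bud (d ++ [e]) =
          subsets bud d ++ (subsets bud d).map fun a => e :: a := by
        unfold subsets at h1 ⊢
        rw [List.foldl_append, List.foldl_cons, List.foldl_nil, List.take_of_length_le]
        rw [List.length_append, List.length_map, h1]
        omega
      rw [h3]
      constructor
      · rw [List.length_append, List.length_map, h1, List.length_append, List.length_singleton,
          pow_succ]
        omega
      · cases hp : p e <;> simp_all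
  exact key.2

open scoped Classical in
/-- A part that many wires leave can be split along an edge of the tree; from any other part a single
node can be split off. The limit `K` leaves room for the at most `φ + 2` wires at that node, in
addition to the `3 φ ^ 2` wires of `length_delta_le`. -/
theorem splits_ne_nil {n : ℕ} {G : TemporalGraph (Fin n)} {N : Type} [Fintype N]
    (D : G.TIMDecomposition N) (hw : 1 ≤ D.width) {iters bud : List ℕ} {K : ℕ}
    (hK : K = 6 * D.width ^ 2) (hi : D.width < iters.length) (hbud : 2 ^ K ≤ bud.length)
    {U : List Node} (hnd : U.Nodup) (hU : U ⊆ nodes G) (hlen : 2 ≤ U.length)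
    (hd : (delta (wires G) U).length ≤ K) : splits (wires G) iters bud K U ≠ [] := by
  suffices h : ∃ p ∈ candidates (wires G) iters bud U, p.1 ≠ [] ∧ p.2 ≠ [] ∧
      (delta (wires G) p.1).length ≤ K ∧ (delta (wires G) p.2).length ≤ K by
    obtain ⟨p, hp, h1, h2, h3, h4⟩ := h
    refine List.ne_nil_of_mem (List.mem_filter.2 ⟨hp, ?_⟩ : p ∈ splits _ _ _ _ _)
    simp [isGood, h1, h2, h3, h4]
  by_cases hgood : ∃ i j, (tree D).Adj i j ∧
      D.width ≤ ((delta (wires G) U).filter fun e =>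
        decide (home D (innerEnd U e) ∈ side (tree D) i j)).length ∧
      D.width ≤ ((delta (wires G) U).filter fun e =>
        !decide (home D (innerEnd U e) ∈ side (tree D) i j)).length
  · obtain ⟨i, j, hij, hc1, hc2⟩ := hgood
    set X : Node → Bool := fun x => decide (home D x ∈ side (tree D) i j)
    -- the wires that leave `U` on the side of `j`, as the enumeration lists them
    set A := ((delta (wires G) U).filter fun e => X (innerEnd U e)).reverse with hA
    set B := (delta (wires G) U).filter fun e => !decide (e ∈ A) with hB
    have hsub : A ∈ subsets bud (delta (wires G) U) :=
      reverse_filter_mem_subsets _ ((Nat.pow_le_pow_right two_pos hd).trans hbud)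
    have memA : ∀ e, e ∈ A ↔ (e ∈ wires G ∧ crosses U e = true) ∧ X (innerEnd U e) = true := by
      intro e
      rw [hA, List.mem_reverse, List.mem_filter, mem_delta]
    have memB : ∀ e, e ∈ B ↔ (e ∈ wires G ∧ crosses U e = true) ∧ X (innerEnd U e) = false := by
      intro e
      rw [hB, List.mem_filter, mem_delta, Bool.not_eq_true', decide_eq_false_iff_not, memA]
      grind
    have hBeq : B = (delta (wires G) U).filter fun e => !X (innerEnd U e) := by
      refine List.filter_congr fun e he => ?_
      have := memA e
      rw [mem_delta] at he
      grind
    have mem_term : ∀ (L : List Wire) x, x ∈ terminals U L ↔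
        x ∈ U ∧ ∃ e ∈ L, e.1 = x ∨ e.2 = x := by
      intro L x
      simp [terminals]
    have hlenA : D.width ≤ A.length := by
      rw [hA, List.length_reverse]
      exact hc1
    have hlenB : D.width ≤ B.length := by
      rw [hBeq]
      exact hc2
    have hsum : A.length + B.length ≤ K := by
      have h1 := List.length_eq_length_filter_add (l := delta (wires G) U)
        (fun e => X (innerEnd U e))
      rw [hA, List.length_reverse, hBeq]
      omega
    have hsep : Separates (terminals U A) (terminals U B) X := by
      constructor
      · intro x hx
        obtain ⟨hxU, e, he, hex⟩ := (mem_term _ _).1 hx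
        rw [memA] at he
        rw [(innerEnd_spec he.1.2).2.2 x hxU hex]
        exact he.2
      · intro x hx
        obtain ⟨hxU, e, he, hex⟩ := (mem_term _ _).1 hx
        rw [memB] at he
        rw [(innerEnd_spec he.1.2).2.2 x hxU hex]
        exact he.2
    have hcut : ((wires G).filter fun e => (decide (e.1 ∈ U) && decide (e.2 ∈ U)) &&
        Bool.xor (X e.1) (X e.2)).length ≤ D.width := by
      refine length_cut_le D (i := i) (j := j) _ fun e he => ?_
      simp only [X, Bool.and_eq_true, bne_iff_ne, Bool.xor] at he
      grind
    obtain ⟨hS1, hS2, hS3⟩ := flowCut_spec (isWiring_wires G) hi hsep hcut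
    set S := flowCut (wires G) iters U A
    have hSU : ∀ x ∈ S, x ∈ U := fun x hx => (List.mem_filter.1 hx).1
    have endA : ∀ e ∈ A, innerEnd U e ∈ S := by
      intro e he
      have := innerEnd_spec ((memA e).1 he).1.2
      exact hS1 _ ((mem_term _ _).2 ⟨this.1, e, he, this.2.1⟩)
    have endB : ∀ e ∈ B, innerEnd U e ∉ S := by
      intro e he
      have := innerEnd_spec ((memB e).1 he).1.2
      exact hS2 _ ((mem_term _ _).2 ⟨this.1, e, he, this.2.1⟩)
    have lenA : ((wires G).filter fun e => decide (e ∈ A)).length ≤ A.length := by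
      refine List.Subperm.length_le (List.subperm_of_subset
        ((isWiring_wires G).nodup.filter _) fun e he => ?_)
      simpa using (List.mem_filter.1 he).2
    have lenB : ((wires G).filter fun e => decide (e ∈ B)).length ≤ B.length := by
      refine List.Subperm.length_le (List.subperm_of_subset
        ((isWiring_wires G).nodup.filter _) fun e he => ?_)
      simpa using (List.mem_filter.1 he).2
    refine ⟨_, List.mem_cons_of_mem _ (List.mem_map.2 ⟨A, hsub, rfl⟩), ?_, ?_, ?_, ?_⟩
    · obtain ⟨e, he⟩ := List.exists_mem_of_length_pos (l := A) (by omega)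
      exact List.ne_nil_of_mem (endA e he)
    · obtain ⟨e, he⟩ := List.exists_mem_of_length_pos (l := B) (by omega)
      refine List.ne_nil_of_mem (a := innerEnd U e) (List.mem_filter.2 ⟨?_, ?_⟩)
      · exact (innerEnd_spec ((memB e).1 he).1.2).1
      · simpa using endB e he
    · refine (length_filter_le_add (q := fun e => decide (e ∈ A)) (r := _) ?_).trans
        ((Nat.add_le_add lenA hS3).trans (by omega))
      intro e he hc
      by_cases h1 : e.1 ∈ U ∧ e.2 ∈ U
      · right
        simpa [h1.1, h1.2, crosses] using hc
      · left
        have h3 := hSU e.1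
        have h4 := hSU e.2
        have h5 := endB e
        rw [memB] at h5
        rw [decide_eq_true_eq, memA]
        unfold crosses at hc h5 ⊢
        unfold innerEnd at h5 ⊢
        by_cases h6 : e.1 ∈ U <;> by_cases h7 : e.2 ∈ U <;> grind
    · refine (length_filter_le_add (q := fun e => decide (e ∈ B)) (r := _) ?_).trans
        ((Nat.add_le_add lenB hS3).trans (by omega))
      intro e he hc
      simp only [crosses, List.mem_filter] at hc
      by_cases h1 : e.1 ∈ U ∧ e.2 ∈ U
      · right
        simpa [h1.1, h1.2] using hc
      · left
        have h5 := endA e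
        rw [memA] at h5
        rw [decide_eq_true_eq, memB]
        unfold crosses at h5 ⊢
        unfold innerEnd at h5 ⊢
        by_cases h6 : e.1 ∈ U <;> by_cases h7 : e.2 ∈ U <;> grind
  · push Not at hgood
    have h1 := length_delta_le D hU hgood
    have hw2 : D.width ≤ D.width ^ 2 := Nat.le_self_pow two_ne_zero _
    obtain ⟨x, U', rfl⟩ : ∃ x U', U = x :: U' := by
      cases U with
      | nil => simp at hlen
      | cons x U' => exact ⟨x, U', rfl⟩
    have h2 := length_delta_singleton_le D (hU List.mem_cons_self)
    refine ⟨_, List.mem_cons_self, ?_, ?_, ?_, ?_⟩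
    · simp
    · rintro h
      replace h : U' = [] := h
      simp [h] at hlen
    · simp only [List.take_succ_cons, List.take_zero]
      omega
    · rw [List.tail_cons]
      have h3 : (delta (wires G) U').length ≤
          (delta (wires G) (x :: U')).length + (delta (wires G) [x]).length := by
        refine length_filter_le_add fun e he hc => ?_
        have hx := (List.nodup_cons.1 hnd).1
        unfold crosses at hc ⊢
        simp only [List.mem_cons, List.not_mem_nil, or_false]
        grind
      exact h3.trans (by omega)

end MatchingAlgorithm

namespace FunProg

open Enc (enc)

/-! ### Loops in polynomial time -/

section

variable {α β σ : Type} [Enc α] [Enc β] [Enc σ]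

theorem Ev.letIn {P : Program} {ρ : List Data} {a b : Term} {x y : Data} {k l : ℕ}
    (h : Ev P ρ a x k) (h' : Ev P (x :: ρ) b y l) : Ev P ρ (.letIn a b) y (k + l + 1) := by
  obtain ⟨i, hi, h⟩ := h
  obtain ⟨j, hj, h'⟩ := h'
  exact ⟨_, by omega, .letIn h h'⟩

/-- A loop that repeats `step` until `test` succeeds, which happens after `k` rounds, takes polynomial
time if `k` and the measures `M` of the states are polynomially bounded. -/
theorem FPT.loop {N k B : α → ℕ} {M : σ → ℕ} {init : α → σ} {test : σ → Bool} {step : σ → σ}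
    (hi : FPT N init) (ht : FPT M test) (hs : FPT M step) (hk : PolyBdd N k) (hB : PolyBdd N B)
    (hM : ∀ x, ∀ j ≤ k x, M (step^[j] (init x)) ≤ B x)
    (hsz : PolyBdd M sz) (hfalse : ∀ x, ∀ j < k x, test (step^[j] (init x)) = false)
    (htrue : ∀ x, test (step^[k x] (init x)) = true) :
    FPT N (fun x => step^[k x] (init x)) := by
  obtain ⟨Pi, Ti, hTi, -, hi⟩ := hi
  obtain ⟨P, T, ⟨d, hT⟩, -, hP⟩ := ht.prodMk hs
  obtain ⟨d', hsz⟩ := hsz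
  set L : Term := .letIn (.call (2 + Pi.length) (.var 0))
    (.ite (.fst (.var 0)) (.var 1) (.call 1 (.snd (.var 0)))) with hL
  set A : Program := [.call 1 (.call 2 (.var 0)), L] with hA
  set R : Program := A ++ (Pi.map (Term.shift 2) ++ P.map (Term.shift (2 + Pi.length))) with hR
  let S : α → ℕ := fun x => (B x + 2) ^ d
  have hS : PolyBdd N S := (hB.add (.const 2)).pow d
  refine ⟨R, fun x => 1 + Ti x + (k x + 1) * (S x + 20) + 2, ?_, ?_, fun x => ?_⟩
  · exact (((PolyBdd.const 1).add hTi).add ((hk.add (.const 1)).mul (hS.add (.const 20)))).add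
      (.const 2)
  · exact ((hB.add (.const 2)).pow d').mono fun x => (hsz _).trans
      (Nat.pow_le_pow_left (Nat.add_le_add_right (hM x _ le_rfl) 2) d')
  · have key : ∀ i j, j + i = k x →
        Ev R [enc (step^[j] (init x))] (.call 1 (.var 0)) (enc (step^[k x] (init x)))
          ((i + 1) * (S x + 20)) := by
      intro i
      induction i with
      | zero =>
        rintro j rfl
        set s := step^[k x] (init x) with hsdef
        have h1 := Ev.link_right (A := A) (P := Pi.map (Term.shift 2)) (hP s)
        simp only [List.length_map] at h1
        have h2 := Ev.call (Eval.arg (x := enc s)).ev h1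
        have hT' : T s ≤ S x := (hT s).trans
          (Nat.pow_le_pow_left (Nat.add_le_add_right (hM x _ (by omega)) 2) d)
        have ht' : test s = true := htrue x
        rw [ht'] at h2
        have h3 : Ev R [enc (true, step s), enc s] (.fst (.var 0)) (.num 1) 2 :=
          (Eval.fst (x := enc (true, step s)) (.var rfl)).ev
        refine (Ev.callBody (b := L) rfl (h2.letIn (h3.iteTrue (by simp) (Eval.var rfl).ev))).mono ?_
        omega
      | succ i ih =>
        intro j hj
        have ih := ih (j + 1) (by omega)
        rw [Function.iterate_succ_apply'] at ih
        set s := step^[j] (init x) with hsdef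
        have h1 := Ev.link_right (A := A) (P := Pi.map (Term.shift 2)) (hP s)
        simp only [List.length_map] at h1
        have h2 := Ev.call (Eval.arg (x := enc s)).ev h1
        have hT' : T s ≤ S x := (hT s).trans
          (Nat.pow_le_pow_left (Nat.add_le_add_right (hM x _ (by omega)) 2) d)
        have ht' : test s = false := hfalse x j (by omega)
        rw [ht'] at h2
        have h3 : Ev R [enc (false, step s), enc s] (.fst (.var 0)) (.num 0) 2 :=
          (Eval.fst (x := enc (false, step s)) (.var rfl)).ev
        have h4 : Ev R [enc (false, step s), enc s] (.snd (.var 0)) (enc (step s)) 2 :=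
          (Eval.snd (x := enc (false, step s)) (.var rfl)).ev
        refine (Ev.callBody (b := L) rfl (h2.letIn (h3.iteFalse (Ev.call h4 ih)))).mono ?_
        rw [add_mul (i + 1) 1, one_mul]
        omega
    have h1 := Ev.link_left (A := A) (Q := P.map (Term.shift (2 + Pi.length))) (hi x)
    have h2 := key (k x) 0 (by omega)
    exact Ev.callBody (b := .call 1 (.call 2 (.var 0))) rfl
      (Ev.call (Ev.call (Eval.arg (x := enc x)).ev h1) h2)

/-- The numbers below `f x`, by counting down; the time depends on the value of `f x`. -/
theorem FPT.range {N f : α → ℕ} (hf : FPT N f) (hb : PolyBdd N f) :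
    FPT N (fun x => List.range (f x)) := by
  let step : ℕ × List ℕ → ℕ × List ℕ := fun s => (s.1 - 1, (s.1 - 1) :: s.2)
  have key : ∀ m j, j ≤ m → step^[j] (m, []) = (m - j, List.range' (m - j) j) := by
    intro m j
    induction j with
    | zero => simp
    | succ j ih =>
      intro hj
      rw [Function.iterate_succ_apply', ih (by omega)]
      simp only [step, List.range'_succ, Prod.mk.injEq, List.cons.injEq]
      refine ⟨by omega, by omega, ?_⟩
      rw [show m - (j + 1) + 1 = m - j by omega]
  have hsz : ∀ l : List ℕ, sz l = 2 * l.length + 1 := by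
    intro l
    induction l with
    | nil => simp
    | cons a l ih =>
      simp only [sz_cons, sz_nat, List.length_cons]
      omega
  have h := FPT.loop (N := N) (k := f) (B := fun x => 2 * f x + 3) (M := sz)
    (init := fun x => (f x, ([] : List ℕ))) (test := fun s : ℕ × List ℕ => decide (s.1 = 0))
    (step := step) (hf.prodMk (FPT.comp_fp (g := fun _ : ℕ => ([] : List ℕ)) (FP.const _) hf))
    (show FP _ by fun_prop) (show FP _ by unfold step; fun_prop) hb
    (((PolyBdd.const 2).mul hb).add (.const 3)) ?_ .self ?_ ?_
  · have := FPT.comp_fp (g := fun s : ℕ × List ℕ => s.2) (by fun_prop) h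
    refine (funext fun x => ?_ : (fun x => List.range (f x)) = _) ▸ this
    rw [key _ _ le_rfl, Nat.sub_self, List.range_eq_range']
  · intro x j hj
    rw [key _ _ hj]
    simp only [sz_prod, sz_nat, hsz, List.length_range']
    omega
  · intro x j hj
    rw [key _ _ hj.le]
    simp only [decide_eq_false_iff_not]
    omega
  · intro x
    rw [key _ _ le_rfl]
    simp

end

end FunProg

namespace MatchingAlgorithm

open FunProg

/-! ### Existence of decompositions -/

section Exists

variable {n : ℕ} {G : TemporalGraph (Fin n)}

theorem isTree_path (m : ℕ) :
    (SimpleGraph.fromRel fun i j : Fin (m + 1) => (j : ℕ) = i + 1).IsTree := by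
  have hadj : ∀ i j : Fin (m + 1), (SimpleGraph.fromRel fun i j : Fin (m + 1) =>
      (j : ℕ) = i + 1).Adj i j ↔ (j : ℕ) = i + 1 ∨ (i : ℕ) = j + 1 := by
    intro i j
    rw [SimpleGraph.fromRel_adj, and_iff_right_iff_imp]
    rintro h rfl
    omega
  refine ⟨?_, ?_⟩
  · refine (SimpleGraph.pathGraph_connected m).mono fun i j h => ?_
    rw [SimpleGraph.pathGraph_adj] at h
    rw [hadj]
    omega
  · rw [SimpleGraph.isAcyclic_iff_forall_adj_isBridge]
    -- the removal of the edge between `a` and `a + 1` leaves no way past `a`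
    have key : ∀ i j : Fin (m + 1), (j : ℕ) = i + 1 → ∀ x,
        ((SimpleGraph.fromRel fun i j : Fin (m + 1) => (j : ℕ) = i + 1).deleteEdges
          {s(i, j)}).Reachable i x → x ≤ i := by
      intro i j hij x hx
      rw [SimpleGraph.reachable_iff_reflTransGen] at hx
      induction hx with
      | refl => exact le_rfl
      | @tail y z _ hyz ih =>
        rw [SimpleGraph.deleteEdges_adj, hadj, Set.mem_singleton_iff] at hyz
        obtain ⟨h1, h2⟩ := hyz
        by_contra hz
        rw [Fin.le_def] at ih hz
        refine h2 ?_
        have e1 : y = i := Fin.ext (by omega)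
        have e2 : z = j := Fin.ext (by omega)
        rw [e1, e2]
    intro i j h
    rcases (hadj i j).1 h with h | h
    · refine SimpleGraph.isBridge_iff.2 fun hr => ?_
      have := key i j h j hr
      rw [Fin.le_def] at this
      omega
    · refine SimpleGraph.isBridge_iff.2 fun hr => ?_
      rw [Sym2.eq_swap] at hr
      have := key j i h i hr.symm
      rw [Fin.le_def] at this
      omega

/-- All vertices in one bag for each time. -/
theorem exists_timDecomposition (hG : G.timeEdges.Nonempty) :
    ∃ (N : Type) (_ : Fintype N), Nonempty (G.TIMDecomposition N) := by
  obtain ⟨⟨e, t⟩, he⟩ := hG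
  replace he : t ∈ G.label e := he
  have h1 := G.one_le_of_mem_label e t he
  have h2 := le_lifetime G he
  obtain ⟨m, hm⟩ : ∃ m, G.lifetime = m + 1 := ⟨G.lifetime - 1, by omega⟩
  obtain ⟨v, -, -, -⟩ := exists_ordered G he
  refine ⟨Fin (m + 1), inferInstance, ⟨{
    T := ⟨fun i j => (j : ℕ) = i + 1⟩
    bag := fun _ => Finset.univ
    time := fun i => i + 1
    time_mem := ?_
    existsUnique_vertex := ?_
    existsUnique_timeEdge := ?_
    adj_iff := ?_
    isTree := isTree_path m }⟩⟩
  · intro i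
    exact ⟨by omega, by omega⟩
  · intro v t ht
    rw [hm] at ht
    refine ⟨⟨t - 1, by grind⟩, ⟨by grind, Finset.mem_univ v⟩, ?_⟩
    rintro i ⟨hi, -⟩
    exact Fin.ext (by simp; omega)
  · rintro ⟨e, t⟩ ht
    have h1 := G.one_le_of_mem_label e t ht
    have h2 := le_lifetime G ht
    refine ⟨⟨t - 1, by omega⟩, ⟨by simp, by simp; omega⟩, ?_⟩
    rintro i ⟨-, hi⟩
    exact Fin.ext (by simp at hi ⊢; omega)
  · intro i j
    rw [Finset.inter_self]
    have : (Finset.univ : Finset (Fin n)).Nonempty := ⟨v, Finset.mem_univ v⟩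
    simp only [this, true_and]
    omega

theorem exists_width_eq_timWidth (hG : G.timeEdges.Nonempty) :
    ∃ (N : Type) (_ : Fintype N) (D : G.TIMDecomposition N), D.width = G.timWidth := by
  obtain ⟨N, hN, ⟨D⟩⟩ := exists_timDecomposition hG
  exact Nat.sInf_mem (s := {w | ∃ (N : Type) (_ : Fintype N) (D : G.TIMDecomposition N),
    D.width = w}) ⟨_, N, hN, D, rfl⟩

/-- Some bag holds both ends of a time-edge. -/
theorem two_le_timWidth (hG : G.timeEdges.Nonempty) : 2 ≤ G.timWidth := by
  obtain ⟨N, hN, D, hD⟩ := exists_width_eq_timWidth hG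
  obtain ⟨⟨e, t⟩, he⟩ := hG
  obtain ⟨u, v, huv, rfl⟩ := exists_ordered G he
  obtain ⟨i, ⟨h1, -⟩, -⟩ := D.existsUnique_timeEdge _ he
  rw [← hD]
  refine le_trans ?_ (Finset.le_sup (f := fun i => (D.bag i).card) (Finset.mem_univ i))
  rw [← Finset.card_pair huv.ne]
  refine Finset.card_le_card fun w hw => h1 w ?_
  simpa using hw

end Exists

/-! ### The algorithm: all widths in turn -/

/-- The state of the main loop: the numbers below `Δ`, the nodes, the wires, and the current guess
for the width, in unary. -/
abbrev LoopState := (List ℕ × List Node × List Wire) × List ℕ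

/-- The number of wires that may leave a part, six times the square of the guess, in unary. -/
def wireLimit (s : LoopState) : List ℕ :=
  s.2.flatMap fun _ => s.2.flatMap fun _ => [0, 0, 0, 0, 0, 0]

@[fun_prop]
theorem fp_wireLimit : FP wireLimit := by
  unfold wireLimit
  fun_prop

theorem length_wireLimit (s : LoopState) : (wireLimit s).length = 6 * s.2.length ^ 2 := by
  simp [wireLimit, List.length_flatMap]
  ring

/-- The limit for the lengths of lists, in unary: the number of assignments of values to as many
wires as may leave a part. -/
def budget (s : LoopState) : List ℕ :=
  (wireLimit s).foldl (fun L _ => L.flatMap fun _ => 0 :: s.1.1) [0]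

theorem length_foldl_flatMap (dl l L : List ℕ) :
    (l.foldl (fun L _ => L.flatMap fun _ => 0 :: dl) L).length =
      L.length * (dl.length + 1) ^ l.length := by
  induction l generalizing L with
  | nil => simp
  | cons a l ih =>
    rw [List.foldl_cons, ih, List.length_cons, pow_succ]
    simp [List.length_flatMap]
    ring

theorem length_budget (s : LoopState) :
    (budget s).length = (s.1.1.length + 1) ^ (6 * s.2.length ^ 2) := by
  rw [budget, length_foldl_flatMap, length_wireLimit, List.length_singleton, one_mul]

/-- The time of one attempt is polynomial in this quantity. -/
def loopMeasure (s : LoopState) : ℕ := sz s + (s.1.1.length + 1) ^ (6 * s.2.length ^ 2)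

theorem sz_list_nat (l : List ℕ) : sz l = 2 * l.length + 1 := by
  induction l with
  | nil => simp
  | cons a l ih =>
    simp only [sz_cons, sz_nat, List.length_cons]
    omega

theorem polyBdd_loopMeasure_sz : PolyBdd loopMeasure sz :=
  PolyBdd.self.mono fun _ => Nat.le_add_right _ _

theorem fpt_budget : FPT loopMeasure budget := by
  have hsz := polyBdd_loopMeasure_sz
  refine FPT.foldl (f := fun s L _ => L.flatMap fun _ => 0 :: s.1.1) (i := fun _ => [0])
    (M := fun s => 2 * (s.1.1.length + 1) ^ (6 * s.2.length ^ 2) + 1) (by fun_prop)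
    ((FP.const _).fpt hsz) (fp_wireLimit.fpt hsz) hsz ?_ ?_
  · exact (((PolyBdd.const 2).mul .self).add (.const 1)).mono fun s =>
      Nat.add_le_add_right (Nat.mul_le_mul_left 2 (Nat.le_add_left _ _)) 1
  · intro s l hl
    rw [sz_list_nat, length_foldl_flatMap, List.length_singleton, one_mul]
    refine Nat.add_le_add_right (Nat.mul_le_mul_left 2 (Nat.pow_le_pow_right (by omega) ?_)) 1
    exact hl.length_le.trans (length_wireLimit s).le

/-- The decomposition for the current guess. -/
def attempt (s : LoopState) : SplitState :=
  decompose s.1.2.1 s.1.2.2 (0 :: s.2) (budget s) (wireLimit s).length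

theorem fpt_attempt : FPT loopMeasure attempt := by
  have h : FP fun p : LoopState × List ℕ =>
      decompose p.1.1.2.1 p.1.1.2.2 (0 :: p.1.2) p.2 (wireLimit p.1).length := by
    have : FP fun p : LoopState × List ℕ => wireLimit p.1 := fp_wireLimit.comp (by fun_prop)
    fun_prop
  have := FPT.comp_fp h ((FP.id'.fpt polyBdd_loopMeasure_sz).prodMk fpt_budget)
  exact this

/-- Whether the decomposition succeeds for the current guess. -/
def succeeds (s : LoopState) : Bool :=
  (attempt s).1 && (attempt s).2.1.isEmpty

theorem fpt_succeeds : FPT loopMeasure succeeds :=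
  FPT.comp_fp (g := fun a : SplitState => a.1 && a.2.1.isEmpty) (by fun_prop) fpt_attempt

/-- The next guess. -/
def nextGuess (s : LoopState) : LoopState := (s.1, 0 :: s.2)

theorem fp_nextGuess : FP nextGuess := by
  unfold nextGuess
  fun_prop

theorem iterate_nextGuess (c : List ℕ × List Node × List Wire) (j : ℕ) :
    nextGuess^[j] (c, []) = (c, List.replicate j 0) := by
  induction j with
  | zero => rfl
  | succ j ih => rw [Function.iterate_succ_apply', ih, nextGuess, List.replicate_succ]

/-- Whether the table for all nodes has an entry of at least the given value. No wire leaves the set of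
all nodes, so its assignments are empty. -/
def answer (p : LoopState × ℕ) : Bool :=
  ((evaluate p.1.1.2.2 p.1.1.1 (p.1.1.1.length - 1) (budget p.1) (attempt p.1).2.2 []).headD
    []).any fun q => decide (p.2 ≤ q.2)

theorem fpt_answer : FPT (fun p => loopMeasure p.1 + 2) answer := by
  have h : FP fun p : (LoopState × ℕ) × List ℕ × SplitState =>
      ((evaluate p.1.1.1.2.2 p.1.1.1.1 (p.1.1.1.1.length - 1) p.2.1 p.2.2.2.2 []).headD
        []).any fun q => decide (p.1.2 ≤ q.2) := by
    fun_prop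
  have hm : PolyBdd (fun p : LoopState × ℕ => loopMeasure p.1 + 2) fun p => loopMeasure p.1 :=
    PolyBdd.self.mono fun _ => Nat.le_add_right _ _
  have hsz : PolyBdd (fun p : LoopState × ℕ => loopMeasure p.1 + 2) sz :=
    PolyBdd.self.mono fun p => by
      simp only [sz_prod, sz_nat, loopMeasure]
      omega
  have h1 : FPT (fun p : LoopState × ℕ => loopMeasure p.1 + 2) fun p => p.1 :=
    FP.fpt (by fun_prop) hsz
  have := FPT.comp_fp h ((FP.id'.fpt hsz).prodMk
    ((FPT.comp fpt_budget h1 hm).prodMk (FPT.comp fpt_attempt h1 hm)))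
  exact this

end MatchingAlgorithm

namespace MatchingAlgorithm

open FunProg

/-! ### The algorithm on the encoded instances -/

/-- The instances of the decision problem. -/
structure MatchingInstance where
  /-- the number of vertices -/
  n : ℕ
  /-- the temporal graph -/
  G : TemporalGraph (Fin n)
  /-- the distance in time -/
  Δ : ℕ
  /-- the size of the matching -/
  h : ℕ
  nonempty : G.timeEdges.Nonempty
  one_le : 1 ≤ Δ

noncomputable instance : Enc MatchingInstance := ⟨fun x => x.G.encodeInstance x.Δ x.h⟩

namespace MatchingInstance

/-- The quantity in which the running time is polynomial. -/
noncomputable def bound (x : MatchingInstance) : ℕ :=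
  x.n * x.G.lifetime * (x.G.timWidth * x.Δ) ^ x.G.timWidth ^ 3

section Bounds

variable (x : MatchingInstance)

theorem one_le_lifetime : 1 ≤ x.G.lifetime := by
  obtain ⟨⟨e, t⟩, he⟩ := x.nonempty
  exact (x.G.one_le_of_mem_label e t he).trans (le_lifetime x.G he)

theorem one_le_n : 1 ≤ x.n := by
  obtain ⟨⟨e, t⟩, he⟩ := x.nonempty
  obtain ⟨u, -, -, -⟩ := exists_ordered x.G he
  have := u.2
  omega

theorem two_le_width : 2 ≤ x.G.timWidth := two_le_timWidth x.nonempty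

theorem succ_le_width_mul : x.Δ + 1 ≤ x.G.timWidth * x.Δ := by
  have h1 := Nat.mul_le_mul_right x.Δ x.two_le_width
  have h2 := x.one_le
  omega

theorem mul_lifetime_le_bound : x.n * x.G.lifetime ≤ x.bound :=
  Nat.le_mul_of_pos_right _ (pow_pos (by have := x.succ_le_width_mul; omega) _)

theorem n_le_bound : x.n ≤ x.bound :=
  (Nat.le_mul_of_pos_right _ x.one_le_lifetime).trans x.mul_lifetime_le_bound

theorem lifetime_le_bound : x.G.lifetime ≤ x.bound :=
  (Nat.le_mul_of_pos_left _ x.one_le_n).trans x.mul_lifetime_le_bound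

theorem pow_le_bound : (x.G.timWidth * x.Δ) ^ x.G.timWidth ^ 3 ≤ x.bound :=
  Nat.le_mul_of_pos_left _ (Nat.mul_pos x.one_le_n x.one_le_lifetime)

theorem width_mul_le_bound : x.G.timWidth * x.Δ ≤ x.bound :=
  (Nat.le_self_pow (pow_pos (by have := x.two_le_width; omega) _).ne' _).trans x.pow_le_bound

theorem width_le_bound : x.G.timWidth ≤ x.bound :=
  (Nat.le_mul_of_pos_right _ x.one_le).trans x.width_mul_le_bound

theorem budget_le_bound {p : ℕ} (hp : p ≤ x.G.timWidth) :
    (x.Δ + 1) ^ (6 * p ^ 2) ≤ x.bound ^ 6 := by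
  have h1 := x.two_le_width
  have h2 : 6 * p ^ 2 ≤ x.G.timWidth ^ 3 * 6 := by
    have h3 : p ^ 2 ≤ x.G.timWidth ^ 2 := Nat.pow_le_pow_left hp 2
    have h4 : x.G.timWidth ^ 2 ≤ x.G.timWidth ^ 3 := Nat.pow_le_pow_right (by omega) (by omega)
    omega
  calc (x.Δ + 1) ^ (6 * p ^ 2) ≤ (x.G.timWidth * x.Δ) ^ (6 * p ^ 2) :=
        Nat.pow_le_pow_left x.succ_le_width_mul _
    _ ≤ (x.G.timWidth * x.Δ) ^ (x.G.timWidth ^ 3 * 6) :=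
        Nat.pow_le_pow_right (by have := x.succ_le_width_mul; omega) h2
    _ = ((x.G.timWidth * x.Δ) ^ x.G.timWidth ^ 3) ^ 6 := pow_mul _ _ _
    _ ≤ x.bound ^ 6 := Nat.pow_le_pow_left x.pow_le_bound 6

end Bounds

/-- The input as nested tuples and lists. -/
noncomputable def input (x : MatchingInstance) : ℕ × ℕ × ℕ × List (ℕ × ℕ × List ℕ) :=
  (x.n, x.Δ, x.h, inputList x.G)

/-- The encoding of an instance is that of nested tuples and lists. -/
theorem enc_input (x : MatchingInstance) : Enc.enc x.input = Enc.enc x := by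
  have : Enc.enc x.input =
      .pair (.num x.n) (.pair (.num x.Δ) (.pair (.num x.h) (Enc.enc (inputList x.G)))) := rfl
  rw [this, enc_inputList]
  rfl

theorem polyBdd_sz : PolyBdd bound (sz : MatchingInstance → ℕ) := by
  have h1 : PolyBdd bound fun x : MatchingInstance => x.n := .mono .self n_le_bound
  have h2 : PolyBdd bound fun x : MatchingInstance => x.G.lifetime := .mono .self lifetime_le_bound
  refine (((h1.mul h1).mul (((PolyBdd.const 2).mul h2).add (.const 8))).add (.const 7)).mono
    fun x => ?_
  have h3 : sz x = sz x.input := by rw [sz, sz, enc_input]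
  have h4 : ∀ q ∈ inputList x.G, sz q ≤ 2 * x.G.lifetime + 7 := by
    intro q hq
    have h5 : q.2.2.length ≤ x.G.lifetime + 1 := by
      unfold inputList at hq
      obtain ⟨p, -, rfl⟩ := List.mem_map.1 hq
      exact (List.length_filter_le _ _).trans List.length_range.le
    have h6 := sz_list_nat q.2.2
    rw [sz_prod, sz_prod, sz_nat, sz_nat, h6]
    omega
  have h6 : (inputList x.G).length ≤ x.n * x.n := by
    unfold inputList
    rw [List.length_map]
    refine (List.length_filter_le _ _).trans ?_
    exact (List.length_product _ _).trans (by rw [List.length_finRange]) |>.le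
  have h7 : sz (inputList x.G) ≤ (inputList x.G).length * (2 * x.G.lifetime + 8) + 1 :=
    sz_le_of_forall_le h4
  have h8 := Nat.mul_le_mul_right (2 * x.G.lifetime + 8) h6
  rw [h3]
  simp only [input, sz_prod, sz_nat]
  omega

theorem fpt_input : FPT bound input := by
  have h : FP input :=
    .of_term (.var 0) 1 (fun x => by rw [enc_input]; exact (Eval.arg (x := Enc.enc x)).ev) 0
      fun x => by rw [sz, sz, enc_input]; exact le_rfl
  exact h.fpt polyBdd_sz

/-- The list of the numbers below `Δ`, the nodes and the wires. -/
noncomputable def context (x : MatchingInstance) : List ℕ × List Node × List Wire :=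
  (List.range x.Δ, nodes x.G, wires x.G)

theorem fpt_context : FPT bound context := by
  have hn : FPT bound fun x : MatchingInstance => x.n :=
    FPT.comp_fp (g := fun p : ℕ × ℕ × ℕ × List (ℕ × ℕ × List ℕ) => p.1) (by fun_prop) fpt_input
  have hΔ : FPT bound fun x : MatchingInstance => x.Δ :=
    FPT.comp_fp (g := fun p : ℕ × ℕ × ℕ × List (ℕ × ℕ × List ℕ) => p.2.1) (by fun_prop) fpt_input
  have hL : FPT bound fun x : MatchingInstance => inputList x.G :=
    FPT.comp_fp (g := fun p : ℕ × ℕ × ℕ × List (ℕ × ℕ × List ℕ) => p.2.2.2) (by fun_prop) fpt_input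
  have hm : FPT bound fun x : MatchingInstance => x.G.lifetime := by
    have h : FP fun L : List (ℕ × ℕ × List ℕ) => maxTime L := by
      unfold maxTime
      exact FP.foldl (f := fun _ m t => m + (t - m)) (g := fun _ => 0) (by fun_prop) (by fun_prop)
        (by fun_prop) (.const 0) (by simp)
    refine (funext fun x => ?_ : (fun x : MatchingInstance => x.G.lifetime) = _) ▸
      FPT.comp_fp h hL
    rw [maxTime_inputList]
  have hΔb : PolyBdd bound fun x : MatchingInstance => x.Δ :=
    PolyBdd.self.mono fun x => (Nat.le_succ _).trans (x.succ_le_width_mul.trans x.width_mul_le_bound)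
  have h1 := (FPT.range hΔ hΔb).prodMk (((FPT.range hn (.mono .self n_le_bound)).prodMk
    (FPT.range hm (.mono .self lifetime_le_bound))).prodMk hL)
  have h2 : FP fun p : List ℕ × (List ℕ × List ℕ) × List (ℕ × ℕ × List ℕ) =>
      (p.1, nodeList p.2.1.1 (p.2.1.2.map fun t => t + 1),
        stayWires p.2.1.1 (p.2.1.2.map fun t => t + 1) ++ edgeWires p.2.2) := by
    unfold nodeList stayWires edgeWires
    fun_prop
  have h3 : ∀ m, (List.range m).map (fun t => t + 1) = List.range' 1 m := by
    intro m
    simp only [List.range'_eq_map_range, add_comm]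
  refine (funext fun x => ?_ : context = _) ▸ FPT.comp_fp h2 h1
  simp only [h3]
  rfl

variable (x : MatchingInstance)

/-- The state of the main loop for the guess `p`. -/
noncomputable def state (p : ℕ) : LoopState := (x.context, List.replicate p 0)

theorem nodes_ne_nil : nodes x.G ≠ [] :=
  List.ne_nil_of_mem (a := (0, 1)) ((mem_nodes x.G).2 ⟨x.one_le_n, le_rfl, x.one_le_lifetime⟩)

theorem length_budget_state (p : ℕ) : (budget (x.state p)).length = (x.Δ + 1) ^ (6 * p ^ 2) := by
  rw [length_budget]
  simp [state, context]

/-- The decomposition succeeds once the guess is the width. -/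
theorem succeeds_timWidth : succeeds (x.state x.G.timWidth) = true := by
  obtain ⟨N, hN, D, hD⟩ := exists_width_eq_timWidth x.nonempty
  have h1 := x.two_le_width
  have h2 := x.one_le
  have hlen : (wireLimit (x.state x.G.timWidth)).length = 6 * x.G.timWidth ^ 2 := by
    rw [length_wireLimit]
    simp [state]
  have h3 := decompose_complete (V := nodes x.G) (E := wires x.G)
    (iters := 0 :: (x.state x.G.timWidth).2) (bud := budget (x.state x.G.timWidth))
    (K := (wireLimit (x.state x.G.timWidth)).length) (b := x.Δ + 1) (nodup_nodes x.G)
    x.nodes_ne_nil (by simp [delta_nodes]) (by omega)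
    (by rw [hlen, length_budget_state]) fun U hU hUV hU2 hUK => ?_
  · unfold succeeds
    rw [Bool.and_eq_true, List.isEmpty_iff]
    exact h3
  · refine splits_ne_nil D (by omega) (by rw [hlen, hD]) ?_ ?_ hU hUV hU2 hUK
    · simp [state, hD]
    · rw [hlen, length_budget_state]
      exact Nat.pow_le_pow_left (by omega) _

theorem exists_succeeds : ∃ p, succeeds (x.state p) = true := ⟨_, x.succeeds_timWidth⟩

/-- The first guess for which the decomposition succeeds. It may be smaller than the width. -/
noncomputable def guess : ℕ := Nat.find x.exists_succeeds

theorem succeeds_guess : succeeds (x.state x.guess) = true := Nat.find_spec x.exists_succeeds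

theorem guess_le : x.guess ≤ x.G.timWidth := Nat.find_min' x.exists_succeeds x.succeeds_timWidth

theorem not_succeeds {p : ℕ} (hp : p < x.guess) : succeeds (x.state p) = false :=
  Bool.eq_false_iff.2 (Nat.find_min x.exists_succeeds hp)

theorem fpt_state_guess : FPT bound fun x => x.state x.guess := by
  have h0 : FPT bound fun x : MatchingInstance => (x.context, ([] : List ℕ)) :=
    FPT.comp_fp (g := fun c : List ℕ × List Node × List Wire => (c, ([] : List ℕ)))
      (by fun_prop) fpt_context
  have h1 : PolyBdd bound fun x : MatchingInstance =>
      sz x.context + (2 * x.bound + 2) + x.bound ^ 6 :=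
    (fpt_context.size.add (((PolyBdd.const 2).mul .self).add (.const 2))).add (PolyBdd.self.pow 6)
  have h := FPT.loop (k := guess) h0 fpt_succeeds (fp_nextGuess.fpt polyBdd_loopMeasure_sz)
    (PolyBdd.self.mono fun x => x.guess_le.trans x.width_le_bound) h1 ?_ polyBdd_loopMeasure_sz
    ?_ ?_
  · simp only [iterate_nextGuess] at h
    exact h
  · intro x p hp
    rw [iterate_nextGuess]
    have h2 := x.budget_le_bound (hp.trans x.guess_le)
    have h3 := (hp.trans x.guess_le).trans x.width_le_bound
    have h4 : x.context.1.length = x.Δ := List.length_range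
    simp only [loopMeasure, sz_prod x.context, sz_prod (x.context, _), sz_list_nat,
      List.length_replicate, h4] at h2 ⊢
    omega
  · intro x p hp
    rw [iterate_nextGuess]
    exact x.not_succeeds hp
  · intro x
    rw [iterate_nextGuess]
    exact x.succeeds_guess

/-- The answer is correct for any guess for which the decomposition succeeds. -/
theorem answer_iff : answer (x.state x.guess, x.h) = true ↔ x.G.HasTemporalMatching x.Δ x.h := by
  have h1 := x.succeeds_guess
  have h2 := x.one_le
  unfold succeeds at h1
  rw [Bool.and_eq_true, List.isEmpty_iff] at h1
  have hlen : (x.state x.guess).1.1.length = x.Δ := List.length_range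
  obtain ⟨T, hT, hTab⟩ := decompose_sound (V := nodes x.G) (E := wires x.G)
    (iters := 0 :: (x.state x.guess).2) (bud := budget (x.state x.guess))
    (K := (wireLimit (x.state x.guess)).length) (b := x.Δ + 1) (dl := List.range x.Δ)
    (D := x.Δ - 1) (nodup_nodes x.G) x.nodes_ne_nil (by simp [delta_nodes])
    (fun r hr => by rw [List.mem_range] at hr; omega) (by omega) (by omega)
    (by rw [length_wireLimit, length_budget_state]; simp [state]) h1.1 h1.2
  rw [hasTemporalMatching_iff h2 hTab]
  unfold answer
  rw [hlen]
  have hT' : evaluate (x.state x.guess).1.2.2 (x.state x.guess).1.1 (x.Δ - 1)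
    (budget (x.state x.guess)) (attempt (x.state x.guess)).2.2 [] = [T] := hT
  simp only [hT']
  simp

theorem fpt_answer_guess : FPT bound fun x => answer (x.state x.guess, x.h) := by
  have hh : FPT bound fun x : MatchingInstance => x.h :=
    FPT.comp_fp (g := fun p : ℕ × ℕ × ℕ × List (ℕ × ℕ × List ℕ) => p.2.2.1) (by fun_prop) fpt_input
  refine FPT.comp fpt_answer (fpt_state_guess.prodMk hh) ?_
  refine ((fpt_state_guess.size.add (PolyBdd.self.pow 6)).add (.const 2)).mono fun x => ?_
  have h1 := x.budget_le_bound x.guess_le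
  have h2 : (x.state x.guess).1.1.length = x.Δ := List.length_range
  have h3 : (x.state x.guess).2.length = x.guess := List.length_replicate
  simp only [loopMeasure, h2, h3]
  omega

end MatchingInstance

end MatchingAlgorithm

open MatchingAlgorithm in
/-- There is one program that solves `Δ`-Temporal Matching in time
`(n Λ) ^ O(1) * (φ Δ) ^ O(φ ^ 3)`, where the input temporal graph has `n` vertices, lifetime `Λ` and
TIM width `φ`. -/
theorem mainTheorem10 :
    ∃ (P : FunProg.Program) (C a b : ℕ),
      ∀ (n : ℕ) (G : TemporalGraph (Fin n)) (Δ h : ℕ), G.timeEdges.Nonempty → 1 ≤ Δ →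
        P.DecidesWithin (G.encodeInstance Δ h) (G.HasTemporalMatching Δ h)
          (C * (n * G.lifetime) ^ a * (G.timWidth * Δ) ^ (b * G.timWidth ^ 3)) := by
  obtain ⟨P, T, ⟨d, hT⟩, -, hP⟩ := MatchingInstance.fpt_answer_guess
  refine ⟨P, 1, 2 * d, 2 * d, fun n G Δ h hG hΔ => ?_⟩
  let x : MatchingInstance := ⟨n, G, Δ, h, hG, hΔ⟩
  obtain ⟨k, hk, hev⟩ := hP x
  have hle : k ≤ 1 * (n * G.lifetime) ^ (2 * d) * (G.timWidth * Δ) ^ (2 * d * G.timWidth ^ 3) := by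
    -- as `x.bound` is at least `2`, the additive constant is absorbed by squaring
    have h2 : 2 ≤ x.bound := x.two_le_width.trans x.width_le_bound
    calc k ≤ (x.bound + 2) ^ d := hk.trans (hT x)
      _ ≤ (x.bound ^ 2) ^ d := Nat.pow_le_pow_left (by nlinarith) d
      _ = _ := by
        rw [one_mul, ← pow_mul, mul_comm (2 * d) (G.timWidth ^ 3), pow_mul _ (G.timWidth ^ 3),
          ← mul_pow]
        rfl
  refine ⟨k, hle, fun hQ => ?_, fun hQ => ?_⟩
  · have h1 : answer (x.state x.guess, x.h) = true := x.answer_iff.2 hQ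
    simp only [h1] at hev
    exact hev
  · have h1 : answer (x.state x.guess, x.h) = false :=
      Bool.eq_false_iff.2 fun h => hQ (x.answer_iff.1 h)
    simp only [h1] at hev
    exact hev
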